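/- Let $n\ge 0$ and let $\mathcal R$ be a Lipschitz Riemannian $n$-manifold without boundary (orientability is not required), that is, a Hausdorff second-countable topological $n$-manifold with an atlas $\mathcal A$ whose transition maps are locally bilipschitz, together with, for every chart $\phi\in\mathcal A$, a measurable Riemannian metric on the corresponding domain of $\mathbb R^n$ which is a.e. uniformly comparable to the Euclidean metric with a constant $C_\phi$, such that the metrics of any two charts are a.e. related by pull-back under the transition map. Let $\operatorname{vol}_g$ be the Riemannian volume measure. A bilipschitz chart is a chart whose transition maps to and from the charts of $\mathcal A$ are locally bilipschitz. A closed subset $N$ of a Lipschitz $m$-manifold is a *closed Lipschitz $m$-submanifold* if around each of its boundary points there is a bilipschitz chart in which the interior of $N$, the complement of $N$ and the boundary of $N$ correspond to $\{x_m>0\}$, $\{x_m<0\}$ and $\{x_m=0\}$. Let $M$ be a closed Lipschitz $n$-submanifold of $\mathcal R$, and let $D$ be a closed Lipschitz $(n-1)$-submanifold of the Lipschitz $(n-1)$-manifold $\partial M$; the cases $D=\emptyset$ and $\partial M=\emptyset$ are allowed. Let $k\ge 0$ and $\mathbb K\in\{\mathbb Z,\mathbb R\}$. A Lipschitz $k$-chain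 is a finite formal sum $\sigma=\sum_i a_i\sigma_i$, $a_i\in\mathbb K$, of distinct singular simplices $\sigma_i\colon\Delta_k\to\mathcal R$ which are Lipschitz in charts, where $\Delta_k\subset\mathbb R^k$ is the closed standard simplex. Let $C_k^{\mathrm{lip}}(A;\mathbb K)$ be the chains whose simplices have image in $A$, and let $$H_k^{\mathrm{lip}}(M,D;\mathbb K)=\frac{\{\sigma\in C_k^{\mathrm{lip}}(M;\mathbb K):\partial\sigma\in C_{k-1}^{\mathrm{lip}}(D;\mathbb K)\}}{C_k^{\mathrm{lip}}(D;\mathbb K)+\partial C_{k+1}^{\mathrm{lip}}(M;\mathbb K)}$$ (with no condition on $\partial\sigma$ if $k=0$), so that a class $c$ is a family of Lipschitz chains. For each singular Lipschitz $k$-simplex $\sigma$ let $\mu_\sigma$ be a surface measure defined by charts: divide $\Delta_k$ into finitely many closed pieces $T_i$, overlapping only in null sets, such that $\sigma(T_i)$ lies in the domain of a bilipschitz chart $\varphi_i$ with values in $\mathbb R^n$, and let $\mu_\sigma$ be the sum over $i$ of the images under $\sigma$ of the measures $\sqrt{\det(D(\varphi_i\circ\sigma)^TD(\varphi_i\circ\sigma))}\,dx$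 on $T_i$. For a chain put $\mu_{\sum a_i\sigma_i}=\sum|a_i|\mu_{\sigma_i}$. Different choices give comparable measures. A family $\Sigma$ of Lipschitz $k$-chains is *$p$-exceptional* if, for some such choice of the measures $\mu_\sigma$ (equivalently, for every choice), $$\operatorname{Mod}_p(\Sigma)=\inf\Big\{\int_{\mathcal R}f^p\,d\operatorname{vol}_g : f\colon\mathcal R\to[0,\infty]\text{ Borel},\ \int f\,d\mu_\sigma\ge 1\text{ for all }\sigma\in\Sigma\Big\}=0 .$$ Then for every $p\in(1,\infty)$, every $k\ge 0$ and each $\mathbb K\in\{\mathbb Z,\mathbb R\}$, no homology class $c\in H_k^{\mathrm{lip}}(M,D;\mathbb K)$ is $p$-exceptional. -/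

import Mathlib

open Set Filter Topology MeasureTheory
open scoped ENNReal NNReal Manifold

noncomputable section

/-! ### Lipschitz manifolds -/

/-- Maps between open subsets of `ℝⁿ` that are locally Lipschitz. -/
def lipschitzPregroupoid (n : ℕ) : Pregroupoid (EuclideanSpace ℝ (Fin n)) where
  property f s := LocallyLipschitzOn s f
  comp {f g u v} hf hg _ _ _ := by
    intro x hx
    obtain ⟨K, t, ht, hK⟩ := hf hx.1
    obtain ⟨L, w, hw, hL⟩ := hg (x := f x) hx.2
    have hc : ContinuousWithinAt f (u ∩ f ⁻¹' v) x :=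
      (hf.continuousOn x hx.1).mono inter_subset_left
    have hm : MapsTo f (u ∩ f ⁻¹' v) v := fun y hy => hy.2
    have hw' : f ⁻¹' w ∈ 𝓝[u ∩ f ⁻¹' v] x := hc.tendsto_nhdsWithin hm hw
    have ht' : t ∈ 𝓝[u ∩ f ⁻¹' v] x := nhdsWithin_mono x inter_subset_left ht
    exact ⟨L * K, t ∩ f ⁻¹' w, inter_mem ht' hw',
      hL.comp (hK.mono inter_subset_left) (fun y hy => hy.2)⟩
  id_mem := LipschitzWith.id.locallyLipschitz.locallyLipschitzOn
  locality {f u} hu H := by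
    intro x hx
    obtain ⟨v, hv, hxv, h⟩ := H x hx
    obtain ⟨K, t, ht, hK⟩ := h ⟨hx, hxv⟩
    refine ⟨K, t, ?_, hK⟩
    rw [(hu.inter hv).nhdsWithin_eq ⟨hx, hxv⟩] at ht
    exact mem_nhdsWithin_of_mem_nhds ht
  congr {f g u} _ hfg hf := by
    intro x hx
    obtain ⟨K, t, ht, hK⟩ := hf hx
    refine ⟨K, t ∩ u, inter_mem ht self_mem_nhdsWithin, ?_⟩
    intro y hy z hz
    rw [hfg y hy.2, hfg z hz.2]
    exact hK hy.1 hz.1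

/-- The groupoid of homeomorphisms between open subsets of `ℝⁿ` that are locally Lipschitz with
locally Lipschitz inverse. A Lipschitz `n`-manifold (without boundary) is a charted space over `ℝⁿ`
whose atlas is compatible with this groupoid. -/
def lipschitzGroupoid (n : ℕ) : StructureGroupoid (EuclideanSpace ℝ (Fin n)) :=
  (lipschitzPregroupoid n).groupoid

/-- The (bi-)Lipschitz charts of `R`: all charts that are compatible with the atlas of `R`. Charts
go from `R` to `ℝⁿ`. -/
def lipCharts (n : ℕ) (R : Type*) [TopologicalSpace R] [ChartedSpace (EuclideanSpace ℝ (Fin n)) R] :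
    Set (OpenPartialHomeomorph R (EuclideanSpace ℝ (Fin n))) :=
  (lipschitzGroupoid n).maximalAtlas R

/-- A Lipschitz Riemannian metric: for every chart `φ` of the atlas, a measurable field of inner
products on the chart domain `φ.target ⊆ ℝⁿ` which is uniformly comparable to the Euclidean one, such
that the fields of two charts are a.e. related by pull-back under the transition map. -/
structure LipRiemannianMetric (n : ℕ) (R : Type*) [TopologicalSpace R]
    [ChartedSpace (EuclideanSpace ℝ (Fin n)) R] where
  /-- The metric in the chart `φ`. -/
  inChart : atlas (EuclideanSpace ℝ (Fin n)) R → EuclideanSpace ℝ (Fin n) →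
    EuclideanSpace ℝ (Fin n) →L[ℝ] EuclideanSpace ℝ (Fin n) →L[ℝ] ℝ
  aemeasurable : ∀ φ v w, AEMeasurable (fun x => inChart φ x v w) (volume.restrict φ.1.target)
  symm : ∀ φ, ∀ᵐ x ∂volume.restrict φ.1.target, ∀ v w, inChart φ x v w = inChart φ x w v
  comparable : ∀ φ, ∃ C : ℝ, 1 ≤ C ∧ ∀ᵐ x ∂volume.restrict φ.1.target, ∀ v,
    C⁻¹ * ‖v‖ ^ 2 ≤ inChart φ x v v ∧ inChart φ x v v ≤ C * ‖v‖ ^ 2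
  compatible : ∀ φ ψ, ∀ᵐ x ∂volume.restrict (ψ.1.symm.trans φ.1).source, ∀ v w,
    inChart φ (φ.1 (ψ.1.symm x)) (fderiv ℝ (φ.1 ∘ ψ.1.symm) x v) (fderiv ℝ (φ.1 ∘ ψ.1.symm) x w) =
      inChart ψ x v w

/-- The density `√(det gᵢⱼ)` of the Riemannian volume in the chart `φ`. -/
def LipRiemannianMetric.density {n : ℕ} {R : Type*} [TopologicalSpace R]
    [ChartedSpace (EuclideanSpace ℝ (Fin n)) R] (g : LipRiemannianMetric n R)
    (φ : atlas (EuclideanSpace ℝ (Fin n)) R) (x : EuclideanSpace ℝ (Fin n)) : ℝ≥0∞ :=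
  ENNReal.ofReal (√(Matrix.of fun i j : Fin n =>
    g.inChart φ x (EuclideanSpace.single i 1) (EuclideanSpace.single j 1)).det)

/-- The Riemannian volume measure on the domain of the chart `φ`, as a measure on `R`: the image of
`√(det g) dx` under `φ⁻¹`. -/
def LipRiemannianMetric.chartVol {n : ℕ} {R : Type*} [TopologicalSpace R] [MeasurableSpace R]
    [ChartedSpace (EuclideanSpace ℝ (Fin n)) R] (g : LipRiemannianMetric n R)
    (φ : atlas (EuclideanSpace ℝ (Fin n)) R) : Measure R :=
  ((volume.restrict φ.1.target).withDensity (g.density φ)).map φ.1.symm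

/-- The Riemannian volume measure on `R`. By the change of variables formula the measures
`g.chartVol φ` agree on the overlaps of charts; their supremum is the measure on `R` which restricts
to `g.chartVol φ` on the domain of each chart `φ`. -/
def LipRiemannianMetric.vol {n : ℕ} {R : Type*} [TopologicalSpace R] [MeasurableSpace R]
    [ChartedSpace (EuclideanSpace ℝ (Fin n)) R] (g : LipRiemannianMetric n R) : Measure R :=
  ⨆ φ, g.chartVol φ

/-! ### Lipschitz submanifolds -/

/-- The last coordinate of a point of `ℝⁿ` (with value `0` in the degenerate case `n = 0`). -/
def lastCoord : (n : ℕ) → EuclideanSpace ℝ (Fin n) → ℝ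
  | 0, _ => 0
  | n + 1, x => x (Fin.last n)

/-- `N` is a closed Lipschitz `n`-submanifold of an `n`-dimensional Lipschitz manifold `X` whose
bilipschitz charts are given by the set `A`: the set `N` is closed and around every boundary point
there is a bilipschitz chart which maps the interior of `N`, the complement of `N` and the boundary
of `N` to the upper half-space, the lower half-space and the hyperplane `xₙ = 0`, respectively. -/
def IsClosedLipSubmanifold {X : Type*} [TopologicalSpace X] {n : ℕ}
    (A : Set (OpenPartialHomeomorph X (EuclideanSpace ℝ (Fin n)))) (N : Set X) : Prop :=
  IsClosed N ∧ ∀ x ∈ frontier N, ∃ φ ∈ A, x ∈ φ.source ∧ ∀ y ∈ φ.source,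
    (y ∈ interior N ↔ 0 < lastCoord n (φ y)) ∧
    (y ∉ N ↔ lastCoord n (φ y) < 0) ∧
    (y ∈ frontier N ↔ lastCoord n (φ y) = 0)

/-- `f` is bilipschitz on a neighbourhood in `s` of each point of `s`. -/
def LocallyBilipschitzOn {X Y : Type*} [PseudoMetricSpace X] [PseudoMetricSpace Y]
    (s : Set X) (f : X → Y) : Prop :=
  ∀ x ∈ s, ∃ t ∈ 𝓝[s] x, ∃ K : ℝ, 0 < K ∧ ∀ y ∈ t, ∀ z ∈ t,
    K⁻¹ * dist y z ≤ dist (f y) (f z) ∧ dist (f y) (f z) ≤ K * dist y z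

/-- The bilipschitz charts of the `(n-1)`-manifold `∂M`, for a Lipschitz submanifold `M` of `R`:
homeomorphisms `ψ` between open subsets of `∂M` and of `ℝⁿ⁻¹` such that `φ ∘ ψ⁻¹` is locally
bilipschitz for every bilipschitz chart `φ` of `R`. If `φ` is a boundary chart of `M`, then its
restriction to `∂M` takes values in `{xₙ = 0}`, isometric to `ℝⁿ⁻¹`, so this is compatibility with the
atlas of `∂M` formed by the restrictions of the boundary charts. -/
def boundaryLipCharts (n : ℕ) {R : Type*} [TopologicalSpace R]
    [ChartedSpace (EuclideanSpace ℝ (Fin n)) R] (M : Set R) :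
    Set (OpenPartialHomeomorph (frontier M) (EuclideanSpace ℝ (Fin (n - 1)))) :=
  {ψ | ∀ φ ∈ lipCharts n R, LocallyBilipschitzOn
    (ψ.target ∩ {x | (ψ.symm x : R) ∈ φ.source}) (fun x => φ (ψ.symm x : R))}

/-! ### Singular Lipschitz chains -/

/-- The closed standard simplex in `ℝᵏ`, with vertices `0, e₁, …, eₖ`. -/
def stdSimplexR (k : ℕ) : Set (EuclideanSpace ℝ (Fin k)) :=
  {x | (∀ i, 0 ≤ x i) ∧ ∑ i, x i ≤ 1}

/-- The `i`-th face map: insert `0` as the `i`-th barycentric coordinate. The barycentric coordinates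
of `x` are `(1 - ∑ xⱼ, x₁, …, xₖ)`. -/
def faceMap {k : ℕ} (i : Fin (k + 2)) (x : EuclideanSpace ℝ (Fin k)) :
    EuclideanSpace ℝ (Fin (k + 1)) :=
  WithLp.toLp 2 (Fin.tail
    (i.insertNth (α := fun _ => ℝ) 0 (Fin.cons (α := fun _ => ℝ) (1 - ∑ j, x j) x)))

lemma faceMap_mem {k : ℕ} (i : Fin (k + 2)) {x : EuclideanSpace ℝ (Fin k)}
    (hx : x ∈ stdSimplexR k) : faceMap i x ∈ stdSimplexR (k + 1) := by
  set b : Fin (k + 1) → ℝ := Fin.cons (α := fun _ => ℝ) (1 - ∑ j, x j) x with hb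
  set c : Fin (k + 2) → ℝ := i.insertNth (α := fun _ => ℝ) 0 b with hc
  have hb0 : ∀ j, 0 ≤ b j := by
    intro j
    refine Fin.cases ?_ (fun j => ?_) j
    · simpa [hb] using hx.2
    · simpa [hb] using hx.1 j
  have hc0 : ∀ j, 0 ≤ c j := by
    intro j
    refine Fin.succAboveCases i ?_ (fun j => ?_) j
    · simp [hc]
    · simpa [hc] using hb0 j
  have hsum : ∑ j, c j = 1 := by
    rw [Fin.sum_univ_succAbove _ i]
    simp [hc, hb, Fin.sum_univ_succ]
  refine ⟨fun j => hc0 j.succ, ?_⟩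
  have h : ∑ j, (faceMap i x) j = ∑ j : Fin (k + 1), c j.succ := rfl
  rw [h]
  rw [Fin.sum_univ_succ] at hsum
  linarith [hc0 0]

lemma contDiff_faceMap {k : ℕ} (i : Fin (k + 2)) : ContDiff ℝ 1 (faceMap (k := k) i) := by
  rw [contDiff_euclidean]
  intro j
  have hb : ∀ l : Fin (k + 1), ContDiff ℝ 1 (fun x : EuclideanSpace ℝ (Fin k) =>
      Fin.cons (α := fun _ => ℝ) (1 - ∑ j, x j) x l) := by
    intro l
    refine Fin.cases ?_ (fun l => ?_) l
    · simp only [Fin.cons_zero]; fun_prop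
    · simp only [Fin.cons_succ]; fun_prop
  have hc : ∀ l : Fin (k + 2), ContDiff ℝ 1 (fun x : EuclideanSpace ℝ (Fin k) =>
      i.insertNth (α := fun _ => ℝ) 0 (Fin.cons (α := fun _ => ℝ) (1 - ∑ j, x j) x) l) := by
    intro l
    refine Fin.succAboveCases i ?_ (fun l => ?_) l
    · simp only [Fin.insertNth_apply_same]; fun_prop
    · simp only [Fin.insertNth_apply_succAbove]; exact hb l
  exact hc j.succ

/-- A singular Lipschitz `k`-simplex in `R`: a continuous map `Δₖ → R` which is, near each point,
Lipschitz in a bilipschitz chart. -/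
structure LipSimplex (n k : ℕ) (R : Type*) [TopologicalSpace R]
    [ChartedSpace (EuclideanSpace ℝ (Fin n)) R] where
  toFun : stdSimplexR k → R
  continuous_toFun : Continuous toFun
  lipschitz : ∀ x, ∃ φ ∈ lipCharts n R, toFun x ∈ φ.source ∧
    ∃ K : ℝ≥0, ∃ t ∈ 𝓝 x, LipschitzOnWith K (φ ∘ toFun) t

section Chains

variable {n k : ℕ} {R : Type*} [TopologicalSpace R] [ChartedSpace (EuclideanSpace ℝ (Fin n)) R]

/-- The `i`-th face of a singular simplex. -/
def LipSimplex.face (σ : LipSimplex n (k + 1) R) (i : Fin (k + 2)) : LipSimplex n k R where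
  toFun x := σ.toFun ⟨faceMap i x, faceMap_mem i x.2⟩
  continuous_toFun := σ.continuous_toFun.comp
    (((contDiff_faceMap i).continuous.comp continuous_subtype_val).subtype_mk _)
  lipschitz x := by
    obtain ⟨φ, hφ, hx, K, t, ht, hK⟩ := σ.lipschitz ⟨faceMap i x, faceMap_mem i x.2⟩
    refine ⟨φ, hφ, hx, ?_⟩
    obtain ⟨L, s, hs, hL⟩ := (contDiff_faceMap i).locallyLipschitz (x : EuclideanSpace ℝ (Fin k))
    let F : stdSimplexR k → stdSimplexR (k + 1) := fun y => ⟨faceMap i y, faceMap_mem i y.2⟩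
    have hF : Continuous F :=
      ((contDiff_faceMap i).continuous.comp continuous_subtype_val).subtype_mk _
    have hFL : LipschitzOnWith L F (Subtype.val ⁻¹' s ∩ F ⁻¹' t) :=
      fun y hy z hz => hL hy.1 hz.1
    exact ⟨K * L, Subtype.val ⁻¹' s ∩ F ⁻¹' t,
      inter_mem (continuous_subtype_val.continuousAt.preimage_mem_nhds hs)
        (hF.continuousAt.preimage_mem_nhds ht),
      hK.comp hFL (fun y hy => hy.2)⟩

variable (n k R) in
/-- Lipschitz `k`-chains in `R` with coefficients in `K`: formal linear combinations of singular
Lipschitz `k`-simplices. -/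
abbrev LipChain (K : Type*) [CommRing K] : Type _ := LipSimplex n k R →₀ K

/-- The boundary operator `∂σ = ∑ᵢ (-1)ⁱ σ ∘ dᵢ`. -/
def lipBoundary (n k : ℕ) (R : Type*) [TopologicalSpace R]
    [ChartedSpace (EuclideanSpace ℝ (Fin n)) R] (K : Type*) [CommRing K] :
    LipChain n (k + 1) R K →ₗ[K] LipChain n k R K :=
  Finsupp.linearCombination K fun σ =>
    ∑ i : Fin (k + 2), Finsupp.single (σ.face i) ((-1 : K) ^ (i : ℕ))

/-- The chains all of whose simplices have their image in `U`. -/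
def chainsIn (n k : ℕ) {R : Type*} [TopologicalSpace R]
    [ChartedSpace (EuclideanSpace ℝ (Fin n)) R] (K : Type*) [CommRing K] (U : Set R) :
    Submodule K (LipChain n k R K) :=
  Finsupp.supported K K {σ | range σ.toFun ⊆ U}

/-- Relative cycles: chains in `M` whose boundary lies in `D`. -/
def relCycles (n : ℕ) {R : Type*} [TopologicalSpace R]
    [ChartedSpace (EuclideanSpace ℝ (Fin n)) R] (K : Type*) [CommRing K] (M D : Set R) :
    (k : ℕ) → Submodule K (LipChain n k R K)
  | 0 => chainsIn n 0 K M
  | k + 1 => chainsIn n (k + 1) K M ⊓ (chainsIn n k K D).comap (lipBoundary n k R K)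

/-- Relative boundaries: sums of a chain in `D` and a boundary of a chain in `M`. -/
def relBoundaries (n k : ℕ) {R : Type*} [TopologicalSpace R]
    [ChartedSpace (EuclideanSpace ℝ (Fin n)) R] (K : Type*) [CommRing K] (M D : Set R) :
    Submodule K (LipChain n k R K) :=
  chainsIn n k K D ⊔ (chainsIn n (k + 1) K M).map (lipBoundary n k R K)

/-- The relative Lipschitz homology `Hₖ(M, D; K)`: the relative cycles modulo the relative boundaries,
as the submodule of the classes of relative cycles in the quotient of all chains. -/
abbrev LipHomology (n k : ℕ) {R : Type*} [TopologicalSpace R]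
    [ChartedSpace (EuclideanSpace ℝ (Fin n)) R] (K : Type*) [CommRing K] (M D : Set R) :
    Submodule K (LipChain n k R K ⧸ relBoundaries n k K M D) :=
  (relCycles n K M D k).map (relBoundaries n k K M D).mkQ

/-- The family of all chains (relative cycles) which represent a homology class. -/
def LipHomology.chains {K : Type*} [CommRing K] {M D : Set R} (c : LipHomology n k K M D) :
    Set (LipChain n k R K) :=
  {s | s ∈ relCycles n K M D k ∧ (relBoundaries n k K M D).mkQ s = c}

end Chains

/-! ### Modulus and exceptional families -/

/-- Fuglede's `p`-modulus of a family `S` of Borel measures on `(X, μ)`. -/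
def fugledeModulus {X : Type*} [MeasurableSpace X] (p : ℝ) (μ : Measure X) (S : Set (Measure X)) :
    ℝ≥0∞ :=
  ⨅ f : {f : X → ℝ≥0∞ // Measurable f ∧ ∀ ν ∈ S, 1 ≤ ∫⁻ x, f x ∂ν}, ∫⁻ x, f.1 x ^ p ∂μ

/-- The Jacobian `√(det (Df(x)ᵀ Df(x)))`. -/
def jacobian {k n : ℕ} (f : EuclideanSpace ℝ (Fin k) → EuclideanSpace ℝ (Fin n))
    (x : EuclideanSpace ℝ (Fin k)) : ℝ≥0∞ :=
  ENNReal.ofReal √((ContinuousLinearMap.adjoint (fderiv ℝ f x)).comp (fderiv ℝ f x)).det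

lemma zero_mem_stdSimplexR (k : ℕ) : (0 : EuclideanSpace ℝ (Fin k)) ∈ stdSimplexR k := by
  simp [stdSimplexR]

section Surface

variable {n k : ℕ} {R : Type*} [TopologicalSpace R] [ChartedSpace (EuclideanSpace ℝ (Fin n)) R]

open Classical in
/-- The map `σ : Δₖ → R`, extended to `ℝᵏ` by a constant. -/
def LipSimplex.extend (σ : LipSimplex n k R) (x : EuclideanSpace ℝ (Fin k)) : R :=
  if h : x ∈ stdSimplexR k then σ.toFun ⟨x, h⟩ else σ.toFun ⟨0, zero_mem_stdSimplexR k⟩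

/-- `μ` is a surface measure of the singular simplex `σ`: for some subdivision of `Δₖ` into finitely
many closed pieces `Tᵢ` (with overlaps of measure zero), each of which is mapped by `σ` to the domain of
a bilipschitz chart `φᵢ`, the measure `μ` is the sum over `i` of the images under `φᵢ⁻¹` of the Euclidean
surface measures of `φᵢ ∘ σ|Tᵢ`. The Euclidean surface measure is the image under `φᵢ ∘ σ` of `J dx` on
`Tᵢ`, with `J` the Jacobian of `φᵢ ∘ σ`, and hence its image under `φᵢ⁻¹` is the image under `σ` of `J dx`
on `Tᵢ`. -/
def IsSurfaceMeasure [MeasurableSpace R] (σ : LipSimplex n k R) (μ : Measure R) : Prop :=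
  ∃ (N : ℕ) (T : Fin N → Set (EuclideanSpace ℝ (Fin k)))
    (φ : Fin N → OpenPartialHomeomorph R (EuclideanSpace ℝ (Fin n))),
    (∀ i, IsClosed (T i)) ∧ (⋃ i, T i = stdSimplexR k) ∧
    (∀ i j, i ≠ j → volume (T i ∩ T j) = 0) ∧
    (∀ i, φ i ∈ lipCharts n R) ∧ (∀ i, MapsTo σ.extend (T i) (φ i).source) ∧
    μ = ∑ i, ((volume.restrict (T i)).withDensity (jacobian (φ i ∘ σ.extend))).map σ.extend

/-- Given a measure `m σ` for each simplex, the measure `∑ |aᵢ| m σᵢ` of the chain `∑ aᵢ σᵢ`. -/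
def chainMeasure [MeasurableSpace R] {K : Type*} [NormedCommRing K]
    (m : LipSimplex n k R → Measure R) (s : LipChain n k R K) : Measure R :=
  s.sum fun σ a => ‖a‖ₑ • m σ

/-- A family `S` of Lipschitz chains is `p`-exceptional if, for a choice `m` of surface measures for
the singular simplices, the family of the measures of the chains in `S` has `p`-modulus zero with respect
to the Riemannian volume. (All choices lead to comparable measures and hence to the same exceptional
families.) -/
def IsPExceptional [MeasurableSpace R] {K : Type*} [NormedCommRing K]
    (g : LipRiemannianMetric n R) (p : ℝ) (S : Set (LipChain n k R K)) : Prop :=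
  ∃ m : LipSimplex n k R → Measure R, (∀ σ, IsSurfaceMeasure σ (m σ)) ∧
    fugledeModulus p g.vol (chainMeasure m '' S) = 0

end Surface

end

/-!
Suppose that the class `c` is exceptional. Scaling admissible functions gives one Borel function `f`
with `∫ f ^ p < ∞` and `∫ f dμ_s = ∞` for every `s ∈ c`
(`exists_lintegral_eq_top_of_fugledeModulus_eq_zero`). Starting from any relative cycle `s ∈ c`, a
homologous relative cycle is constructed along which the integral of `f` is finite.

Every point of `R` has a bilipschitz chart in which increasing the coordinates does not leave `M`, and
does not leave `D` if in addition the last coordinate is kept (`AdaptedBall`, `exists_adaptedBall`).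
The interesting charts are those at the boundary of `D`: there a boundary chart of `M` is combined with
a boundary chart of `D` in `∂M` (`exists_cornerChart`). Shifting by a vector `w` in such a chart, with a
cutoff, is a self-map of `R`; finitely many of these maps, with parameters `w = (w₁, …, w_N)` in small
positive orthants, are composed to a map `H w` (`AdaptedBall.shiftAll`) so that each point of `s` is
moved effectively by one of them. Let `w ↦ w⁽ᵗ⁾` be the multiplication of all last coordinates by `t`.
Then `H w⁽⁰⁾` is homotopic to the identity through maps of the pair `(M, D)`, while `t ↦ H w⁽ᵗ⁾` is a
homotopy in `M` that leaves `D`. With `P` the prism operator of the latter homotopy, the chain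
`H(w)₊ s - P(∂s)` has the boundary `H(w⁽⁰⁾)₊ ∂s` in `D` and is homologous to `s` (`deformChain_equiv`).

It remains to find `w` for which `f` has a finite integral along this chain. The average over `w` of
`F (H w⁽ᵗ⁾ x)` is at most `C t⁻¹ ∫ F`, because the shift in one of the charts spreads `x` over a set of
directions in which only the last one has been contracted by `t`, and the subsequent shifts distort
volumes by bounded factors (`AdaptedBall.exists_lintegral_shiftLaw_le`). This is applied to `F = f ^ p`.
On the simplices of the prism over `∂s`, the height `t` is at least the last coordinate, so that
`t ^ (-1 / p)` is integrable because of `p > 1`; Young's inequality and Tonelli's theorem then bound the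
average over `w` of the integral of `f` (`AdaptedBall.ae_lintegral_shiftAll_ne_top`). Jacobians are
bounded, hence the same holds for the integrals with respect to arbitrary surface measures
(`IsSurfaceMeasure.lintegral_ne_top`).
-/

noncomputable section

/-! ### Singular prisms and chain homotopies -/

section SimplexMaps

/-- The barycentric coordinates `(1 - ∑ xⱼ, x₁, …, xₖ)` with respect to the vertices of the standard
simplex. -/
def bary {k : ℕ} (x : EuclideanSpace ℝ (Fin k)) : Fin (k + 1) → ℝ :=
  Fin.cons (α := fun _ => ℝ) (1 - ∑ j, x j) x

lemma bary_succ {k : ℕ} (x : EuclideanSpace ℝ (Fin k)) (i : Fin k) : bary x i.succ = x i := rfl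

lemma sum_bary {k : ℕ} (x : EuclideanSpace ℝ (Fin k)) : ∑ i, bary x i = 1 := by
  simp [bary, Fin.sum_univ_succ]

lemma bary_nonneg {k : ℕ} {x : EuclideanSpace ℝ (Fin k)} (hx : x ∈ stdSimplexR k) (i) :
    0 ≤ bary x i := by
  refine Fin.cases ?_ (fun j => ?_) i
  · simpa [bary] using hx.2
  · exact hx.1 j

lemma mem_stdSimplexR_iff_bary {k : ℕ} {x : EuclideanSpace ℝ (Fin k)} :
    x ∈ stdSimplexR k ↔ ∀ i, 0 ≤ bary x i := by
  refine ⟨fun hx => bary_nonneg hx, fun h => ⟨fun i => h i.succ, ?_⟩⟩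
  simpa [bary] using h 0

lemma bary_injective {k : ℕ} : Function.Injective (bary (k := k)) := by
  intro x y h
  ext i
  exact congrFun h i.succ

/-- The affine map of standard simplices which maps the `i`-th vertex to the vertex `θ i`. -/
def simplexMap {k m : ℕ} (θ : Fin (m + 1) → Fin (k + 1)) (x : EuclideanSpace ℝ (Fin m)) :
    EuclideanSpace ℝ (Fin k) :=
  WithLp.toLp 2 fun l => ∑ i, if θ i = l.succ then bary x i else 0

lemma bary_simplexMap {k m : ℕ} (θ : Fin (m + 1) → Fin (k + 1)) (x : EuclideanSpace ℝ (Fin m))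
    (l : Fin (k + 1)) : bary (simplexMap θ x) l = ∑ i, if θ i = l then bary x i else 0 := by
  refine Fin.cases ?_ (fun j => rfl) l
  have h : ∑ l : Fin (k + 1), ∑ i, (if θ i = l then bary x i else 0) = 1 := by
    rw [Finset.sum_comm]
    simp [sum_bary]
  rw [Fin.sum_univ_succ] at h
  have : bary (simplexMap θ x) 0 = 1 - ∑ l : Fin k, ∑ i, (if θ i = l.succ then bary x i else 0) := rfl
  linarith

lemma simplexMap_mem {k m : ℕ} (θ : Fin (m + 1) → Fin (k + 1)) {x : EuclideanSpace ℝ (Fin m)}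
    (hx : x ∈ stdSimplexR m) : simplexMap θ x ∈ stdSimplexR k := by
  rw [mem_stdSimplexR_iff_bary]
  intro i
  rw [bary_simplexMap]
  exact Finset.sum_nonneg fun j _ => by split_ifs; exacts [bary_nonneg hx j, le_rfl]

lemma simplexMap_comp {k l m : ℕ} (θ : Fin (l + 1) → Fin (k + 1)) (ξ : Fin (m + 1) → Fin (l + 1))
    (x : EuclideanSpace ℝ (Fin m)) : simplexMap θ (simplexMap ξ x) = simplexMap (θ ∘ ξ) x := by
  apply bary_injective
  funext i
  simp only [bary_simplexMap, Function.comp]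
  calc ∑ j, (if θ j = i then ∑ s, (if ξ s = j then bary x s else 0) else 0)
      = ∑ j, ∑ s, (if ξ s = j then (if θ j = i then bary x s else 0) else 0) := by
        refine Finset.sum_congr rfl fun j _ => ?_
        split_ifs <;> simp
    _ = _ := by
        rw [Finset.sum_comm]
        simp

lemma simplexMap_id {k : ℕ} (x : EuclideanSpace ℝ (Fin k)) : simplexMap id x = x := by
  apply bary_injective
  funext i
  simp [bary_simplexMap]

lemma faceMap_eq_simplexMap {k : ℕ} (i : Fin (k + 2)) (x : EuclideanSpace ℝ (Fin k)) :
    faceMap i x = simplexMap i.succAbove x := by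
  ext l
  have h1 : faceMap i x l = (i.insertNth (α := fun _ => ℝ) 0 (bary x) : Fin (k + 2) → ℝ) l.succ := rfl
  have h2 : simplexMap i.succAbove x l = ∑ s, if i.succAbove s = l.succ then bary x s else 0 := rfl
  rw [h1, h2]
  generalize l.succ = r
  refine Fin.succAboveCases i ?_ (fun j => ?_) r
  · simp [Fin.succAbove_ne]
  · simp

lemma contDiff_simplexMap {k m : ℕ} (θ : Fin (m + 1) → Fin (k + 1)) :
    ContDiff ℝ 1 (simplexMap θ) := by
  have hb : ∀ l : Fin (m + 1), ContDiff ℝ 1 (fun x : EuclideanSpace ℝ (Fin m) => bary x l) := by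
    intro l
    refine Fin.cases ?_ (fun l => ?_) l
    · simp only [bary, Fin.cons_zero]; fun_prop
    · simp only [bary, Fin.cons_succ]; fun_prop
  rw [contDiff_euclidean]
  intro l
  have h : ContDiff ℝ 1 fun x : EuclideanSpace ℝ (Fin m) =>
      ∑ i, if θ i = l.succ then bary x i else 0 := by
    refine ContDiff.sum fun i _ => ?_
    split_ifs
    exacts [hb i, contDiff_const]
  exact h

/-- The affine function on the simplex with value `ρ i` at the `i`-th vertex. -/
def simplexHeight {m : ℕ} (ρ : Fin (m + 1) → ℝ) (x : EuclideanSpace ℝ (Fin m)) : ℝ :=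
  ∑ i, ρ i * bary x i

lemma simplexHeight_simplexMap {k m : ℕ} (ρ : Fin (k + 1) → ℝ) (θ : Fin (m + 1) → Fin (k + 1))
    (x : EuclideanSpace ℝ (Fin m)) :
    simplexHeight ρ (simplexMap θ x) = simplexHeight (ρ ∘ θ) x := by
  simp only [simplexHeight, bary_simplexMap, Finset.mul_sum, Function.comp]
  rw [Finset.sum_comm]
  simp

lemma simplexHeight_const {m : ℕ} (c : ℝ) (x : EuclideanSpace ℝ (Fin m)) :
    simplexHeight (fun _ => c) x = c := by
  simp [simplexHeight, ← Finset.mul_sum, sum_bary]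

lemma simplexHeight_mem_Icc {m : ℕ} {ρ : Fin (m + 1) → ℝ} (hρ : ∀ i, ρ i ∈ Icc (0 : ℝ) 1)
    {x : EuclideanSpace ℝ (Fin m)} (hx : x ∈ stdSimplexR m) : simplexHeight ρ x ∈ Icc (0 : ℝ) 1 := by
  refine ⟨Finset.sum_nonneg fun i _ => mul_nonneg (hρ i).1 (bary_nonneg hx i), ?_⟩
  rw [← sum_bary x]
  exact Finset.sum_le_sum fun i _ => mul_le_of_le_one_left (bary_nonneg hx i) (hρ i).2

lemma contDiff_simplexHeight {m : ℕ} (ρ : Fin (m + 1) → ℝ) : ContDiff ℝ 1 (simplexHeight ρ) := by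
  have hb : ∀ l : Fin (m + 1), ContDiff ℝ 1 (fun x : EuclideanSpace ℝ (Fin m) => bary x l) := by
    intro l
    refine Fin.cases ?_ (fun l => ?_) l
    · simp only [bary, Fin.cons_zero]; fun_prop
    · simp only [bary, Fin.cons_succ]; fun_prop
  exact ContDiff.sum fun i _ => contDiff_const.mul (hb i)

end SimplexMaps

section Prism

variable {n k : ℕ} {R : Type*} [TopologicalSpace R] [ChartedSpace (EuclideanSpace ℝ (Fin n)) R]

/-- A continuous map which is, near each point, Lipschitz in a bilipschitz chart. This is the condition
that defines `LipSimplex`. -/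
def ChartLipschitz (n : ℕ) {X R : Type*} [PseudoMetricSpace X] [TopologicalSpace R]
    [ChartedSpace (EuclideanSpace ℝ (Fin n)) R] (f : X → R) : Prop :=
  Continuous f ∧ ∀ x, ∃ φ ∈ lipCharts n R, f x ∈ φ.source ∧
    ∃ K : ℝ≥0, ∃ t ∈ 𝓝 x, LipschitzOnWith K (φ ∘ f) t

lemma LipSimplex.chartLipschitz (σ : LipSimplex n k R) : ChartLipschitz n σ.toFun :=
  ⟨σ.continuous_toFun, σ.lipschitz⟩

lemma LipSimplex.ext {σ τ : LipSimplex n k R} (h : σ.toFun = τ.toFun) : σ = τ := by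
  cases σ; cases τ; cases h; rfl

lemma ChartLipschitz.comp {X Y : Type*} [PseudoMetricSpace X] [PseudoMetricSpace Y] {f : Y → R}
    (hf : ChartLipschitz n f) {g : X → Y} (hg : LocallyLipschitz g) : ChartLipschitz n (f ∘ g) := by
  refine ⟨hf.1.comp hg.continuous, fun x => ?_⟩
  obtain ⟨φ, hφ, hx, K, t, ht, hK⟩ := hf.2 (g x)
  obtain ⟨L, s, hs, hL⟩ := hg x
  exact ⟨φ, hφ, hx, K * L, s ∩ g ⁻¹' t, inter_mem hs (hg.continuous.continuousAt.preimage_mem_nhds ht),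
    hK.comp (hL.mono inter_subset_left) fun y hy => hy.2⟩

/-- A family of self-maps of `R` which is jointly Lipschitz in charts. Since `R` carries no metric, this
is tested by composition with maps from standard simplices. -/
def IsLipHomotopy (n : ℕ) {R : Type*} [TopologicalSpace R]
    [ChartedSpace (EuclideanSpace ℝ (Fin n)) R] (Γ : ℝ → R → R) : Prop :=
  ∀ (k : ℕ) (a : stdSimplexR k → ℝ) (f : stdSimplexR k → R), LocallyLipschitz a →
    ChartLipschitz n f → ChartLipschitz n fun x => Γ (a x) (f x)

lemma locallyLipschitz_restrict {k : ℕ} {Y : Type*} [PseudoMetricSpace Y]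
    {f : EuclideanSpace ℝ (Fin k) → Y} (hf : LocallyLipschitz f) :
    LocallyLipschitz fun x : stdSimplexR k => f x := by
  intro x
  obtain ⟨K, t, ht, hK⟩ := hf (x : EuclideanSpace ℝ (Fin k))
  exact ⟨K, Subtype.val ⁻¹' t, continuous_subtype_val.continuousAt.preimage_mem_nhds ht,
    fun y hy z hz => hK hy hz⟩

/-- The singular simplex `x ↦ Γ (ρ x) (σ (θ x))`, where `θ` and `ρ` stand for the affine map and the
affine function with the given values at the vertices: it is the image under `(t, y) ↦ Γ t (σ y)` of the
simplex in `ℝ × Δₖ` with the vertices `(ρ i, θ i)`. -/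
def prismSimplex (Γ : ℝ → R → R) (hΓ : IsLipHomotopy n Γ) (σ : LipSimplex n k R) {m : ℕ}
    (θ : Fin (m + 1) → Fin (k + 1)) (ρ : Fin (m + 1) → ℝ) : LipSimplex n m R where
  toFun x := Γ (simplexHeight ρ x) (σ.toFun ⟨simplexMap θ x, simplexMap_mem θ x.2⟩)
  continuous_toFun := (hΓ m _ _ (locallyLipschitz_restrict (contDiff_simplexHeight ρ).locallyLipschitz)
    (σ.chartLipschitz.comp (g := fun x : stdSimplexR m =>
      (⟨simplexMap θ x, simplexMap_mem θ x.2⟩ : stdSimplexR k))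
      (fun x => locallyLipschitz_restrict (contDiff_simplexMap θ).locallyLipschitz x))).1
  lipschitz := (hΓ m _ _ (locallyLipschitz_restrict (contDiff_simplexHeight ρ).locallyLipschitz)
    (σ.chartLipschitz.comp (g := fun x : stdSimplexR m =>
      (⟨simplexMap θ x, simplexMap_mem θ x.2⟩ : stdSimplexR k))
      (fun x => locallyLipschitz_restrict (contDiff_simplexMap θ).locallyLipschitz x))).2

variable {Γ : ℝ → R → R} (hΓ : IsLipHomotopy n Γ)

/-- The faces of a prism simplex are obtained by omitting vertices; together with `prismSimplex_face`, this
reduces chain identities to identities between maps of vertices. -/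
lemma face_prismSimplex (σ : LipSimplex n k R) {m : ℕ} (θ : Fin (m + 2) → Fin (k + 1))
    (ρ : Fin (m + 2) → ℝ) (j : Fin (m + 2)) :
    (prismSimplex Γ hΓ σ θ ρ).face j = prismSimplex Γ hΓ σ (θ ∘ j.succAbove) (ρ ∘ j.succAbove) := by
  apply LipSimplex.ext
  funext x
  simp only [LipSimplex.face, prismSimplex, faceMap_eq_simplexMap, simplexMap_comp,
    simplexHeight_simplexMap]

lemma prismSimplex_face (σ : LipSimplex n (k + 1) R) {m : ℕ} (θ : Fin (m + 1) → Fin (k + 1))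
    (ρ : Fin (m + 1) → ℝ) (j : Fin (k + 2)) :
    prismSimplex Γ hΓ (σ.face j) θ ρ = prismSimplex Γ hΓ σ (j.succAbove ∘ θ) ρ := by
  apply LipSimplex.ext
  funext x
  simp only [LipSimplex.face, prismSimplex, faceMap_eq_simplexMap, simplexMap_comp]

/-- Heights of the vertices of the `i`-th simplex of the prism: `0` up to `i`, then `1`. -/
def prismHeight {k : ℕ} (i : Fin (k + 1)) (m : Fin (k + 2)) : ℝ := if i.castSucc < m then 1 else 0

lemma prismHeight_mem_Icc {k : ℕ} (i : Fin (k + 1)) (m : Fin (k + 2)) :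
    prismHeight i m ∈ Icc (0 : ℝ) 1 := by
  unfold prismHeight; split_ifs <;> simp

variable (K : Type*) [CommRing K]

/-- The chain map induced by `Γ c`. -/
def pushChain (c : ℝ) (k : ℕ) : LipChain n k R K →ₗ[K] LipChain n k R K :=
  Finsupp.linearCombination K fun σ => Finsupp.single (prismSimplex Γ hΓ σ id fun _ => c) 1

/-- The prism operator of the homotopy `Γ`: the prism over a singular `k`-simplex is the alternating sum
of `k + 1` simplices, the `i`-th of which visits the vertices `0, …, i` at the height `0` and then
`i, …, k` at the height `1`. -/
def prismOp (k : ℕ) : LipChain n k R K →ₗ[K] LipChain n (k + 1) R K :=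
  Finsupp.linearCombination K fun σ => ∑ i : Fin (k + 1),
    Finsupp.single (prismSimplex Γ hΓ σ i.predAbove (prismHeight i)) ((-1 : K) ^ (i : ℕ))

lemma val_succAbove {k : ℕ} (i : Fin (k + 1)) (l : Fin k) :
    (i.succAbove l : ℕ) = if (l : ℕ) < i then (l : ℕ) else l + 1 := by
  simp only [Fin.succAbove, Fin.lt_def, Fin.val_castSucc]
  split_ifs <;> rfl

lemma val_predAbove {k : ℕ} (l : Fin k) (i : Fin (k + 1)) :
    (l.predAbove i : ℕ) = if (l : ℕ) < i then (i : ℕ) - 1 else i := by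
  simp only [Fin.predAbove, Fin.lt_def, Fin.val_castSucc]
  split_ifs <;> rfl

/-- The reindexing of the faces in the boundary of a prism, apart from the two faces of the `i`-th simplex
that it shares with its neighbours in the prism. It is given by the involution
`(i, l) ↦ (i.succAbove l, l.predAbove i)`, as in the simplicial identities. -/
lemma sum_prism_offdiagonal {A : Type*} [AddCommMonoid A] (k : ℕ) (g : Fin (k + 2) → Fin (k + 3) → A)
    (h : Fin (k + 1) → Fin (k + 2) → A)
    (hgh : ∀ i l, g i (i.castSucc.succAbove (i.succAbove l)) = h (l.predAbove i) (i.succAbove l)) :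
    ∑ i : Fin (k + 2), ∑ l : Fin (k + 1), g i (i.castSucc.succAbove (i.succAbove l)) =
      ∑ i : Fin (k + 1), ∑ j : Fin (k + 2), h i j := by
  rw [Finset.sum_comm (s := Finset.univ (α := Fin (k + 1))), ← Finset.sum_product',
    ← Finset.sum_product']
  refine Finset.sum_nbij' (fun x => (x.1.succAbove x.2, x.2.predAbove x.1))
    (fun x => (x.1.succAbove x.2, x.2.predAbove x.1)) (by simp) (by simp) ?_ ?_ ?_
  · rintro ⟨i, l⟩ -
    simp only [Prod.mk.injEq]
    constructor
    all_goals
      ext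
      simp only [val_succAbove, val_predAbove]
      split_ifs <;> omega
  · rintro ⟨i, l⟩ -
    simp only [Prod.mk.injEq]
    constructor
    all_goals
      ext
      simp only [val_succAbove, val_predAbove]
      split_ifs <;> omega
  · rintro ⟨i, l⟩ -
    exact hgh i l

/-- `boundary_prismOp_succ` in degree zero, where there is no boundary term. -/
lemma boundary_prismOp_zero (s : LipChain n 0 R K) :
    lipBoundary n 0 R K (prismOp hΓ K 0 s) = pushChain hΓ K 1 0 s - pushChain hΓ K 0 0 s := by
  have H : (lipBoundary n 0 R K).comp (prismOp hΓ K 0) = pushChain hΓ K 1 0 - pushChain hΓ K 0 0 := by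
    refine Finsupp.lhom_ext' fun σ => LinearMap.ext_ring ?_
    have e1 : (Fin.predAbove (0 : Fin 1) ∘ Fin.succAbove (0 : Fin 2)) = id := by
      funext x; fin_cases x; rfl
    have e2 : (Fin.predAbove (0 : Fin 1) ∘ Fin.succAbove (1 : Fin 2)) = id := by
      funext x; fin_cases x; rfl
    have e3 : (prismHeight (0 : Fin 1) ∘ Fin.succAbove (0 : Fin 2)) = fun _ => 1 := by
      funext x; fin_cases x; simp [prismHeight]
    have e4 : (prismHeight (0 : Fin 1) ∘ Fin.succAbove (1 : Fin 2)) = fun _ => 0 := by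
      funext x; fin_cases x; simp [prismHeight]
    simp only [lipBoundary, prismOp, pushChain, LinearMap.comp_apply, Finsupp.lsingle_apply,
      Finsupp.linearCombination_single, one_smul, LinearMap.sub_apply, Fin.sum_univ_succ,
      Finset.univ_eq_empty, Finset.sum_empty, add_zero, Fin.val_zero, pow_zero,
      face_prismSimplex, Fin.val_succ, pow_one, Fin.succ_zero_eq_one, e1, e2, e3, e4, zero_add]
    rw [sub_eq_add_neg, ← Finsupp.single_neg]
  exact LinearMap.congr_fun H s

/-- The prism operator is a chain homotopy between the maps induced by `Γ 0` and `Γ 1`. -/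
lemma boundary_prismOp_succ (k : ℕ) (s : LipChain n (k + 1) R K) :
    lipBoundary n (k + 1) R K (prismOp hΓ K (k + 1) s) =
      pushChain hΓ K 1 (k + 1) s - pushChain hΓ K 0 (k + 1) s -
        prismOp hΓ K k (lipBoundary n k R K s) := by
  have H : (lipBoundary n (k + 1) R K).comp (prismOp hΓ K (k + 1)) =
      pushChain hΓ K 1 (k + 1) - pushChain hΓ K 0 (k + 1) -
        (prismOp hΓ K k).comp (lipBoundary n k R K) := by
    refine Finsupp.lhom_ext' fun σ => LinearMap.ext_ring ?_
    simp only [lipBoundary, prismOp, pushChain, LinearMap.comp_apply, Finsupp.lsingle_apply,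
      Finsupp.linearCombination_single, one_smul, LinearMap.sub_apply, map_sum,
      face_prismSimplex, prismSimplex_face, Finset.smul_sum, Finsupp.smul_single, smul_eq_mul]
    -- the faces which lie between two neighbouring simplices of the prism
    set Q : ℕ → LipChain n (k + 1) R K := fun i =>
      Finsupp.single (prismSimplex Γ hΓ σ id fun m => if i ≤ (m : ℕ) then 1 else 0) 1 with hQ
    have hoff := sum_prism_offdiagonal k
      (fun i j => Finsupp.single (prismSimplex Γ hΓ σ (i.predAbove ∘ j.succAbove)
        (prismHeight i ∘ j.succAbove)) ((-1 : K) ^ (i : ℕ) * (-1) ^ (j : ℕ)))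
      (fun i j => -Finsupp.single (prismSimplex Γ hΓ σ (j.succAbove ∘ i.predAbove)
        (prismHeight i)) ((-1 : K) ^ (j : ℕ) * (-1) ^ (i : ℕ))) (by
        intro i l
        have e1 : i.predAbove ∘ (i.castSucc.succAbove (i.succAbove l)).succAbove =
            (i.succAbove l).succAbove ∘ (l.predAbove i).predAbove := by
          funext x
          ext
          simp only [Function.comp, val_succAbove, val_predAbove, Fin.val_castSucc]
          split_ifs <;> omega
        have e2 : prismHeight i ∘ (i.castSucc.succAbove (i.succAbove l)).succAbove =
            prismHeight (l.predAbove i) := by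
          funext x
          simp only [Function.comp, prismHeight, Fin.lt_def, val_succAbove, val_predAbove,
            Fin.val_castSucc]
          refine if_congr ?_ rfl rfl
          split_ifs <;> omega
        have e3 : (-1 : K) ^ (i : ℕ) * (-1) ^ ((i.castSucc.succAbove (i.succAbove l) :
            Fin (k + 3)) : ℕ) = -((-1) ^ ((i.succAbove l : Fin (k + 2)) : ℕ) *
              (-1) ^ ((l.predAbove i : Fin (k + 1)) : ℕ)) := by
          simp only [val_succAbove, val_predAbove, Fin.val_castSucc]
          obtain hil | hil := lt_or_ge (l : ℕ) i
          · obtain ⟨r, hr⟩ : ∃ r, (i : ℕ) = r + 1 := ⟨i - 1, by omega⟩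
            have h1 : (l : ℕ) < r + 1 := hr ▸ hil
            simp only [hr, h1, if_true, Nat.add_sub_cancel, pow_succ]
            ring
          · have h1 : ¬ (l : ℕ) < i := not_lt.2 hil
            have h2 : ¬ (l : ℕ) + 1 < i := by omega
            simp only [h1, h2, if_false, pow_succ]
            ring
        simp only [e1, e2, e3, Finsupp.single_neg])
    have hdiag : ∀ i : Fin (k + 2), ∑ j : Fin (k + 3), Finsupp.single (prismSimplex Γ hΓ σ
        (i.predAbove ∘ j.succAbove) (prismHeight i ∘ j.succAbove)) ((-1 : K) ^ (i : ℕ) * (-1) ^ (j : ℕ))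
        = (Q i - Q (i + 1)) + ∑ l : Fin (k + 1), Finsupp.single (prismSimplex Γ hΓ σ
        (i.predAbove ∘ (i.castSucc.succAbove (i.succAbove l)).succAbove)
        (prismHeight i ∘ (i.castSucc.succAbove (i.succAbove l)).succAbove))
        ((-1 : K) ^ (i : ℕ) * (-1) ^ ((i.castSucc.succAbove (i.succAbove l) : Fin (k + 3)) : ℕ)) := by
      intro i
      rw [Fin.sum_univ_succAbove _ i.castSucc, Fin.sum_univ_succAbove _ i, ← add_assoc]
      congr 1
      have a1 : i.predAbove ∘ i.castSucc.succAbove = id := by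
        funext x
        ext
        simp only [Function.comp, val_succAbove, val_predAbove, Fin.val_castSucc, id]
        split_ifs <;> omega
      have a2 : i.predAbove ∘ i.succ.succAbove = id := by
        funext x
        ext
        simp only [Function.comp, val_succAbove, val_predAbove, Fin.val_succ, id]
        split_ifs <;> omega
      have a3 : prismHeight i ∘ i.castSucc.succAbove = 
          fun m : Fin (k + 2) => if (i : ℕ) ≤ (m : ℕ) then (1 : ℝ) else 0 := by
        funext x
        simp only [Function.comp, prismHeight, Fin.lt_def, val_succAbove, Fin.val_castSucc]
        refine if_congr ?_ rfl rfl
        split_ifs <;> omega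
      have a4 : prismHeight i ∘ i.succ.succAbove =
          fun m : Fin (k + 2) => if (i : ℕ) + 1 ≤ (m : ℕ) then (1 : ℝ) else 0 := by
        funext x
        simp only [Function.comp, prismHeight, Fin.lt_def, val_succAbove, Fin.val_castSucc,
          Fin.val_succ]
        refine if_congr ?_ rfl rfl
        split_ifs <;> omega
      have a5 : i.castSucc.succAbove i = i.succ := by simp
      have a6 : (-1 : K) ^ (i : ℕ) * (-1) ^ (i : ℕ) = 1 := by
        rw [← mul_pow]; simp
      rw [a5, a1, a2, a3, a4, Fin.val_castSucc, Fin.val_succ, pow_succ, ← mul_assoc, a6, hQ,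
        sub_eq_add_neg, ← Finsupp.single_neg, one_mul]
    have htel : ∑ i : Fin (k + 2), (Q i - Q (i + 1)) = Q 0 - Q (k + 2) := by
      rw [Fin.sum_univ_eq_sum_range (fun i => Q i - Q (i + 1)), Finset.sum_range_sub']
    have hQ0 : Q 0 = Finsupp.single (prismSimplex Γ hΓ σ id fun _ => 1) 1 := by simp [hQ]
    have hQ1 : Q (k + 2) = Finsupp.single (prismSimplex Γ hΓ σ id fun _ => 0) 1 := by
      have : (fun m : Fin (k + 2) => if k + 2 ≤ (m : ℕ) then (1 : ℝ) else 0) = fun _ => 0 := by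
        funext m
        rw [if_neg (by omega)]
      simp only [hQ, this]
    rw [Finset.sum_congr rfl fun i _ => hdiag i, Finset.sum_add_distrib, hoff, htel, hQ0, hQ1,
      sub_eq_add_neg (_ - _) (∑ _, _), Finset.sum_comm (γ := Fin (k + 1))]
    simp only [Finset.sum_neg_distrib]
  exact LinearMap.congr_fun H s

lemma lipBoundary_lipBoundary (k : ℕ) (s : LipChain n (k + 2) R K) :
    lipBoundary n k R K (lipBoundary n (k + 1) R K s) = 0 := by
  have H : (lipBoundary n k R K).comp (lipBoundary n (k + 1) R K) = 0 := by
    refine Finsupp.lhom_ext' fun σ => LinearMap.ext_ring ?_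
    simp only [lipBoundary, LinearMap.comp_apply, Finsupp.lsingle_apply,
      Finsupp.linearCombination_single, one_smul, map_sum, Finset.smul_sum, Finsupp.smul_single,
      smul_eq_mul, LinearMap.zero_apply]
    rw [← Finset.sum_product' (f := fun (i : Fin (k + 3)) (j : Fin (k + 2)) =>
      Finsupp.single ((σ.face i).face j) ((-1 : K) ^ (i : ℕ) * (-1) ^ (j : ℕ)))]
    refine Finset.sum_involution (fun x _ => (x.1.succAbove x.2, x.2.predAbove x.1)) ?_ ?_ (by simp) ?_
    · rintro ⟨i, j⟩ -
      have e1 : ((σ.face i).face j) = (σ.face (i.succAbove j)).face (j.predAbove i) := by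
        apply LipSimplex.ext
        funext x
        have : i.succAbove ∘ j.succAbove = (i.succAbove j).succAbove ∘ (j.predAbove i).succAbove := by
          funext y
          ext
          simp only [Function.comp, val_succAbove, val_predAbove]
          split_ifs <;> omega
        simp only [LipSimplex.face, faceMap_eq_simplexMap, simplexMap_comp, this]
      have e2 : (-1 : K) ^ ((i.succAbove j : Fin (k + 3)) : ℕ) *
          (-1) ^ ((j.predAbove i : Fin (k + 2)) : ℕ) = -((-1) ^ (i : ℕ) * (-1) ^ (j : ℕ)) := by
        simp only [val_succAbove, val_predAbove]
        obtain hij | hij := lt_or_ge (j : ℕ) i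
        · obtain ⟨r, hr⟩ : ∃ r, (i : ℕ) = r + 1 := ⟨i - 1, by omega⟩
          have h1 : (j : ℕ) < r + 1 := hr ▸ hij
          simp only [hr, h1, if_true, Nat.add_sub_cancel, pow_succ]
          ring
        · simp only [not_lt.2 hij, if_false, pow_succ]
          ring
      simp only [e1, e2, Finsupp.single_neg, add_neg_cancel]
    · rintro ⟨i, j⟩ - - h
      simp only [Prod.mk.injEq] at h
      exact Fin.succAbove_ne _ _ h.1
    · rintro ⟨i, j⟩ -
      simp only [Prod.mk.injEq]
      constructor
      all_goals
        ext
        simp only [val_succAbove, val_predAbove]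
        split_ifs <;> omega
  exact LinearMap.congr_fun H s

lemma lipBoundary_pushChain (c : ℝ) (k : ℕ) (s : LipChain n (k + 1) R K) :
    lipBoundary n k R K (pushChain hΓ K c (k + 1) s) = pushChain hΓ K c k (lipBoundary n k R K s) := by
  have H : (lipBoundary n k R K).comp (pushChain hΓ K c (k + 1)) =
      (pushChain hΓ K c k).comp (lipBoundary n k R K) := by
    refine Finsupp.lhom_ext' fun σ => LinearMap.ext_ring ?_
    simp only [lipBoundary, pushChain, LinearMap.comp_apply, Finsupp.lsingle_apply,
      Finsupp.linearCombination_single, one_smul, map_sum, face_prismSimplex, prismSimplex_face,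
      Finsupp.smul_single, smul_eq_mul, mul_one]
    rfl
  exact LinearMap.congr_fun H s

variable {K}

lemma pushChain_mem_supported {c : ℝ} {S : Set (LipSimplex n k R)} {s : LipChain n k R K}
    (h : ∀ σ ∈ s.support, prismSimplex Γ hΓ σ id (fun _ => c) ∈ S) :
    pushChain hΓ K c k s ∈ Finsupp.supported K K S := by
  rw [pushChain, Finsupp.linearCombination_apply]
  exact Submodule.sum_mem _ fun σ hσ => Submodule.smul_mem _ _
    (Finsupp.single_mem_supported _ _ (h σ hσ))

lemma prismOp_mem_supported {S : Set (LipSimplex n (k + 1) R)} {s : LipChain n k R K}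
    (h : ∀ σ ∈ s.support, ∀ i : Fin (k + 1), prismSimplex Γ hΓ σ i.predAbove (prismHeight i) ∈ S) :
    prismOp hΓ K k s ∈ Finsupp.supported K K S := by
  rw [prismOp, Finsupp.linearCombination_apply]
  exact Submodule.sum_mem _ fun σ hσ => Submodule.smul_mem _ _ (Submodule.sum_mem _ fun i _ =>
    Finsupp.single_mem_supported _ _ (h σ hσ i))

lemma lipBoundary_mem_chainsIn {U : Set R} {s : LipChain n (k + 1) R K}
    (hs : s ∈ chainsIn n (k + 1) K U) : lipBoundary n k R K s ∈ chainsIn n k K U := by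
  rw [lipBoundary, Finsupp.linearCombination_apply]
  refine Submodule.sum_mem _ fun σ hσ => Submodule.smul_mem _ _ (Submodule.sum_mem _ fun i _ =>
    Finsupp.single_mem_supported _ _ ?_)
  rintro _ ⟨x, rfl⟩
  exact (Finsupp.mem_supported _ _).1 hs hσ (mem_range_self _)

lemma pushChain_mem_chainsIn {U V : Set R} {c : ℝ} (hUV : ∀ x ∈ U, Γ c x ∈ V)
    {s : LipChain n k R K} (hs : s ∈ chainsIn n k K U) : pushChain hΓ K c k s ∈ chainsIn n k K V := by
  refine pushChain_mem_supported hΓ fun σ hσ => ?_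
  rintro _ ⟨x, rfl⟩
  simp only [prismSimplex, simplexHeight_const]
  exact hUV _ ((Finsupp.mem_supported _ _).1 hs hσ (mem_range_self _))

lemma prismOp_mem_chainsIn {U V : Set R} (hUV : ∀ t ∈ Icc (0 : ℝ) 1, ∀ x ∈ U, Γ t x ∈ V)
    {s : LipChain n k R K} (hs : s ∈ chainsIn n k K U) :
    prismOp hΓ K k s ∈ chainsIn n (k + 1) K V := by
  refine prismOp_mem_supported hΓ fun σ hσ i => ?_
  rintro _ ⟨x, rfl⟩
  exact hUV _ (simplexHeight_mem_Icc (prismHeight_mem_Icc i) x.2) _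
    ((Finsupp.mem_supported _ _).1 hs hσ (mem_range_self _))

lemma pushChain_congr {Γ' : ℝ → R → R} (hΓ' : IsLipHomotopy n Γ') {c d : ℝ}
    (h : ∀ x, Γ c x = Γ' d x) : pushChain hΓ K c k = pushChain hΓ' K d k := by
  refine Finsupp.lhom_ext' fun σ => LinearMap.ext_ring ?_
  simp only [pushChain, LinearMap.comp_apply, Finsupp.lsingle_apply,
      Finsupp.linearCombination_single, one_smul]
  congr 1
  apply LipSimplex.ext
  funext x
  simp only [prismSimplex, simplexHeight_const, h]

lemma pushChain_of_eq_id {c : ℝ} (h : ∀ x, Γ c x = x) (s : LipChain n k R K) :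
    pushChain hΓ K c k s = s := by
  have H : pushChain hΓ K c k = LinearMap.id := by
    refine Finsupp.lhom_ext' fun σ => LinearMap.ext_ring ?_
    simp only [pushChain, LinearMap.comp_apply, Finsupp.lsingle_apply,
        Finsupp.linearCombination_single, one_smul, LinearMap.id_apply]
    congr 1
    apply LipSimplex.ext
    funext x
    simp only [prismSimplex, simplexHeight_const, h, simplexMap_id]
  rw [H, LinearMap.id_apply]

/-- The image of a chain under the end `Γ 1` of a homotopy, minus the prism over the boundary of the chain.
If `Γ` moves `D`, then the image of a relative cycle need not be a relative cycle, and the prism makes up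
for this: the boundary of the difference is the image under `Γ 0` of the boundary. -/
def deformChain : (k : ℕ) → LipChain n k R K → LipChain n k R K
  | 0, s => pushChain hΓ K 1 0 s
  | k + 1, s => pushChain hΓ K 1 (k + 1) s - prismOp hΓ K k (lipBoundary n k R K s)

/-- Moving a relative cycle by a homotopy `A` of the pair `(M, D)` and then by a homotopy `B` of `M` as in
`deformChain` does not change its class. -/
lemma deformChain_equiv {A B : ℝ → R → R} (hA : IsLipHomotopy n A) (hB : IsLipHomotopy n B)
    {M D : Set R} (hA0 : ∀ x, A 0 x = x) (hAB : ∀ x, A 1 x = B 0 x)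
    (hAM : ∀ t ∈ Icc (0 : ℝ) 1, ∀ x ∈ M, A t x ∈ M) (hAD : ∀ t ∈ Icc (0 : ℝ) 1, ∀ x ∈ D, A t x ∈ D)
    (hBM : ∀ t ∈ Icc (0 : ℝ) 1, ∀ x ∈ M, B t x ∈ M) (hDM : D ⊆ M)
    {s : LipChain n k R K} (hs : s ∈ relCycles n K M D k) :
    deformChain hB k s ∈ relCycles n K M D k ∧ deformChain hB k s - s ∈ relBoundaries n k K M D := by
  have h0 : (0 : ℝ) ∈ Icc (0 : ℝ) 1 := by simp
  have h1 : (1 : ℝ) ∈ Icc (0 : ℝ) 1 := by simp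
  have hmono : chainsIn n (k - 1) K D ≤ chainsIn n (k - 1) K M :=
    Finsupp.supported_mono fun σ hσ => hσ.trans hDM
  cases k with
  | zero =>
    refine ⟨pushChain_mem_chainsIn hB (hBM 1 h1) hs, ?_⟩
    have e : deformChain hB 0 s - s = lipBoundary n 0 R K (prismOp hB K 0 s + prismOp hA K 0 s) := by
      rw [map_add, boundary_prismOp_zero, boundary_prismOp_zero, pushChain_of_eq_id hA hA0,
        pushChain_congr hA hB hAB]
      simp [deformChain]
    rw [e]
    exact Submodule.mem_sup_right (Submodule.mem_map_of_mem (Submodule.add_mem _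
      (prismOp_mem_chainsIn hB hBM hs) (prismOp_mem_chainsIn hA hAM hs)))
  | succ k =>
    obtain ⟨hsM, hsD⟩ := hs
    have hsD : lipBoundary n k R K s ∈ chainsIn n k K D := hsD
    refine ⟨⟨Submodule.sub_mem _ (pushChain_mem_chainsIn hB (hBM 1 h1) hsM)
      (prismOp_mem_chainsIn hB hBM (hmono hsD)), ?_⟩, ?_⟩
    · have e : lipBoundary n k R K (deformChain hB (k + 1) s) =
          pushChain hA K 1 k (lipBoundary n k R K s) := by
        rw [pushChain_congr hA hB hAB]
        cases k with
        | zero =>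
          rw [deformChain, map_sub, lipBoundary_pushChain, boundary_prismOp_zero]
          abel
        | succ k =>
          rw [deformChain, map_sub, lipBoundary_pushChain, boundary_prismOp_succ,
            lipBoundary_lipBoundary, map_zero]
          abel
      change lipBoundary n k R K (deformChain hB (k + 1) s) ∈ chainsIn n k K D
      rw [e]
      exact pushChain_mem_chainsIn hA (hAD 1 h1) hsD
    · have e : deformChain hB (k + 1) s - s = prismOp hA K k (lipBoundary n k R K s) +
          lipBoundary n (k + 1) R K (prismOp hB K (k + 1) s + prismOp hA K (k + 1) s) := by
        rw [map_add, boundary_prismOp_succ, boundary_prismOp_succ, pushChain_of_eq_id hA hA0,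
          pushChain_congr hA hB hAB, deformChain]
        abel
      rw [e]
      exact Submodule.add_mem_sup (prismOp_mem_chainsIn hA hAD hsD)
        (Submodule.mem_map_of_mem (Submodule.add_mem _
        (prismOp_mem_chainsIn hB hBM hsM) (prismOp_mem_chainsIn hA hAM hsM)))

end Prism

/-! ### Charts adapted to `M` and `D` -/

section Charts

variable {n : ℕ} {R : Type*} [TopologicalSpace R] [ChartedSpace (EuclideanSpace ℝ (Fin n)) R]

lemma locallyLipschitzOn_transition [HasGroupoid R (lipschitzGroupoid n)]
    {φ ψ : OpenPartialHomeomorph R (EuclideanSpace ℝ (Fin n))} (hφ : φ ∈ lipCharts n R)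
    (hψ : ψ ∈ lipCharts n R) : LocallyLipschitzOn (φ.symm.trans ψ).source (ψ ∘ φ.symm) :=
  ((lipschitzGroupoid n).compatible_of_mem_maximalAtlas hφ hψ).1

/-- Being Lipschitz in charts does not depend on the choice of the chart. -/
lemma ChartLipschitz.exists_lipschitzOnWith [HasGroupoid R (lipschitzGroupoid n)] {X : Type*}
    [PseudoMetricSpace X] {f : X → R} (hf : ChartLipschitz n f)
    {φ : OpenPartialHomeomorph R (EuclideanSpace ℝ (Fin n))} (hφ : φ ∈ lipCharts n R) {x : X}
    (hx : f x ∈ φ.source) :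
    ∃ K : ℝ≥0, ∃ t ∈ 𝓝 x, MapsTo f t φ.source ∧ LipschitzOnWith K (φ ∘ f) t := by
  obtain ⟨ψ, hψ, hxψ, K, t, ht, hK⟩ := hf.2 x
  have hx' : ψ (f x) ∈ (ψ.symm.trans φ).source := by
    simp [hxψ, hx]
  obtain ⟨L, s, hs, hL⟩ := locallyLipschitzOn_transition hψ hφ hx'
  rw [(ψ.symm.trans φ).open_source.nhdsWithin_eq hx'] at hs
  have hc : ContinuousAt (ψ ∘ f) x := (ψ.continuousAt hxψ).comp hf.1.continuousAt
  have hφs := hf.1.continuousAt.preimage_mem_nhds (φ.open_source.mem_nhds hx)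
  have hψs := hf.1.continuousAt.preimage_mem_nhds (ψ.open_source.mem_nhds hxψ)
  refine ⟨L * K, t ∩ (ψ ∘ f) ⁻¹' s ∩ f ⁻¹' φ.source ∩ f ⁻¹' ψ.source,
    inter_mem (inter_mem (inter_mem ht (hc.preimage_mem_nhds hs)) hφs) hψs,
    fun y hy => hy.1.2, ?_⟩
  have h := hL.comp (hK.mono (inter_subset_left.trans (inter_subset_left.trans inter_subset_left)))
    (fun y (hy : y ∈ t ∩ (ψ ∘ f) ⁻¹' s ∩ f ⁻¹' φ.source ∩ f ⁻¹' ψ.source) => hy.1.1.2)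
  intro y hy z hz
  simpa [ψ.left_inv hy.2, ψ.left_inv hz.2] using h hy hz

lemma trans_mem_lipCharts {φ : OpenPartialHomeomorph R (EuclideanSpace ℝ (Fin n))}
    (hφ : φ ∈ lipCharts n R) {β : OpenPartialHomeomorph (EuclideanSpace ℝ (Fin n))
      (EuclideanSpace ℝ (Fin n))} (hβ : β ∈ lipschitzGroupoid n) : φ.trans β ∈ lipCharts n R := by
  rw [lipCharts, mem_maximalAtlas_iff] at hφ ⊢
  intro e he
  obtain ⟨h1, h2⟩ := hφ e he
  refine ⟨?_, ?_⟩
  · rw [OpenPartialHomeomorph.trans_symm_eq_symm_trans_symm, OpenPartialHomeomorph.trans_assoc]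
    exact (lipschitzGroupoid n).trans ((lipschitzGroupoid n).symm hβ) h1
  · rw [← OpenPartialHomeomorph.trans_assoc]
    exact (lipschitzGroupoid n).trans h2 hβ

lemma lastCoord_mono {n : ℕ} {u v : EuclideanSpace ℝ (Fin n)} (h : ∀ i, u i ≤ v i) :
    lastCoord n u ≤ lastCoord n v := by
  cases n
  exacts [le_rfl, h _]

end Charts

section Corner

variable {m : ℕ}

/-- The point of `ℝᵐ⁺¹` obtained by appending the last coordinate `s`. -/
def appendCoord (u : EuclideanSpace ℝ (Fin m)) (s : ℝ) : EuclideanSpace ℝ (Fin (m + 1)) :=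
  WithLp.toLp 2 (Fin.snoc (α := fun _ => ℝ) u s)

/-- The projection that forgets the last coordinate. -/
def dropCoord (v : EuclideanSpace ℝ (Fin (m + 1))) : EuclideanSpace ℝ (Fin m) :=
  WithLp.toLp 2 fun i => v i.castSucc

@[simp] lemma appendCoord_castSucc (u : EuclideanSpace ℝ (Fin m)) (s : ℝ) (i : Fin m) :
    appendCoord u s i.castSucc = u i := by simp [appendCoord]

@[simp] lemma appendCoord_last (u : EuclideanSpace ℝ (Fin m)) (s : ℝ) :
    appendCoord u s (Fin.last m) = s := by simp [appendCoord]

@[simp] lemma dropCoord_appendCoord (u : EuclideanSpace ℝ (Fin m)) (s : ℝ) :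
    dropCoord (appendCoord u s) = u := by ext i; simp [dropCoord]

@[simp] lemma appendCoord_dropCoord (v : EuclideanSpace ℝ (Fin (m + 1))) :
    appendCoord (dropCoord v) (v (Fin.last m)) = v := by
  ext i
  refine Fin.lastCases ?_ (fun j => ?_) i <;> simp [dropCoord]

lemma dist_appendCoord_sq (u v : EuclideanSpace ℝ (Fin m)) (s t : ℝ) :
    dist (appendCoord u s) (appendCoord v t) ^ 2 = dist u v ^ 2 + dist s t ^ 2 := by
  rw [EuclideanSpace.dist_eq, EuclideanSpace.dist_eq, Real.sq_sqrt (by positivity),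
    Real.sq_sqrt (by positivity), Fin.sum_univ_castSucc]
  simp

lemma dist_appendCoord_le (u v : EuclideanSpace ℝ (Fin m)) (s t : ℝ) :
    dist (appendCoord u s) (appendCoord v t) ≤ dist u v + dist s t := by
  refine abs_le_of_sq_le_sq' ?_ (by positivity) |>.2
  rw [dist_appendCoord_sq]
  nlinarith [mul_nonneg (dist_nonneg (x := u) (y := v)) (dist_nonneg (x := s) (y := t))]

lemma dist_appendCoord_same (u v : EuclideanSpace ℝ (Fin m)) (s : ℝ) :
    dist (appendCoord u s) (appendCoord v s) = dist u v := by
  have := dist_appendCoord_sq u v s s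
  rw [dist_self, zero_pow two_ne_zero, add_zero] at this
  exact (pow_left_inj₀ dist_nonneg dist_nonneg two_ne_zero).1 this

lemma dist_dropCoord_le (v w : EuclideanSpace ℝ (Fin (m + 1))) :
    dist (dropCoord v) (dropCoord w) ≤ dist v w := by
  refine abs_le_of_sq_le_sq' ?_ dist_nonneg |>.2
  conv_rhs => rw [← appendCoord_dropCoord v, ← appendCoord_dropCoord w]
  rw [dist_appendCoord_sq]
  nlinarith [sq_nonneg (dist (v (Fin.last m)) (w (Fin.last m)))]

lemma dist_last_le (v w : EuclideanSpace ℝ (Fin (m + 1))) :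
    dist (v (Fin.last m)) (w (Fin.last m)) ≤ dist v w := by
  refine abs_le_of_sq_le_sq' ?_ dist_nonneg |>.2
  conv_rhs => rw [← appendCoord_dropCoord v, ← appendCoord_dropCoord w]
  rw [dist_appendCoord_sq]
  nlinarith [sq_nonneg (dist (dropCoord v) (dropCoord w))]

lemma continuous_appendCoord :
    Continuous fun p : EuclideanSpace ℝ (Fin m) × ℝ => appendCoord p.1 p.2 := by
  refine (LipschitzWith.of_dist_le_mul (K := 2) fun p q => ?_).continuous
  refine (dist_appendCoord_le _ _ _ _).trans ?_
  have h1 : dist p.1 q.1 ≤ dist p q := le_max_left _ _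
  have h2 : dist p.2 q.2 ≤ dist p q := le_max_right _ _
  norm_num
  linarith

lemma continuous_dropCoord : Continuous (dropCoord (m := m)) :=
  (LipschitzWith.of_dist_le_mul (K := 1) fun v w => by
    simpa using dist_dropCoord_le v w).continuous

/-- The product of a partial homeomorphism of `ℝᵐ` with the identity of `ℝ`. -/
def prodLine (β : OpenPartialHomeomorph (EuclideanSpace ℝ (Fin m)) (EuclideanSpace ℝ (Fin m))) :
    OpenPartialHomeomorph (EuclideanSpace ℝ (Fin (m + 1))) (EuclideanSpace ℝ (Fin (m + 1))) where
  toFun v := appendCoord (β (dropCoord v)) (v (Fin.last m))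
  invFun v := appendCoord (β.symm (dropCoord v)) (v (Fin.last m))
  source := dropCoord ⁻¹' β.source
  target := dropCoord ⁻¹' β.target
  map_source' v hv := by simpa using β.map_source hv
  map_target' v hv := by simpa using β.map_target hv
  left_inv' v hv := by simp [β.left_inv hv]
  right_inv' v hv := by simp [β.right_inv hv]
  open_source := β.open_source.preimage continuous_dropCoord
  open_target := β.open_target.preimage continuous_dropCoord
  continuousOn_toFun := continuous_appendCoord.comp_continuousOn
    ((β.continuousOn.comp continuous_dropCoord.continuousOn fun v hv => hv).prodMk (by fun_prop))
  continuousOn_invFun := continuous_appendCoord.comp_continuousOn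
    ((β.symm.continuousOn.comp continuous_dropCoord.continuousOn fun v hv => hv).prodMk (by fun_prop))

lemma LocallyLipschitzOn.prodLine {s : Set (EuclideanSpace ℝ (Fin m))}
    {f : EuclideanSpace ℝ (Fin m) → EuclideanSpace ℝ (Fin m)} (hf : LocallyLipschitzOn s f) :
    LocallyLipschitzOn (dropCoord ⁻¹' s) fun v => appendCoord (f (dropCoord v)) (v (Fin.last m)) := by
  intro v hv
  obtain ⟨K, t, ht, hK⟩ := hf (x := dropCoord v) hv
  refine ⟨K + 1, dropCoord ⁻¹' t, ?_, LipschitzOnWith.of_dist_le_mul fun x hx y hy => ?_⟩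
  · exact (continuous_dropCoord.continuousWithinAt).tendsto_nhdsWithin (fun x hx => hx) ht
  · refine (dist_appendCoord_le _ _ _ _).trans ?_
    have h1 := hK.dist_le_mul _ hx _ hy
    have h2 := dist_last_le x y
    have h3 := mul_le_mul_of_nonneg_left (dist_dropCoord_le x y) K.coe_nonneg
    push_cast
    linarith

lemma prodLine_mem_lipschitzGroupoid
    {β : OpenPartialHomeomorph (EuclideanSpace ℝ (Fin m)) (EuclideanSpace ℝ (Fin m))}
    (h1 : LocallyLipschitzOn β.source β) (h2 : LocallyLipschitzOn β.target β.symm) :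
    prodLine β ∈ lipschitzGroupoid (m + 1) :=
  mem_groupoid_of_pregroupoid.2 ⟨h1.prodLine, h2.prodLine⟩

variable {R : Type*} [TopologicalSpace R]

open Classical in
/-- The restriction to `∂M` of a boundary chart of `M`, as a chart with values in `ℝᵐ`. The point `x` is the
value of the inverse outside the target. -/
def boundaryChart {M : Set R} (φ : OpenPartialHomeomorph R (EuclideanSpace ℝ (Fin (m + 1))))
    (hφ : ∀ y ∈ φ.source, y ∈ frontier M ↔ φ y (Fin.last m) = 0) (x : frontier M) :
    OpenPartialHomeomorph (frontier M) (EuclideanSpace ℝ (Fin m)) where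
  toFun y := dropCoord (φ y)
  invFun u := if h : φ.symm (appendCoord u 0) ∈ frontier M then ⟨_, h⟩ else x
  source := Subtype.val ⁻¹' φ.source
  target := {u | appendCoord u 0 ∈ φ.target}
  map_source' y hy := by
    have h : φ y (Fin.last m) = 0 := (hφ y hy).1 y.2
    have : appendCoord (dropCoord (φ y)) 0 = φ y := by rw [← h, appendCoord_dropCoord]
    simpa only [mem_ofPred_eq, this] using φ.map_source hy
  map_target' u hu := by
    have h : φ.symm (appendCoord u 0) ∈ frontier M := by
      rw [hφ _ (φ.map_target hu), φ.right_inv hu, appendCoord_last]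
    simp only [h, dif_pos, mem_preimage]
    exact φ.map_target hu
  left_inv' y hy := by
    have h : φ y (Fin.last m) = 0 := (hφ y hy).1 y.2
    have h' : appendCoord (dropCoord (φ y)) 0 = φ y := by rw [← h, appendCoord_dropCoord]
    have : φ.symm (appendCoord (dropCoord (φ y)) 0) = y := by rw [h', φ.left_inv hy]
    simp only [this, y.2, dif_pos]
  right_inv' u hu := by
    have h : φ.symm (appendCoord u 0) ∈ frontier M := by
      rw [hφ _ (φ.map_target hu), φ.right_inv hu, appendCoord_last]
    simp only [h, dif_pos]
    rw [φ.right_inv hu, dropCoord_appendCoord]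
  open_source := φ.open_source.preimage continuous_subtype_val
  open_target := φ.open_target.preimage (continuous_appendCoord.comp (by fun_prop :
    Continuous fun u : EuclideanSpace ℝ (Fin m) => (u, (0 : ℝ))))
  continuousOn_toFun := continuous_dropCoord.comp_continuousOn
    (φ.continuousOn.comp continuous_subtype_val.continuousOn fun y hy => hy)
  continuousOn_invFun := by
    rw [Topology.IsInducing.subtypeVal.continuousOn_iff]
    have hc : ContinuousOn (fun u : EuclideanSpace ℝ (Fin m) => φ.symm (appendCoord u 0))
        {u | appendCoord u 0 ∈ φ.target} :=
      φ.symm.continuousOn.comp (continuous_appendCoord.comp (by fun_prop :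
        Continuous fun u : EuclideanSpace ℝ (Fin m) => (u, (0 : ℝ)))).continuousOn fun u hu => hu
    refine hc.congr fun u hu => ?_
    have h : φ.symm (appendCoord u 0) ∈ frontier M := by
      rw [hφ _ (φ.map_target hu), φ.right_inv hu, appendCoord_last]
    simp only [Function.comp, h, dif_pos]

variable [ChartedSpace (EuclideanSpace ℝ (Fin (m + 1))) R]

/-- A boundary chart `φ` of `M` and a bilipschitz chart `ψ` of `∂M` combine to a bilipschitz chart of `R`: its
last coordinate is that of `φ`, and on `∂M` the other coordinates are those of `ψ`. -/
lemma exists_cornerChart {M : Set R} {φ : OpenPartialHomeomorph R (EuclideanSpace ℝ (Fin (m + 1)))}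
    (hφ : φ ∈ lipCharts (m + 1) R) (hφM : ∀ y ∈ φ.source, y ∈ frontier M ↔ φ y (Fin.last m) = 0)
    {ψ : OpenPartialHomeomorph (frontier M) (EuclideanSpace ℝ (Fin m))}
    (hψ : ψ ∈ boundaryLipCharts (m + 1) M) {x : frontier M} (hxφ : (x : R) ∈ φ.source)
    (hxψ : x ∈ ψ.source) :
    ∃ χ ∈ lipCharts (m + 1) R, (x : R) ∈ χ.source ∧ χ.source ⊆ φ.source ∧
      (∀ y ∈ χ.source, χ y (Fin.last m) = φ y (Fin.last m)) ∧
      ∀ y : frontier M, (y : R) ∈ χ.source → y ∈ ψ.source ∧ dropCoord (χ y) = ψ y := by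
  -- the chart is `φ` followed by the product of the transition map from `φ|∂M` to `ψ` with `id`
  set κ := boundaryChart φ hφM x with hκ
  have hκφ : ∀ u ∈ κ.target, φ (κ.symm u) = appendCoord u 0 := by
    intro u hu
    have h : φ.symm (appendCoord u 0) ∈ frontier M := by
      rw [hφM _ (φ.map_target hu), φ.right_inv hu, appendCoord_last]
    have : (κ.symm u : R) = φ.symm (appendCoord u 0) := by
      simp [hκ, boundaryChart, h]
    rw [this, φ.right_inv hu]
  set β := κ.symm.trans ψ with hβ
  have hbil := hψ φ hφ
  have hmaps : MapsTo β β.source (ψ.target ∩ {x | (ψ.symm x : R) ∈ φ.source}) := by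
    intro u hu
    have hu' : u ∈ κ.target ∧ κ.symm u ∈ ψ.source := by simpa [hβ] using hu
    refine ⟨β.map_source hu |>.1, ?_⟩
    change (ψ.symm (ψ (κ.symm u)) : R) ∈ φ.source
    rw [ψ.left_inv hu'.2]
    exact κ.map_target hu'.1
  have hinv : ∀ u ∈ β.source, φ (ψ.symm (β u)) = appendCoord u 0 := by
    intro u hu
    have hu' : u ∈ κ.target ∧ κ.symm u ∈ ψ.source := by simpa [hβ] using hu
    change φ (ψ.symm (ψ (κ.symm u))) = _
    rw [ψ.left_inv hu'.2, hκφ u hu'.1]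
  have h1 : LocallyLipschitzOn β.source β := by
    intro u hu
    obtain ⟨t, ht, K, hK, H⟩ := hbil (β u) (hmaps hu)
    refine ⟨K.toNNReal, β ⁻¹' t ∩ β.source, inter_mem
      ((β.continuousOn u hu).tendsto_nhdsWithin hmaps ht) self_mem_nhdsWithin,
      LipschitzOnWith.of_dist_le_mul fun y hy z hz => ?_⟩
    have : K⁻¹ * dist (β y) (β z) ≤ dist (φ (ψ.symm (β y))) (φ (ψ.symm (β z))) :=
      (H _ hy.1 _ hz.1).1
    rw [hinv y hy.2, hinv z hz.2, dist_appendCoord_same, inv_mul_le_iff₀ hK] at this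
    rwa [Real.coe_toNNReal _ hK.le]
  have h2 : LocallyLipschitzOn β.target β.symm := by
    have hsub : β.target ⊆ ψ.target ∩ {x | (ψ.symm x : R) ∈ φ.source} := by
      intro a ha
      simpa [hβ, hκ, boundaryChart] using ha
    intro a ha
    obtain ⟨t, ht, K, hK, H⟩ := hbil a (hsub ha)
    refine ⟨K.toNNReal, t, nhdsWithin_mono _ hsub ht,
      LipschitzOnWith.of_dist_le_mul fun y hy z hz => ?_⟩
    rw [Real.coe_toNNReal _ hK.le]
    exact (dist_dropCoord_le _ _).trans (H y hy z hz).2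
  have hsrc : ∀ y, y ∈ (φ.trans (prodLine β)).source ↔ y ∈ φ.source ∧ dropCoord (φ y) ∈ β.source := by
    intro y
    rw [OpenPartialHomeomorph.trans_source]
    rfl
  have hκsymm : ∀ y : frontier M, (y : R) ∈ φ.source → κ.symm (dropCoord (φ y)) = y :=
    fun y hy => κ.left_inv hy
  refine ⟨φ.trans (prodLine β), trans_mem_lipCharts hφ (prodLine_mem_lipschitzGroupoid h1 h2),
    ?_, fun y hy => ((hsrc y).1 hy).1, fun y hy => ?_, fun y hy => ?_⟩
  · rw [hsrc]
    refine ⟨hxφ, ?_⟩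
    rw [hβ, OpenPartialHomeomorph.trans_source]
    refine ⟨κ.map_source hxφ, ?_⟩
    rw [mem_preimage, hκsymm x hxφ]
    exact hxψ
  · exact appendCoord_last _ _
  · obtain ⟨hyφ, hyβ⟩ := (hsrc y).1 hy
    have : κ.symm (dropCoord (φ y)) ∈ ψ.source := by
      rw [hβ, OpenPartialHomeomorph.trans_source] at hyβ
      exact hyβ.2
    rw [hκsymm y hyφ] at this
    refine ⟨this, ?_⟩
    have e : dropCoord ((φ.trans (prodLine β)) y) = β (dropCoord (φ y)) := dropCoord_appendCoord _ _
    rw [e]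
    change ψ (κ.symm (dropCoord (φ y))) = _
    rw [hκsymm y hyφ]

end Corner

/-- A closed ball in a bilipschitz chart, in which increasing the coordinates keeps `M`, and also
keeps `D` provided that the last coordinate is kept. -/
structure AdaptedBall (n : ℕ) {R : Type*} [TopologicalSpace R]
    [ChartedSpace (EuclideanSpace ℝ (Fin n)) R] (M D : Set R) where
  /-- The chart. -/
  chart : OpenPartialHomeomorph R (EuclideanSpace ℝ (Fin n))
  chart_mem : chart ∈ lipCharts n R
  /-- The center of the ball. -/
  center : EuclideanSpace ℝ (Fin n)
  /-- The radius of the ball. -/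
  radius : ℝ
  radius_pos : 0 < radius
  closedBall_subset : Metric.closedBall center radius ⊆ chart.target
  symm_mem_left : ∀ u ∈ Metric.closedBall center radius, ∀ v ∈ Metric.closedBall center radius,
    (∀ i, u i ≤ v i) → chart.symm u ∈ M → chart.symm v ∈ M
  symm_mem_right : ∀ u ∈ Metric.closedBall center radius, ∀ v ∈ Metric.closedBall center radius,
    (∀ i, u i ≤ v i) → lastCoord n u = lastCoord n v → chart.symm u ∈ D → chart.symm v ∈ D

section Adapted

variable {n : ℕ} {R : Type*} [TopologicalSpace R] [ChartedSpace (EuclideanSpace ℝ (Fin n)) R]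
  {M D : Set R}

/-- The part of the chart domain that corresponds to the concentric ball of half the radius. -/
def AdaptedBall.core (b : AdaptedBall n M D) : Set R :=
  b.chart.source ∩ b.chart ⁻¹' Metric.ball b.center (b.radius / 2)

lemma AdaptedBall.isOpen_core (b : AdaptedBall n M D) : IsOpen b.core :=
  b.chart.isOpen_inter_preimage Metric.isOpen_ball

lemma exists_adaptedBall_of_chart {φ : OpenPartialHomeomorph R (EuclideanSpace ℝ (Fin n))}
    (hφ : φ ∈ lipCharts n R) {x : R} (hx : x ∈ φ.source) {O : Set R} (hO : IsOpen O) (hxO : x ∈ O)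
    (h1 : ∀ y ∈ φ.source ∩ O, ∀ z ∈ φ.source ∩ O, (∀ i, φ y i ≤ φ z i) → y ∈ M → z ∈ M)
    (h2 : ∀ y ∈ φ.source ∩ O, ∀ z ∈ φ.source ∩ O, (∀ i, φ y i ≤ φ z i) →
      lastCoord n (φ y) = lastCoord n (φ z) → y ∈ D → z ∈ D) :
    ∃ b : AdaptedBall n M D, x ∈ b.core := by
  have hmem : φ x ∈ φ.target ∩ φ.symm ⁻¹' O := ⟨φ.map_source hx, by simpa [φ.left_inv hx] using hxO⟩
  obtain ⟨r, hr, hsub⟩ := Metric.nhds_basis_closedBall.mem_iff.1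
    ((φ.isOpen_inter_preimage_symm hO).mem_nhds hmem)
  have hs : ∀ u ∈ Metric.closedBall (φ x) r, φ.symm u ∈ φ.source ∩ O ∧ φ (φ.symm u) = u :=
    fun u hu => ⟨⟨φ.map_target (hsub hu).1, (hsub hu).2⟩, φ.right_inv (hsub hu).1⟩
  refine ⟨⟨φ, hφ, φ x, r, hr, fun u hu => (hsub hu).1, fun u hu v hv huv => ?_,
    fun u hu v hv huv hl => ?_⟩, hx, Metric.mem_ball_self (half_pos hr)⟩
  · refine h1 _ (hs u hu).1 _ (hs v hv).1 ?_
    rwa [(hs u hu).2, (hs v hv).2]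
  · refine h2 _ (hs u hu).1 _ (hs v hv).1 ?_ ?_
    · rwa [(hs u hu).2, (hs v hv).2]
    · rwa [(hs u hu).2, (hs v hv).2]

/-- Every point lies in the core of an adapted ball. For points outside `M` and in its interior any small ball
does. At a boundary point of `M`, a boundary chart of `M` does unless the point is a boundary point of `D`,
where a corner chart is used. -/
lemma exists_adaptedBall [HasGroupoid R (lipschitzGroupoid n)]
    (hM : IsClosedLipSubmanifold (lipCharts n R) M) {D : Set (frontier M)}
    (hD : IsClosedLipSubmanifold (boundaryLipCharts n M) D) (x : R) :
    ∃ b : AdaptedBall n M (Subtype.val '' D), x ∈ b.core := by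
  have hDfr : ∀ y ∈ Subtype.val '' D, y ∈ frontier M := by
    rintro _ ⟨y, -, rfl⟩; exact y.2
  have hDM : ∀ y ∈ Subtype.val '' D, y ∈ M := fun y hy => hM.1.frontier_subset (hDfr y hy)
  have hDcl : IsClosed (Subtype.val '' D) := isClosed_frontier.isClosedEmbedding_subtypeVal.isClosedMap _ hD.1
  have hchart : chartAt (EuclideanSpace ℝ (Fin n)) x ∈ lipCharts n R :=
    (lipschitzGroupoid n).chart_mem_maximalAtlas x
  by_cases hxM : x ∉ M
  · exact exists_adaptedBall_of_chart hchart (mem_chart_source _ x) hM.1.isOpen_compl hxM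
      (fun y hy _ _ _ h => absurd h hy.2) (fun y hy _ _ _ _ h => absurd (hDM y h) hy.2)
  by_cases hxi : x ∈ interior M
  · exact exists_adaptedBall_of_chart hchart (mem_chart_source _ x) isOpen_interior hxi
      (fun _ _ z hz _ _ => interior_subset hz.2) (fun y hy _ _ _ _ h => absurd hy.2 (hDfr y h).2)
  have hxf : x ∈ frontier M := ⟨subset_closure (not_not.1 hxM), hxi⟩
  obtain ⟨φ, hφ, hxφ, H⟩ := hM.2 x hxf
  have hφM : ∀ y ∈ φ.source, ∀ z ∈ φ.source, lastCoord n (φ y) ≤ lastCoord n (φ z) → y ∈ M → z ∈ M := by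
    intro y hy z hz hyz hyM
    by_contra hzM
    have := (H z hz).2.1.1 hzM
    exact (H y hy).2.1.2 (hyz.trans_lt this) hyM
  by_cases hxD : x ∉ Subtype.val '' D
  · exact exists_adaptedBall_of_chart hφ hxφ hDcl.isOpen_compl hxD
      (fun y hy z hz h => hφM y hy.1 z hz.1 (lastCoord_mono h)) (fun y hy _ _ _ _ h => absurd h hy.2)
  replace hxD := not_not.1 hxD
  obtain ⟨x, hxD, rfl⟩ := hxD
  by_cases hxDi : x ∈ interior D
  · obtain ⟨O, hO, hOD⟩ := isOpen_induced_iff.1 (isOpen_interior (s := D))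
    refine exists_adaptedBall_of_chart hφ hxφ hO (by rw [← hOD] at hxDi; exact hxDi)
      (fun y hy z hz h => hφM y hy.1 z hz.1 (lastCoord_mono h)) fun y hy z hz _ hl hyD => ?_
    have hzf : z ∈ frontier M := by
      rw [(H z hz.1).2.2, ← hl, ← (H y hy.1).2.2]
      exact hDfr y hyD
    refine ⟨⟨z, hzf⟩, interior_subset ?_, rfl⟩
    rw [← hOD]
    exact hz.2
  have hxDf : x ∈ frontier D := ⟨subset_closure hxD, hxDi⟩
  obtain ⟨ψ, hψ, hxψ, H'⟩ := hD.2 x hxDf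
  cases n with
  | zero =>
    -- the last coordinate is constantly zero, so that `M` contains the domain of `φ`
    refine absurd (interior_maximal (fun y hy => ?_) φ.open_source hxφ) hxi
    exact not_not.1 fun h => lt_irrefl _ ((H y hy).2.1.1 h)
  | succ m =>
    obtain ⟨χ, hχ, hxχ, hsub, hlast, hdrop⟩ := exists_cornerChart hφ (fun y hy => (H y hy).2.2) hψ
      hxφ hxψ
    refine exists_adaptedBall_of_chart hχ hxχ isOpen_univ (mem_univ _) (fun y hy z hz h => ?_)
      fun y hy z hz h hl hyD => ?_
    · refine hφM y (hsub hy.1) z (hsub hz.1) ?_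
      change φ y (Fin.last m) ≤ φ z (Fin.last m)
      rw [← hlast y hy.1, ← hlast z hz.1]
      exact h _
    · have hl' : φ y (Fin.last m) = φ z (Fin.last m) := by
        rw [← hlast y hy.1, ← hlast z hz.1]
        exact hl
      have hzf : z ∈ frontier M := by
        refine (H z (hsub hz.1)).2.2.2 ?_
        exact hl'.symm.trans ((H y (hsub hy.1)).2.2.1 (hDfr y hyD))
      obtain ⟨y, hyD, rfl⟩ := hyD
      refine ⟨⟨z, hzf⟩, ?_, rfl⟩
      obtain ⟨hyψ, hyd⟩ := hdrop y hy.1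
      obtain ⟨hzψ, hzd⟩ := hdrop ⟨z, hzf⟩ hz.1
      by_contra hzD
      have h3 := (H' _ hzψ).2.1.1 hzD
      refine (H' _ hyψ).2.1.2 (lt_of_le_of_lt (lastCoord_mono fun i => ?_) h3) hyD
      rw [← hyd, ← hzd]
      exact h i.castSucc

end Adapted

/-! ### Shifts in a chart and Lebesgue measure -/

section EuclideanVolume

variable {n : ℕ}

lemma volume_eq_smul_hausdorffMeasure (n : ℕ) :
    ∃ c : ℝ≥0, (volume : Measure (EuclideanSpace ℝ (Fin n))) = c • μH[(n : ℝ)] :=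
  ⟨_, Measure.isAddLeftInvariant_eq_smul volume (μH[(n : ℝ)])⟩

lemma LipschitzOnWith.volume_image_le {K : ℝ≥0}
    {f : EuclideanSpace ℝ (Fin n) → EuclideanSpace ℝ (Fin n)} {s : Set (EuclideanSpace ℝ (Fin n))}
    (hf : LipschitzOnWith K f s) : volume (f '' s) ≤ (K : ℝ≥0∞) ^ n * volume s := by
  obtain ⟨c, hc⟩ := volume_eq_smul_hausdorffMeasure n
  have h := hf.hausdorffMeasure_image_le (Nat.cast_nonneg n)
  rw [hc, Measure.smul_apply, Measure.smul_apply, ENNReal.smul_def, ENNReal.smul_def, smul_eq_mul,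
    smul_eq_mul, mul_left_comm]
  rw [ENNReal.rpow_natCast] at h
  gcongr

lemma AntilipschitzWith.volume_le_image {K : ℝ≥0}
    {f : EuclideanSpace ℝ (Fin n) → EuclideanSpace ℝ (Fin n)} (hf : AntilipschitzWith K f)
    (s : Set (EuclideanSpace ℝ (Fin n))) : volume s ≤ (K : ℝ≥0∞) ^ n * volume (f '' s) := by
  obtain ⟨c, hc⟩ := volume_eq_smul_hausdorffMeasure n
  have h := hf.le_hausdorffMeasure_image (Nat.cast_nonneg n) s
  rw [hc, Measure.smul_apply, Measure.smul_apply, ENNReal.smul_def, ENNReal.smul_def, smul_eq_mul,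
    smul_eq_mul, mul_left_comm]
  rw [ENNReal.rpow_natCast] at h
  gcongr

/-- The linear map which multiplies the last coordinate by `t` (the identity if `n = 0`). -/
def scaleLast (n : ℕ) (t : ℝ) : EuclideanSpace ℝ (Fin n) →ₗ[ℝ] EuclideanSpace ℝ (Fin n) :=
  Matrix.toLpLin 2 2 (Matrix.diagonal fun i : Fin n => if (i : ℕ) + 1 = n then t else 1)

lemma scaleLast_apply (t : ℝ) (w : EuclideanSpace ℝ (Fin n)) (i : Fin n) :
    scaleLast n t w i = if (i : ℕ) + 1 = n then t * w i else w i := by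
  simp [scaleLast, Matrix.toLpLin_apply, Matrix.mulVec_diagonal]

lemma continuous_scaleLast (n : ℕ) :
    Continuous fun p : ℝ × EuclideanSpace ℝ (Fin n) => scaleLast n p.1 p.2 := by
  refine (PiLp.continuous_toLp 2 _).comp (continuous_pi (f := fun (p : ℝ × EuclideanSpace ℝ (Fin n))
    (i : Fin n) => scaleLast n p.1 p.2 i) fun i => ?_)
  simp only [scaleLast_apply]
  split_ifs <;> fun_prop

lemma locallyLipschitz_scaleLast (w : EuclideanSpace ℝ (Fin n)) :
    LocallyLipschitz fun t : ℝ => scaleLast n t w := by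
  have : ContDiff ℝ 1 fun t : ℝ => scaleLast n t w := by
    rw [contDiff_euclidean]
    intro i
    simp only [scaleLast_apply]
    split_ifs <;> fun_prop
  exact this.locallyLipschitz

lemma le_det_scaleLast {t : ℝ} (ht : t ∈ Ioc (0 : ℝ) 1) : t ≤ LinearMap.det (scaleLast n t) := by
  have h : LinearMap.det (scaleLast n t) = ∏ i : Fin n, if (i : ℕ) + 1 = n then t else 1 := by
    rw [scaleLast, Matrix.toLpLin_eq_toLin, LinearMap.det_toLin, Matrix.det_diagonal]
  rw [h]
  cases n with
  | zero => simpa using ht.2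
  | succ m =>
    rw [Fin.prod_univ_castSucc]
    have : ∀ i : Fin m, (i : ℕ) ≠ m := fun i => i.2.ne
    simp [this]

lemma lintegral_scaleLast_le {t : ℝ} (ht : t ∈ Ioc (0 : ℝ) 1)
    {F : EuclideanSpace ℝ (Fin n) → ℝ≥0∞} (hF : Measurable F) :
    ∫⁻ w, F (scaleLast n t w) ≤ ENNReal.ofReal t⁻¹ * ∫⁻ w, F w := by
  have h0 := le_det_scaleLast (n := n) ht
  have hpos : 0 < LinearMap.det (scaleLast n t) := ht.1.trans_le h0
  have hm : Measurable (scaleLast n t) := (scaleLast n t).continuous_of_finiteDimensional.measurable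
  rw [← lintegral_map hF hm, Measure.map_linearMap_addHaar_eq_smul_addHaar _ hpos.ne',
    lintegral_smul_measure, smul_eq_mul]
  gcongr
  rw [abs_of_pos (inv_pos.2 hpos)]
  exact inv_anti₀ ht.1 h0

/-- Restrict every coordinate to the interval `[0, δ]`. This makes the shifts below defined for all
parameters, and monotone. -/
def clip (δ : ℝ) (w : EuclideanSpace ℝ (Fin n)) : EuclideanSpace ℝ (Fin n) :=
  WithLp.toLp 2 fun i => max 0 (min (w i) δ)

lemma clip_nonneg (δ : ℝ) (w : EuclideanSpace ℝ (Fin n)) (i : Fin n) : 0 ≤ clip δ w i :=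
  le_max_left _ _

lemma clip_of_mem {δ : ℝ} {w : EuclideanSpace ℝ (Fin n)} (h : ∀ i, w i ∈ Icc 0 δ) :
    clip δ w = w := by
  ext i
  simp [clip, min_eq_left (h i).2, max_eq_right (h i).1]

lemma norm_le_of_forall_abs_le {δ : ℝ} {w : EuclideanSpace ℝ (Fin n)} (h : ∀ i, |w i| ≤ δ) :
    ‖w‖ ≤ n * δ := by
  have e : w = ∑ i, w i • EuclideanSpace.single i (1 : ℝ) := by
    simpa using ((EuclideanSpace.basisFun (Fin n) ℝ).sum_repr w).symm
  rw [e]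
  refine (norm_sum_le _ _).trans ?_
  calc ∑ i, ‖w i • EuclideanSpace.single i (1 : ℝ)‖ ≤ ∑ _i : Fin n, δ :=
        Finset.sum_le_sum fun i _ => by simpa [norm_smul] using h i
    _ = n * δ := by simp

lemma norm_clip_le {δ : ℝ} (hδ : 0 ≤ δ) (w : EuclideanSpace ℝ (Fin n)) : ‖clip δ w‖ ≤ n * δ := by
  refine norm_le_of_forall_abs_le fun i => ?_
  rw [abs_of_nonneg (clip_nonneg _ _ _)]
  exact max_le hδ (min_le_right _ _)

lemma dist_clip_le (δ : ℝ) (v w : EuclideanSpace ℝ (Fin n)) :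
    dist (clip δ v) (clip δ w) ≤ dist v w := by
  rw [EuclideanSpace.dist_eq, EuclideanSpace.dist_eq]
  refine Real.sqrt_le_sqrt (Finset.sum_le_sum fun i _ => pow_le_pow_left₀ dist_nonneg ?_ 2)
  simp only [clip, Real.dist_eq]
  refine (abs_max_sub_max_le_max _ _ _ _).trans (max_le (by simp) ?_)
  exact (abs_min_sub_min_le_max _ _ _ _).trans (max_le le_rfl (by simp))

lemma lastCoord_clip {δ : ℝ} (hδ : 0 ≤ δ) {w : EuclideanSpace ℝ (Fin n)} (h : lastCoord n w = 0) :
    lastCoord n (clip δ w) = 0 := by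
  cases n
  · rfl
  · have h : w (Fin.last _) = 0 := h
    simp [lastCoord, clip, h, hδ]

end EuclideanVolume

namespace AdaptedBall

variable {n : ℕ} {R : Type*} [TopologicalSpace R] [ChartedSpace (EuclideanSpace ℝ (Fin n)) R]
  {M D : Set R} (b : AdaptedBall n M D)

/-- The bound for the coordinates of the shifts. It ensures that they have length at most an eighth of the
radius, so that the cut off shifts are injective and map the ball to itself. -/
def size : ℝ := b.radius / (8 * (n + 1))

lemma size_pos : 0 < b.size := div_pos b.radius_pos (by positivity)

lemma norm_clip_size_le (w : EuclideanSpace ℝ (Fin n)) : ‖clip b.size w‖ ≤ b.radius / 8 := by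
  refine (norm_clip_le b.size_pos.le w).trans ?_
  rw [size, mul_div_assoc', div_le_div_iff₀ (by positivity) (by norm_num)]
  have := b.radius_pos
  nlinarith

/-- A cutoff function: it is `1` on the ball of half the radius and `0` off the ball. -/
def cutoff (u : EuclideanSpace ℝ (Fin n)) : ℝ := max 0 (min (2 - 2 / b.radius * dist u b.center) 1)

lemma cutoff_nonneg (u) : 0 ≤ b.cutoff u := le_max_left _ _
lemma cutoff_le_one (u) : b.cutoff u ≤ 1 := max_le zero_le_one (min_le_right _ _)

lemma cutoff_eq_one {u} (hu : dist u b.center ≤ b.radius / 2) : b.cutoff u = 1 := by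
  have h : 2 / b.radius * dist u b.center ≤ 1 := by
    rw [div_mul_eq_mul_div, div_le_one b.radius_pos]; linarith
  rw [cutoff, min_eq_right (by linarith), max_eq_right zero_le_one]

lemma cutoff_eq_zero {u} (hu : b.radius ≤ dist u b.center) : b.cutoff u = 0 := by
  have h : 2 ≤ 2 / b.radius * dist u b.center := by
    rw [div_mul_eq_mul_div, le_div_iff₀ b.radius_pos]; linarith
  exact max_eq_left ((min_le_left _ _).trans (by linarith))

lemma cutoff_le {u} (hu : dist u b.center ≤ b.radius) :
    b.cutoff u ≤ 2 - 2 / b.radius * dist u b.center := by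
  have h : 2 / b.radius * dist u b.center ≤ 2 := by
    rw [div_mul_eq_mul_div, div_le_iff₀ b.radius_pos]; linarith
  exact max_le (by linarith) (min_le_left _ _)

lemma dist_cutoff_le (u v) : |b.cutoff u - b.cutoff v| ≤ 2 / b.radius * dist u v := by
  refine (abs_max_sub_max_le_max _ _ _ _).trans (max_le ?_ ?_)
  · have := b.radius_pos
    simp only [sub_self, abs_zero]; positivity
  refine (abs_min_sub_min_le_max _ _ _ _).trans (max_le ?_ ?_)
  · have e : (2 - 2 / b.radius * dist u b.center) - (2 - 2 / b.radius * dist v b.center) =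
        2 / b.radius * (dist v b.center - dist u b.center) := by ring
    have h : 0 < 2 / b.radius := div_pos two_pos b.radius_pos
    rw [e, abs_mul, abs_of_pos h, dist_comm u v]
    gcongr
    exact abs_dist_sub_le _ _ _
  · have := b.radius_pos
    simp only [sub_self, abs_zero]; positivity

/-- The shift by `w` in the chart, cut off outside the ball. -/
def move (u w : EuclideanSpace ℝ (Fin n)) : EuclideanSpace ℝ (Fin n) :=
  u + b.cutoff u • clip b.size w

lemma norm_cutoff_smul_sub_le (u v w : EuclideanSpace ℝ (Fin n)) :
    ‖b.cutoff u • clip b.size w - b.cutoff v • clip b.size w‖ ≤ dist u v / 4 := by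
  rw [← sub_smul, norm_smul, Real.norm_eq_abs]
  calc |b.cutoff u - b.cutoff v| * ‖clip b.size w‖ ≤ (2 / b.radius * dist u v) * (b.radius / 8) :=
        mul_le_mul (b.dist_cutoff_le u v) (b.norm_clip_size_le w) (norm_nonneg _)
          (mul_nonneg (div_pos two_pos b.radius_pos).le dist_nonneg)
    _ = dist u v / 4 := by have := b.radius_pos.ne'; field_simp; ring

lemma dist_move_le (u v w w' : EuclideanSpace ℝ (Fin n)) :
    dist (b.move u w) (b.move v w') ≤ 2 * dist u v + dist w w' := by
  have e : b.move u w - b.move v w' = (u - v) +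
      (b.cutoff u • clip b.size w - b.cutoff v • clip b.size w) +
      b.cutoff v • (clip b.size w - clip b.size w') := by
    simp only [move, smul_sub]; abel
  rw [dist_eq_norm, e]
  refine (norm_add₃_le).trans ?_
  have h1 := b.norm_cutoff_smul_sub_le u v w
  have h2 : ‖b.cutoff v • (clip b.size w - clip b.size w')‖ ≤ dist w w' := by
    rw [norm_smul, Real.norm_eq_abs, abs_of_nonneg (b.cutoff_nonneg v), ← dist_eq_norm]
    exact (mul_le_of_le_one_left dist_nonneg (b.cutoff_le_one v)).trans (dist_clip_le _ _ _)
  have h3 : ‖u - v‖ = dist u v := (dist_eq_norm _ _).symm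
  have := dist_nonneg (x := u) (y := v)
  linarith

lemma dist_le_dist_move (u v w : EuclideanSpace ℝ (Fin n)) :
    dist u v ≤ 2 * dist (b.move u w) (b.move v w) := by
  have e : u - v = (b.move u w - b.move v w) -
      (b.cutoff u • clip b.size w - b.cutoff v • clip b.size w) := by
    simp only [move]; abel
  have h1 := b.norm_cutoff_smul_sub_le u v w
  have h2 := norm_sub_le (b.move u w - b.move v w)
    (b.cutoff u • clip b.size w - b.cutoff v • clip b.size w)
  rw [← e, ← dist_eq_norm, ← dist_eq_norm] at h2
  have := dist_nonneg (x := b.move u w) (y := b.move v w)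
  linarith

lemma antilipschitz_move (w : EuclideanSpace ℝ (Fin n)) :
    AntilipschitzWith 2 fun u => b.move u w :=
  AntilipschitzWith.of_le_mul_dist fun u v => by simpa using b.dist_le_dist_move u v w

lemma continuous_move : Continuous fun p : EuclideanSpace ℝ (Fin n) × EuclideanSpace ℝ (Fin n) =>
    b.move p.1 p.2 := by
  refine (LipschitzWith.of_dist_le_mul (K := 3) fun p q => ?_).continuous
  refine (b.dist_move_le _ _ _ _).trans ?_
  have h1 : dist p.1 q.1 ≤ dist p q := le_max_left _ _
  have h2 : dist p.2 q.2 ≤ dist p q := le_max_right _ _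
  norm_num
  linarith

lemma move_of_notMem {u : EuclideanSpace ℝ (Fin n)}
    (hu : u ∉ Metric.closedBall b.center b.radius) (w) : b.move u w = u := by
  rw [Metric.mem_closedBall, not_le] at hu
  simp [move, b.cutoff_eq_zero hu.le]

lemma move_mem_closedBall {u : EuclideanSpace ℝ (Fin n)}
    (hu : u ∈ Metric.closedBall b.center b.radius) (w) :
    b.move u w ∈ Metric.closedBall b.center b.radius := by
  rw [Metric.mem_closedBall] at hu ⊢
  have h1 : dist (b.move u w) b.center ≤ dist u b.center + b.cutoff u * (b.radius / 8) := by
    have e : b.move u w - b.center = (u - b.center) + b.cutoff u • clip b.size w := by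
      simp only [move]; abel
    rw [dist_eq_norm, e, dist_eq_norm]
    refine (norm_add_le _ _).trans ?_
    rw [norm_smul, Real.norm_eq_abs, abs_of_nonneg (b.cutoff_nonneg u)]
    gcongr
    exacts [b.cutoff_nonneg u, b.norm_clip_size_le w]
  have h2 : b.cutoff u * (b.radius / 8) ≤ (2 - 2 / b.radius * dist u b.center) * (b.radius / 8) :=
    mul_le_mul_of_nonneg_right (b.cutoff_le hu) (by linarith [b.radius_pos])
  have h3 : (2 - 2 / b.radius * dist u b.center) * (b.radius / 8) =
      b.radius / 4 - dist u b.center / 4 := by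
    field_simp [b.radius_pos.ne']; ring
  linarith

lemma move_mem_target {u : EuclideanSpace ℝ (Fin n)} (hu : u ∈ b.chart.target) (w) :
    b.move u w ∈ b.chart.target := by
  by_cases h : u ∈ Metric.closedBall b.center b.radius
  · exact b.closedBall_subset (b.move_mem_closedBall h w)
  · rwa [b.move_of_notMem h]

/-- The part of `R` that corresponds to the closed ball. The shifts are the identity outside. -/
def carrier : Set R := b.chart.symm '' Metric.closedBall b.center b.radius

lemma isCompact_carrier : IsCompact b.carrier :=
  (isCompact_closedBall _ _).image_of_continuousOn (b.chart.symm.continuousOn.mono b.closedBall_subset)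

lemma carrier_subset_source : b.carrier ⊆ b.chart.source := by
  rintro _ ⟨u, hu, rfl⟩
  exact b.chart.map_target (b.closedBall_subset hu)

lemma mem_carrier_iff {x : R} (hx : x ∈ b.chart.source) :
    x ∈ b.carrier ↔ b.chart x ∈ Metric.closedBall b.center b.radius := by
  constructor
  · rintro ⟨u, hu, rfl⟩
    rwa [b.chart.right_inv (b.closedBall_subset hu)]
  · exact fun h => ⟨_, h, b.chart.left_inv hx⟩

open Classical in
/-- The self-map of `R` which is the cut off shift by `w` in the chart, and the identity outside the ball. -/
def shift (w : EuclideanSpace ℝ (Fin n)) (x : R) : R :=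
  if x ∈ b.chart.source then b.chart.symm (b.move (b.chart x) w) else x

lemma shift_of_mem_source {x : R} (hx : x ∈ b.chart.source) (w) :
    b.shift w x = b.chart.symm (b.move (b.chart x) w) := if_pos hx

lemma shift_of_notMem {x : R} (hx : x ∉ b.carrier) (w) : b.shift w x = x := by
  by_cases h : x ∈ b.chart.source
  · rw [b.shift_of_mem_source h, b.move_of_notMem ((b.mem_carrier_iff h).not.1 hx), b.chart.left_inv h]
  · exact if_neg h

lemma shift_zero (x : R) : b.shift 0 x = x := by
  by_cases h : x ∈ b.chart.source
  · have : clip b.size (0 : EuclideanSpace ℝ (Fin n)) = 0 := clip_of_mem fun i => ⟨le_rfl, b.size_pos.le⟩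
    rw [b.shift_of_mem_source h, move, this, smul_zero, add_zero, b.chart.left_inv h]
  · exact if_neg h

lemma shift_mem_source {x : R} (hx : x ∈ b.chart.source) (w) : b.shift w x ∈ b.chart.source := by
  rw [b.shift_of_mem_source hx]
  exact b.chart.map_target (b.move_mem_target (b.chart.map_source hx) w)

lemma chart_shift {x : R} (hx : x ∈ b.chart.source) (w) :
    b.chart (b.shift w x) = b.move (b.chart x) w := by
  rw [b.shift_of_mem_source hx, b.chart.right_inv (b.move_mem_target (b.chart.map_source hx) w)]

lemma shift_mem_left {x : R} (hx : x ∈ M) (w) : b.shift w x ∈ M := by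
  by_cases h : x ∈ b.carrier
  · have hs := b.carrier_subset_source h
    have hb := (b.mem_carrier_iff hs).1 h
    rw [b.shift_of_mem_source hs]
    refine b.symm_mem_left _ hb _ (b.move_mem_closedBall hb w) (fun i => ?_) ?_
    · simpa [move] using mul_nonneg (b.cutoff_nonneg _) (clip_nonneg b.size w i)
    · rwa [b.chart.left_inv hs]
  · rwa [b.shift_of_notMem h]

lemma shift_mem_right {x : R} (hx : x ∈ D) {w} (hw : lastCoord n w = 0) : b.shift w x ∈ D := by
  by_cases h : x ∈ b.carrier
  · have hs := b.carrier_subset_source h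
    have hb := (b.mem_carrier_iff hs).1 h
    rw [b.shift_of_mem_source hs]
    refine b.symm_mem_right _ hb _ (b.move_mem_closedBall hb w) (fun i => ?_) ?_ ?_
    · simpa [move] using mul_nonneg (b.cutoff_nonneg _) (clip_nonneg b.size w i)
    · have := lastCoord_clip b.size_pos.le hw
      cases n
      · rfl
      · simp only [lastCoord] at this
        simp [lastCoord, move, this]
    · rwa [b.chart.left_inv hs]
  · rwa [b.shift_of_notMem h]

lemma map_move_le (w : EuclideanSpace ℝ (Fin n)) :
    (volume.restrict (Metric.closedBall b.center b.radius)).map (fun u => b.move u w) ≤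
      (2 : ℝ≥0∞) ^ n • volume.restrict (Metric.closedBall b.center b.radius) := by
  have hm : Measurable fun u => b.move u w :=
    (b.continuous_move.comp (by fun_prop : Continuous fun u : EuclideanSpace ℝ (Fin n) => (u, w))).measurable
  refine Measure.le_iff.2 fun A hA => ?_
  rw [Measure.map_apply hm hA, Measure.smul_apply, Measure.restrict_apply (hm hA),
    Measure.restrict_apply hA, smul_eq_mul]
  refine ((b.antilipschitz_move w).volume_le_image _).trans ?_
  simp only [ENNReal.coe_ofNat]
  gcongr
  rintro _ ⟨u, ⟨hu, hu'⟩, rfl⟩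
  exact ⟨hu, b.move_mem_closedBall hu' w⟩

section

variable [MeasurableSpace R] [BorelSpace R]

/-- The image on `R` of Lebesgue measure on the ball. -/
def chartMeasure : Measure R :=
  (volume.restrict (Metric.closedBall b.center b.radius)).map b.chart.symm

lemma aemeasurable_symm :
    AEMeasurable b.chart.symm (volume.restrict (Metric.closedBall b.center b.radius)) :=
  (b.chart.symm.continuousOn.mono b.closedBall_subset).aemeasurable Metric.isClosed_closedBall.measurableSet

lemma lintegral_chartMeasure {F : R → ℝ≥0∞} (hF : Measurable F) :
    ∫⁻ x, F x ∂b.chartMeasure = ∫⁻ u in Metric.closedBall b.center b.radius, F (b.chart.symm u) :=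
  lintegral_map' hF.aemeasurable b.aemeasurable_symm

/-- The measure `lam` dominates `b.chartMeasure` and is comparable to it on the carrier of `b`. -/
def Comparable (lam : Measure R) : Prop :=
  b.chartMeasure ≤ lam ∧ ∃ C : ℝ≥0∞, C ≠ ∞ ∧ lam.restrict b.carrier ≤ C • b.chartMeasure

end

variable [T2Space R]

lemma isClosed_carrier : IsClosed b.carrier := b.isCompact_carrier.isClosed

lemma continuous_shift : Continuous fun p : EuclideanSpace ℝ (Fin n) × R => b.shift p.1 p.2 := by
  rw [continuous_iff_continuousAt]
  rintro ⟨w, x⟩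
  by_cases h : x ∈ b.chart.source
  · have h1 : ContinuousAt (fun p : EuclideanSpace ℝ (Fin n) × R =>
        b.chart.symm (b.move (b.chart p.2) p.1)) (w, x) := by
      have h2 : ContinuousAt (fun p : EuclideanSpace ℝ (Fin n) × R => b.chart p.2) (w, x) :=
        ContinuousAt.comp (f := Prod.snd) (g := b.chart) (b.chart.continuousAt h) continuousAt_snd
      have h3 : ContinuousAt (fun p : EuclideanSpace ℝ (Fin n) × R => b.move (b.chart p.2) p.1) (w, x) :=
        b.continuous_move.continuousAt.comp (h2.prodMk continuousAt_fst)
      exact ContinuousAt.comp (g := b.chart.symm)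
        (b.chart.symm.continuousAt (b.move_mem_target (b.chart.map_source h) w)) h3
    refine h1.congr ?_
    filter_upwards [continuousAt_snd.preimage_mem_nhds (b.chart.open_source.mem_nhds h)] with p hp
    exact (b.shift_of_mem_source hp p.1).symm
  · have h' : x ∉ b.carrier := fun hx => h (b.carrier_subset_source hx)
    refine (continuousAt_snd : ContinuousAt Prod.snd (w, x)).congr ?_
    filter_upwards [continuousAt_snd.preimage_mem_nhds
      (b.isClosed_carrier.isOpen_compl.mem_nhds h')] with p hp
    exact (b.shift_of_notMem hp p.1).symm

lemma chartLipschitz_shift [HasGroupoid R (lipschitzGroupoid n)] {X : Type*} [PseudoMetricSpace X]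
    {f : X → R} (hf : ChartLipschitz n f) {g : X → EuclideanSpace ℝ (Fin n)}
    (hg : LocallyLipschitz g) : ChartLipschitz n fun x => b.shift (g x) (f x) := by
  refine ⟨b.continuous_shift.comp (hg.continuous.prodMk hf.1), fun x => ?_⟩
  by_cases h : f x ∈ b.chart.source
  · obtain ⟨K, t, ht, hm, hK⟩ := hf.exists_lipschitzOnWith b.chart_mem h
    obtain ⟨L, s, hs, hL⟩ := hg x
    refine ⟨b.chart, b.chart_mem, b.shift_mem_source h _, 2 * K + L, t ∩ s, inter_mem ht hs,
      LipschitzOnWith.of_dist_le_mul fun y hy z hz => ?_⟩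
    simp only [Function.comp, b.chart_shift (hm hy.1), b.chart_shift (hm hz.1)]
    refine (b.dist_move_le _ _ _ _).trans ?_
    have h1 := hK.dist_le_mul _ hy.1 _ hz.1
    have h2 := hL.dist_le_mul _ hy.2 _ hz.2
    simp only [Function.comp] at h1
    push_cast
    linarith
  · have h' : f x ∉ b.carrier := fun hx => h (b.carrier_subset_source hx)
    obtain ⟨φ, hφ, hx, K, t, ht, hK⟩ := hf.2 x
    refine ⟨φ, hφ, by simpa only [b.shift_of_notMem h'] using hx, K, t ∩ f ⁻¹' b.carrierᶜ, inter_mem ht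
      (hf.1.continuousAt.preimage_mem_nhds (b.isClosed_carrier.isOpen_compl.mem_nhds h')),
      fun y hy z hz => ?_⟩
    simp only [Function.comp, b.shift_of_notMem hy.2, b.shift_of_notMem hz.2]
    exact hK hy.1 hz.1

variable [MeasurableSpace R] [BorelSpace R]

lemma measurable_shift (w : EuclideanSpace ℝ (Fin n)) : Measurable (b.shift w) :=
  (b.continuous_shift.comp (by fun_prop : Continuous fun x : R => (w, x))).measurable

/-- The shifts distort the measure by a bounded factor. -/
lemma Comparable.exists_lintegral_shift_le {b : AdaptedBall n M D} {lam : Measure R}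
    (h : b.Comparable lam) : ∃ C : ℝ≥0∞, C ≠ ∞ ∧ ∀ w, ∀ F : R → ℝ≥0∞, Measurable F →
      ∫⁻ x, F (b.shift w x) ∂lam ≤ C * ∫⁻ x, F x ∂lam := by
  obtain ⟨h1, C, hC, h2⟩ := h
  refine ⟨C * 2 ^ n + 1, by finiteness, fun w F hF => ?_⟩
  have hms : MeasurableSet b.carrier := b.isClosed_carrier.measurableSet
  rw [← lintegral_add_compl _ hms, add_mul, one_mul]
  refine add_le_add ?_ ?_
  · calc ∫⁻ x in b.carrier, F (b.shift w x) ∂lam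
        ≤ ∫⁻ x, F (b.shift w x) ∂(C • b.chartMeasure) := lintegral_mono' h2 le_rfl
      _ = C * ∫⁻ u in Metric.closedBall b.center b.radius, F (b.shift w (b.chart.symm u)) := by
          rw [lintegral_smul_measure, smul_eq_mul]
          congr 1
          exact b.lintegral_chartMeasure (hF.comp (b.measurable_shift w))
      _ = C * ∫⁻ u in Metric.closedBall b.center b.radius, F (b.chart.symm (b.move u w)) := by
          congr 1
          refine setLIntegral_congr_fun Metric.isClosed_closedBall.measurableSet fun u hu => ?_
          have ht := b.closedBall_subset hu
          simp only [b.shift_of_mem_source (b.chart.map_target ht), b.chart.right_inv ht]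
      _ ≤ C * ∫⁻ u, F (b.chart.symm u) ∂((volume.restrict
            (Metric.closedBall b.center b.radius)).map fun u => b.move u w) := by
          refine mul_le_mul_right (le_of_eq ?_) _
          have hm : Measurable fun u => b.move u w := (b.continuous_move.comp (by fun_prop :
            Continuous fun u : EuclideanSpace ℝ (Fin n) => (u, w))).measurable
          rw [lintegral_map' _ hm.aemeasurable]
          refine hF.comp_aemeasurable ?_
          exact (b.aemeasurable_symm.smul_measure _).mono_measure (b.map_move_le w)
      _ ≤ C * ∫⁻ u, F (b.chart.symm u) ∂((2 : ℝ≥0∞) ^ n •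
            volume.restrict (Metric.closedBall b.center b.radius)) := by
          gcongr
          exact b.map_move_le w
      _ = C * 2 ^ n * ∫⁻ x, F x ∂b.chartMeasure := by
          rw [lintegral_smul_measure, b.lintegral_chartMeasure hF, smul_eq_mul, mul_assoc]
      _ ≤ C * 2 ^ n * ∫⁻ x, F x ∂lam := by gcongr
  · calc ∫⁻ x in b.carrierᶜ, F (b.shift w x) ∂lam = ∫⁻ x in b.carrierᶜ, F x ∂lam :=
        setLIntegral_congr_fun hms.compl fun x hx => by simp only [b.shift_of_notMem hx]
      _ ≤ ∫⁻ x, F x ∂lam := setLIntegral_le_lintegral _ _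

end AdaptedBall

/-- The intersection of the open positive orthant with the ball of radius `ε` around the origin. -/
def smallOrthant (n : ℕ) (ε : ℝ) : Set (EuclideanSpace ℝ (Fin n)) :=
  {w | (∀ i, 0 < w i) ∧ ‖w‖ < ε}

lemma abs_apply_le_norm {n : ℕ} (w : EuclideanSpace ℝ (Fin n)) (i : Fin n) : |w i| ≤ ‖w‖ := by
  simpa using PiLp.norm_apply_le w i

lemma norm_scaleLast_le {n : ℕ} {t : ℝ} (ht : t ∈ Icc (0 : ℝ) 1) (w : EuclideanSpace ℝ (Fin n)) :
    ‖scaleLast n t w‖ ≤ ‖w‖ := by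
  rw [EuclideanSpace.norm_eq, EuclideanSpace.norm_eq]
  refine Real.sqrt_le_sqrt (Finset.sum_le_sum fun i _ => pow_le_pow_left₀ (norm_nonneg _) ?_ 2)
  rw [scaleLast_apply]
  split_ifs
  · rw [norm_mul, Real.norm_of_nonneg ht.1]
    exact mul_le_of_le_one_left (norm_nonneg _) ht.2
  · exact le_rfl

lemma isOpen_smallOrthant (n : ℕ) (ε : ℝ) : IsOpen (smallOrthant n ε) := by
  have h1 : IsOpen {w : EuclideanSpace ℝ (Fin n) | ∀ i, 0 < w i} := by
    simp only [ofPred_forall]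
    exact isOpen_iInter_of_finite fun i => isOpen_lt continuous_const (by fun_prop)
  exact h1.inter (isOpen_lt continuous_norm continuous_const)

lemma smallOrthant_nonempty (n : ℕ) {ε : ℝ} (hε : 0 < ε) : (smallOrthant n ε).Nonempty := by
  refine ⟨WithLp.toLp 2 fun _ => ε / (n + 1), fun i => ?_, ?_⟩
  · exact div_pos hε (by positivity)
  · refine (norm_le_of_forall_abs_le (δ := ε / (n + 1)) fun i => ?_).trans_lt ?_
    · exact (abs_of_pos (div_pos hε (by positivity))).le
    · rw [mul_div_assoc', div_lt_iff₀ (by positivity)]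
      nlinarith

namespace AdaptedBall

variable {n : ℕ} {R : Type*} [TopologicalSpace R] [ChartedSpace (EuclideanSpace ℝ (Fin n)) R]
  {M D : Set R} [MeasurableSpace R] [BorelSpace R]

/-- For a point of the core, the average over the shifts is bounded by an integral over `R`: the shifted point
is `x + w` in the chart, with the last coordinate of `w` multiplied by `t`. -/
lemma Comparable.lintegral_smallOrthant_le {b : AdaptedBall n M D} {lam : Measure R}
    (h : b.Comparable lam) {ε : ℝ} (hε : ε ≤ b.size) {x : R} (hx : x ∈ b.core) {t : ℝ}
    (ht : t ∈ Ioc (0 : ℝ) 1) {F : R → ℝ≥0∞} (hF : Measurable F) :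
    ∫⁻ w in smallOrthant n ε, F (b.shift (scaleLast n t w) x) ≤
      ENNReal.ofReal t⁻¹ * ∫⁻ y, F y ∂lam := by
  classical
  set B := Metric.closedBall b.center b.radius with hB
  have hBm : MeasurableSet B := Metric.isClosed_closedBall.measurableSet
  -- a measurable extension of the inverse of the chart
  set sy : EuclideanSpace ℝ (Fin n) → R := B.piecewise b.chart.symm fun _ => x with hsy
  have hsym : Measurable sy := ContinuousOn.measurable_piecewise
    (b.chart.symm.continuousOn.mono b.closedBall_subset) continuousOn_const hBm
  set G : EuclideanSpace ℝ (Fin n) → ℝ≥0∞ := B.indicator fun u => F (sy u) with hG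
  have hGm : Measurable G := (hF.comp hsym).indicator hBm
  have hGt : Measurable fun v => G (b.chart x + v) := hGm.comp (measurable_const_add _)
  calc ∫⁻ w in smallOrthant n ε, F (b.shift (scaleLast n t w) x)
      ≤ ∫⁻ w in smallOrthant n ε, G (b.chart x + scaleLast n t w) := by
        refine setLIntegral_mono' (isOpen_smallOrthant n ε).measurableSet fun w hw => le_of_eq ?_
        have hn := norm_scaleLast_le ⟨ht.1.le, ht.2⟩ w
        have hclip : clip b.size (scaleLast n t w) = scaleLast n t w := by
          refine clip_of_mem fun i => ⟨?_, ?_⟩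
          · rw [scaleLast_apply]
            split_ifs
            exacts [(mul_pos ht.1 (hw.1 i)).le, (hw.1 i).le]
          · exact (le_abs_self _).trans ((abs_apply_le_norm _ i).trans (hn.trans (hw.2.le.trans hε)))
        have hd : dist (b.chart x) b.center < b.radius / 2 := hx.2
        have hmove : b.move (b.chart x) (scaleLast n t w) = b.chart x + scaleLast n t w := by
          rw [move, hclip, b.cutoff_eq_one hd.le, one_smul]
        have hmem : b.chart x + scaleLast n t w ∈ B := by
          rw [← hmove]
          exact b.move_mem_closedBall (Metric.mem_closedBall.2 (by linarith [b.radius_pos])) _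
        rw [b.shift_of_mem_source hx.1, hmove, hG, indicator_of_mem hmem, hsy,
          piecewise_eq_of_mem _ _ _ hmem]
    _ ≤ ∫⁻ w, G (b.chart x + scaleLast n t w) := setLIntegral_le_lintegral _ _
    _ ≤ ENNReal.ofReal t⁻¹ * ∫⁻ v, G (b.chart x + v) := lintegral_scaleLast_le ht hGt
    _ = ENNReal.ofReal t⁻¹ * ∫⁻ u in B, F (b.chart.symm u) := by
        rw [lintegral_add_left_eq_self, hG, lintegral_indicator hBm]
        congr 1
        refine setLIntegral_congr_fun hBm fun u hu => ?_
        simp only [hsy, piecewise_eq_of_mem _ _ _ hu]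
    _ = ENNReal.ofReal t⁻¹ * ∫⁻ y, F y ∂b.chartMeasure := by rw [b.lintegral_chartMeasure hF]
    _ ≤ ENNReal.ofReal t⁻¹ * ∫⁻ y, F y ∂lam := by
        gcongr
        exact h.1

end AdaptedBall

/-! ### Compositions of shifts and averages over their parameters -/

lemma measurable_scaleLast (n : ℕ) :
    Measurable fun p : ℝ × EuclideanSpace ℝ (Fin n) => scaleLast n p.1 p.2 :=
  (continuous_scaleLast n).measurable

lemma Measurable.scaleLast {n : ℕ} {Y : Type*} [MeasurableSpace Y] {τ : Y → ℝ} (hτ : Measurable τ)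
    {g : Y → EuclideanSpace ℝ (Fin n)} (hg : Measurable g) :
    Measurable fun y => scaleLast n (τ y) (g y) := by
  simpa only [Function.comp_def] using (measurable_scaleLast n).comp (hτ.prodMk hg)

/-- Young's inequality with a weight: the powers of the weight are chosen so that both terms have
the same integrability in `T` once the first one is divided by `T`. -/
lemma ENNReal.le_rpow_mul_add_rpow_neg {p r : ℝ} (hpr : p.HolderConjugate r) (a : ℝ≥0∞) {T : ℝ≥0∞}
    (hT0 : T ≠ 0) (hTt : T ≠ ∞) : a ≤ a ^ p * T ^ r⁻¹ + T ^ (-p⁻¹) := by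
  have hp0 := hpr.pos.ne'
  have hr0 := hpr.symm.pos.ne'
  calc a = (a * T ^ (p⁻¹ * r⁻¹)) * T ^ (-(p⁻¹ * r⁻¹)) := by
        rw [mul_assoc, ← ENNReal.rpow_add _ _ hT0 hTt, add_neg_cancel, ENNReal.rpow_zero, mul_one]
    _ ≤ _ := ENNReal.young_inequality _ _ hpr
    _ ≤ (a * T ^ (p⁻¹ * r⁻¹)) ^ p + (T ^ (-(p⁻¹ * r⁻¹))) ^ r := by
        gcongr
        · exact ENNReal.div_le_of_le_mul (le_mul_of_one_le_right' (by
            rw [← ENNReal.ofReal_one]; exact ENNReal.ofReal_le_ofReal hpr.lt.le))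
        · exact ENNReal.div_le_of_le_mul (le_mul_of_one_le_right' (by
            rw [← ENNReal.ofReal_one]; exact ENNReal.ofReal_le_ofReal hpr.symm.lt.le))
    _ = _ := by
        rw [ENNReal.mul_rpow_of_nonneg _ _ hpr.nonneg, ← ENNReal.rpow_mul, ← ENNReal.rpow_mul]
        congr 3
        · field_simp
        · field_simp

namespace AdaptedBall

section Composition

variable {n : ℕ} {R : Type*} [TopologicalSpace R] [ChartedSpace (EuclideanSpace ℝ (Fin n)) R]
  {M D : Set R}

/-- The composition of the shifts in finitely many balls. -/
def shiftAll : (N : ℕ) → (Fin N → AdaptedBall n M D) → (Fin N → EuclideanSpace ℝ (Fin n)) → R → R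
  | 0, _, _, x => x
  | N + 1, b, w, x => shiftAll N (Fin.tail b) (Fin.tail w) ((b 0).shift (w 0) x)

lemma shiftAll_zero (N : ℕ) (b : Fin N → AdaptedBall n M D) (x : R) :
    shiftAll N b (fun _ => 0) x = x := by
  induction N generalizing x with
  | zero => rfl
  | succ N ih =>
    simp only [shiftAll, shift_zero]
    exact ih _ x

lemma shiftAll_mem_left {N : ℕ} (b : Fin N → AdaptedBall n M D) (w) {x : R} (hx : x ∈ M) :
    shiftAll N b w x ∈ M := by
  induction N generalizing x with
  | zero => exact hx
  | succ N ih => exact ih _ _ ((b 0).shift_mem_left hx _)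

lemma shiftAll_mem_right {N : ℕ} (b : Fin N → AdaptedBall n M D)
    {w : Fin N → EuclideanSpace ℝ (Fin n)} (hw : ∀ i, lastCoord n (w i) = 0) {x : R} (hx : x ∈ D) :
    shiftAll N b w x ∈ D := by
  induction N generalizing x with
  | zero => exact hx
  | succ N ih => exact ih _ (fun i => hw i.succ) ((b 0).shift_mem_right hx (hw 0))

/-- The points `x` with the following property: for all parameters of norm at most `ε`, when `x` is moved by
the shifts one after the other, it is at some stage in the core of the ball of the next shift. -/
def reach (ε : ℝ) : (N : ℕ) → (Fin N → AdaptedBall n M D) → Set R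
  | 0, _ => ∅
  | N + 1, b => (b 0).core ∪ {x | ∀ w, ‖w‖ ≤ ε → (b 0).shift w x ∈ reach ε N (Fin.tail b)}

variable [T2Space R]

lemma continuous_shiftAll (N : ℕ) (b : Fin N → AdaptedBall n M D) :
    Continuous fun p : (Fin N → EuclideanSpace ℝ (Fin n)) × R => shiftAll N b p.1 p.2 := by
  induction N with
  | zero => exact continuous_snd
  | succ N ih =>
    have h1 : Continuous fun p : (Fin (N + 1) → EuclideanSpace ℝ (Fin n)) × R =>
        (b 0).shift (p.1 0) p.2 :=
      Continuous.comp (f := fun p : (Fin (N + 1) → EuclideanSpace ℝ (Fin n)) × R => (p.1 0, p.2))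
        (b 0).continuous_shift (by fun_prop)
    have h2 : Continuous fun p : (Fin (N + 1) → EuclideanSpace ℝ (Fin n)) × R => Fin.tail p.1 :=
      continuous_pi fun i => (continuous_apply i.succ).comp continuous_fst
    exact (ih (Fin.tail b)).comp (h2.prodMk h1)

lemma chartLipschitz_shiftAll [HasGroupoid R (lipschitzGroupoid n)] {X : Type*}
    [PseudoMetricSpace X] {N : ℕ} (b : Fin N → AdaptedBall n M D) {f : X → R}
    (hf : ChartLipschitz n f) {g : X → Fin N → EuclideanSpace ℝ (Fin n)}
    (hg : ∀ i, LocallyLipschitz fun x => g x i) :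
    ChartLipschitz n fun x => shiftAll N b (g x) (f x) := by
  induction N generalizing f with
  | zero => exact hf
  | succ N ih =>
    exact ih (Fin.tail b) ((b 0).chartLipschitz_shift hf (hg 0)) (g := fun x => Fin.tail (g x))
      fun i => hg i.succ

/-- Small shifts move compact sets only a little, so that a compact set which is covered by the cores is
reached for small parameters. -/
lemma exists_subset_reach [WeaklyLocallyCompactSpace R] {N : ℕ} (b : Fin N → AdaptedBall n M D)
    {K : Set R} (hK : IsCompact K) (hKb : K ⊆ ⋃ i, (b i).core) :
    ∃ ε₀ > 0, ∀ ε ≤ ε₀, K ⊆ reach ε N b := by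
  induction N generalizing K with
  | zero => exact ⟨1, one_pos, fun ε _ => fun x hx => by simpa using hKb hx⟩
  | succ N ih =>
    set O : Set R := ⋃ i, (Fin.tail b i).core with hO
    have hOo : IsOpen O := isOpen_iUnion fun i => (Fin.tail b i).isOpen_core
    have hK1 : IsCompact (K \ (b 0).core) := hK.diff (b 0).isOpen_core
    have hKO : K \ (b 0).core ⊆ O := by
      rintro x ⟨hx, hx0⟩
      obtain ⟨i, hi⟩ := mem_iUnion.1 (hKb hx)
      refine Fin.cases (fun h => absurd h hx0) (fun i h => ?_) i hi
      exact mem_iUnion.2 ⟨i, h⟩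
    obtain ⟨L, hL, hKL, hLO⟩ := exists_compact_between hK1 hOo hKO
    obtain ⟨ε₁, hε₁, H₁⟩ := ih (Fin.tail b) hL hLO
    have hopen : IsOpen {p : EuclideanSpace ℝ (Fin n) × R | (b 0).shift p.1 p.2 ∈ interior L} :=
      isOpen_interior.preimage (b 0).continuous_shift
    obtain ⟨u, v, hu, hv, h0u, hKv, huv⟩ := generalized_tube_lemma
      (isCompact_singleton (x := (0 : EuclideanSpace ℝ (Fin n)))) hK1 hopen (by
        rintro ⟨w, x⟩ ⟨hw, hx⟩
        rw [mem_singleton_iff] at hw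
        subst hw
        simpa only [mem_ofPred_eq, shift_zero] using hKL hx)
    obtain ⟨ε₂, hε₂, H₂⟩ := Metric.nhds_basis_closedBall.mem_iff.1 (hu.mem_nhds (h0u rfl))
    refine ⟨min ε₁ ε₂, lt_min hε₁ hε₂, fun ε hε x hx => ?_⟩
    by_cases hx0 : x ∈ (b 0).core
    · exact Or.inl hx0
    · refine Or.inr fun w hw => H₁ ε (hε.trans (min_le_left _ _)) ?_
      refine interior_subset (huv (mk_mem_prod (H₂ ?_) (hKv ⟨hx, hx0⟩)) : _ ∈ interior L)
      exact mem_closedBall_zero_iff.2 (hw.trans (hε.trans (min_le_right _ _)))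

variable [MeasurableSpace R] [BorelSpace R]

lemma exists_lintegral_shiftAll_le {N : ℕ} {b : Fin N → AdaptedBall n M D} {lam : Measure R}
    (h : ∀ i, (b i).Comparable lam) : ∃ C : ℝ≥0∞, C ≠ ∞ ∧ ∀ w, ∀ F : R → ℝ≥0∞, Measurable F →
      ∫⁻ x, F (shiftAll N b w x) ∂lam ≤ C * ∫⁻ x, F x ∂lam := by
  induction N with
  | zero => exact ⟨1, by simp, fun w F _ => by simp [shiftAll]⟩
  | succ N ih =>
    obtain ⟨C₁, hC₁, H₁⟩ := ih (b := Fin.tail b) fun i => h i.succ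
    obtain ⟨C₀, hC₀, H₀⟩ := (h 0).exists_lintegral_shift_le
    refine ⟨C₀ * C₁, by finiteness, fun w F hF => ?_⟩
    have hm : Measurable (shiftAll N (Fin.tail b) (Fin.tail w)) :=
      ((continuous_shiftAll N (Fin.tail b)).comp (by fun_prop :
        Continuous fun x : R => (Fin.tail w, x))).measurable
    calc ∫⁻ x, F (shiftAll (N + 1) b w x) ∂lam
        ≤ C₀ * ∫⁻ x, F (shiftAll N (Fin.tail b) (Fin.tail w) x) ∂lam := H₀ (w 0) _ (hF.comp hm)
      _ ≤ C₀ * (C₁ * ∫⁻ x, F x ∂lam) := by gcongr; exact H₁ _ F hF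
      _ = _ := (mul_assoc _ _ _).symm

end Composition

/-- The measure on the parameters of the shifts: the product of the Lebesgue measures on the small
orthants. -/
def shiftLaw (n N : ℕ) (ε : ℝ) : Measure (Fin N → EuclideanSpace ℝ (Fin n)) :=
  Measure.pi fun _ => volume.restrict (smallOrthant n ε)

instance isFiniteMeasure_restrict_smallOrthant (n : ℕ) (ε : ℝ) :
    IsFiniteMeasure ((volume : Measure (EuclideanSpace ℝ (Fin n))).restrict (smallOrthant n ε)) := by
  refine ⟨?_⟩
  rw [Measure.restrict_apply_univ]
  refine (measure_mono fun w hw => ?_).trans_lt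
    (measure_closedBall_lt_top (x := (0 : EuclideanSpace ℝ (Fin n))) (r := ε))
  exact mem_closedBall_zero_iff.2 hw.2.le

instance (n N : ℕ) (ε : ℝ) : IsFiniteMeasure (shiftLaw n N ε) := by
  unfold shiftLaw; infer_instance

lemma shiftLaw_ne_zero (n N : ℕ) {ε : ℝ} (hε : 0 < ε) : shiftLaw n N ε ≠ 0 := by
  intro h
  have h1 := congrArg (fun μ => μ univ) h
  simp only [shiftLaw, Measure.pi_univ, Measure.restrict_apply_univ, Measure.coe_zero,
    Pi.zero_apply, Finset.prod_const] at h1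
  exact ((isOpen_smallOrthant n ε).measure_pos volume (smallOrthant_nonempty n hε)).ne'
    (eq_zero_of_pow_eq_zero h1)

lemma lintegral_shiftLaw_succ {n N : ℕ} {ε : ℝ}
    {G : (Fin (N + 1) → EuclideanSpace ℝ (Fin n)) → ℝ≥0∞} (hG : Measurable G) :
    ∫⁻ w, G w ∂shiftLaw n (N + 1) ε =
      ∫⁻ v in smallOrthant n ε, ∫⁻ w, G (Fin.cons v w) ∂shiftLaw n N ε := by
  have h := (measurePreserving_piFinSuccAbove
    (fun _ : Fin (N + 1) => (volume : Measure (EuclideanSpace ℝ (Fin n))).restrict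
      (smallOrthant n ε)) 0).symm
  have h1 := h.lintegral_comp hG
  have h2 : Measurable fun a => G
      ((MeasurableEquiv.piFinSuccAbove (fun _ => EuclideanSpace ℝ (Fin n)) 0).symm a) :=
    hG.comp (MeasurableEquiv.measurable _)
  rw [shiftLaw, ← h1, lintegral_prod _ h2.aemeasurable]
  simp only [shiftLaw, MeasurableEquiv.piFinSuccAbove_symm_apply, Fin.insertNthEquiv_zero]
  rfl

section Average

variable {n : ℕ} {R : Type*} [TopologicalSpace R] [ChartedSpace (EuclideanSpace ℝ (Fin n)) R]
  {M D : Set R} [T2Space R] [SecondCountableTopology R] [MeasurableSpace R] [BorelSpace R]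

lemma measurable_shiftAll {Y : Type*} [MeasurableSpace Y] {N : ℕ} (b : Fin N → AdaptedBall n M D)
    {g : Y → Fin N → EuclideanSpace ℝ (Fin n)} (hg : Measurable g) {q : Y → R} (hq : Measurable q) :
    Measurable fun y => shiftAll N b (g y) (q y) :=
  (continuous_shiftAll N b).measurable.comp (hg.prodMk hq)

/-- The average over the parameters, with their last coordinates multiplied by `t`, is bounded by an integral
over `R`. At the stage where the point is in a core, integrate over the parameter of the next shift first;
the remaining shifts distort `lam` by bounded factors. -/
lemma exists_lintegral_shiftLaw_le {N : ℕ} {b : Fin N → AdaptedBall n M D} {lam : Measure R}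
    [SFinite lam] (h : ∀ i, (b i).Comparable lam) {ε : ℝ} (hε : ∀ i, ε ≤ (b i).size) :
    ∃ C : ℝ≥0∞, C ≠ ∞ ∧ ∀ x ∈ reach ε N b, ∀ t ∈ Ioc (0 : ℝ) 1, ∀ F : R → ℝ≥0∞, Measurable F →
      ∫⁻ w, F (shiftAll N b (fun i => scaleLast n t (w i)) x) ∂shiftLaw n N ε ≤
        C * ENNReal.ofReal t⁻¹ * ∫⁻ y, F y ∂lam := by
  induction N with
  | zero => exact ⟨0, by simp, fun x hx => hx.elim⟩
  | succ N ih =>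
    obtain ⟨C₁, hC₁, H₁⟩ := ih (b := Fin.tail b) (fun i => h i.succ) fun i => hε i.succ
    obtain ⟨C₂, hC₂, H₂⟩ := exists_lintegral_shiftAll_le (b := Fin.tail b) fun i => h i.succ
    set c₁ := shiftLaw n N ε univ with hc₁
    set c₂ := (volume : Measure (EuclideanSpace ℝ (Fin n))).restrict (smallOrthant n ε) univ with hc₂
    have hc₁' : c₁ ≠ ∞ := measure_ne_top _ _
    have hc₂' : c₂ ≠ ∞ := measure_ne_top _ _
    refine ⟨C₂ * c₁ + C₁ * c₂, by finiteness, fun x hx t ht F hF => ?_⟩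
    have hs : Measurable (scaleLast n t) :=
      (scaleLast n t).continuous_of_finiteDimensional.measurable
    have hmeas : Measurable fun p : EuclideanSpace ℝ (Fin n) × (Fin N → EuclideanSpace ℝ (Fin n)) =>
        F (shiftAll N (Fin.tail b) (fun i => scaleLast n t (p.2 i))
          ((b 0).shift (scaleLast n t p.1) x)) := by
      refine hF.comp (measurable_shiftAll _ ?_ ?_)
      · exact measurable_pi_lambda _ fun i => hs.comp ((measurable_pi_apply i).comp measurable_snd)
      · exact (b 0).continuous_shift.measurable.comp ((hs.comp measurable_fst).prodMk measurable_const)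
    have hmeas' : Measurable fun w : Fin (N + 1) → EuclideanSpace ℝ (Fin n) =>
        F (shiftAll (N + 1) b (fun i => scaleLast n t (w i)) x) := by
      refine hF.comp (measurable_shiftAll _ ?_ measurable_const)
      exact measurable_pi_lambda _ fun i => hs.comp (measurable_pi_apply i)
    rw [lintegral_shiftLaw_succ hmeas']
    change ∫⁻ v in smallOrthant n ε, ∫⁻ w, F (shiftAll N (Fin.tail b) (fun i => scaleLast n t (w i))
          ((b 0).shift (scaleLast n t v) x)) ∂shiftLaw n N ε ≤ _
    rcases hx with hx | hx
    -- `x` lies in the first core: the parameter of the first shift is integrated first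
    · rw [lintegral_lintegral_swap hmeas.aemeasurable]
      calc ∫⁻ w, (∫⁻ v in smallOrthant n ε, F (shiftAll N (Fin.tail b)
            (fun i => scaleLast n t (w i)) ((b 0).shift (scaleLast n t v) x))) ∂shiftLaw n N ε
          ≤ ∫⁻ _w, ENNReal.ofReal t⁻¹ * (C₂ * ∫⁻ y, F y ∂lam) ∂shiftLaw n N ε := by
            refine lintegral_mono fun w => ?_
            have hm : Measurable (shiftAll N (Fin.tail b) fun i => scaleLast n t (w i)) :=
              ((continuous_shiftAll N (Fin.tail b)).comp (by fun_prop :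
                Continuous fun x : R => (fun i => scaleLast n t (w i), x))).measurable
            refine ((h 0).lintegral_smallOrthant_le (hε 0) hx ht (hF.comp hm)).trans ?_
            gcongr
            exact H₂ _ F hF
        _ = C₂ * c₁ * ENNReal.ofReal t⁻¹ * ∫⁻ y, F y ∂lam := by
            rw [lintegral_const]; ring
        _ ≤ (C₂ * c₁ + C₁ * c₂) * ENNReal.ofReal t⁻¹ * ∫⁻ y, F y ∂lam := by
            gcongr
            exact le_self_add
    · calc ∫⁻ v in smallOrthant n ε, ∫⁻ w, F (shiftAll N (Fin.tail b)
            (fun i => scaleLast n t (w i)) ((b 0).shift (scaleLast n t v) x)) ∂shiftLaw n N ε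
          ≤ ∫⁻ _v in smallOrthant n ε, C₁ * ENNReal.ofReal t⁻¹ * ∫⁻ y, F y ∂lam := by
            refine setLIntegral_mono' (isOpen_smallOrthant n ε).measurableSet fun v hv => ?_
            refine H₁ _ (hx _ ?_) t ht F hF
            exact (norm_scaleLast_le ⟨ht.1.le, ht.2⟩ v).trans hv.2.le
        _ = C₁ * c₂ * ENNReal.ofReal t⁻¹ * ∫⁻ y, F y ∂lam := by
            rw [lintegral_const]; ring
        _ ≤ (C₂ * c₁ + C₁ * c₂) * ENNReal.ofReal t⁻¹ * ∫⁻ y, F y ∂lam := by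
            gcongr
            exact le_add_self

/-- The combination of Young's inequality and Tonelli's theorem, for a function `G` whose average over the
parameters is controlled by the inverse of the height `τ`. -/
lemma lintegral_lintegral_shiftAll_lt_top {N : ℕ} {ε : ℝ} {C I : ℝ≥0∞} (hC : C ≠ ∞) (hI : I ≠ ∞)
    {p : ℝ} (hp : 1 < p) {X : Type*} [MeasurableSpace X] {m : Measure X} [SFinite m]
    {G : (Fin N → EuclideanSpace ℝ (Fin n)) → X → ℝ≥0∞} (hG : Measurable (Function.uncurry G))
    {τ : X → ℝ} (hτ : Measurable τ) (hτ1 : ∀ᵐ x ∂m, τ x ≤ 1)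
    (hτp : ∫⁻ x, ENNReal.ofReal (τ x) ^ (-p⁻¹) ∂m ≠ ∞)
    (H : ∀ x, τ x ∈ Ioc (0 : ℝ) 1 →
      ∫⁻ w, G w x ^ p ∂shiftLaw n N ε ≤ C * ENNReal.ofReal (τ x)⁻¹ * I) :
    ∫⁻ w, ∫⁻ x, G w x ∂m ∂shiftLaw n N ε < ∞ := by
  have hpr := Real.HolderConjugate.conjExponent hp
  set r := p.conjExponent with hr
  set T : X → ℝ≥0∞ := fun x => ENNReal.ofReal (τ x) with hT
  have hTm : Measurable T := hτ.ennreal_ofReal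
  have hTt : ∀ x, T x ≠ ∞ := fun x => ENNReal.ofReal_ne_top
  -- the junk value `0 ^ (-1 / p) = ∞` is excluded by integrability
  have hτ0 : ∀ᵐ x ∂m, 0 < τ x := by
    filter_upwards [ae_lt_top (hTm.pow_const _) hτp] with x hx
    by_contra hneg
    have h0 : T x = 0 := ENNReal.ofReal_of_nonpos (not_lt.1 hneg)
    simp only [h0] at hx
    rw [ENNReal.zero_rpow_of_neg (by simpa using hpr.pos)] at hx
    exact lt_irrefl _ hx
  have hmf : Measurable fun y : (Fin N → EuclideanSpace ℝ (Fin n)) × X =>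
      G y.1 y.2 ^ p * T y.2 ^ r⁻¹ :=
    (hG.pow_const p).mul ((hTm.pow_const _).comp measurable_snd)
  calc ∫⁻ w, ∫⁻ x, G w x ∂m ∂shiftLaw n N ε
      ≤ ∫⁻ w, (∫⁻ x, G w x ^ p * T x ^ r⁻¹ ∂m + ∫⁻ x, T x ^ (-p⁻¹) ∂m) ∂shiftLaw n N ε := by
        refine lintegral_mono fun w => ?_
        rw [← lintegral_add_right _ (hTm.pow_const _)]
        refine lintegral_mono_ae ?_
        filter_upwards [hτ0] with x hx
        exact ENNReal.le_rpow_mul_add_rpow_neg hpr _ (ENNReal.ofReal_pos.2 hx).ne' (hTt x)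
    _ = ∫⁻ x, ∫⁻ w, G w x ^ p * T x ^ r⁻¹ ∂shiftLaw n N ε ∂m +
          (∫⁻ x, T x ^ (-p⁻¹) ∂m) * shiftLaw n N ε univ := by
        rw [lintegral_add_right _ measurable_const, lintegral_const,
          lintegral_lintegral_swap hmf.aemeasurable]
    _ ≤ ∫⁻ x, C * I * T x ^ (-p⁻¹) ∂m +
          (∫⁻ x, T x ^ (-p⁻¹) ∂m) * shiftLaw n N ε univ := by
        refine add_le_add (lintegral_mono_ae ?_) le_rfl
        filter_upwards [hτ0, hτ1] with x hx hx1
        have hT0 : T x ≠ 0 := (ENNReal.ofReal_pos.2 hx).ne'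
        have hGx : Measurable fun w => G w x := hG.comp measurable_prodMk_right
        rw [lintegral_mul_const _ (hGx.pow_const p)]
        refine (mul_le_mul_left (H x ⟨hx, hx1⟩) _).trans (le_of_eq ?_)
        have h2 : ENNReal.ofReal (τ x)⁻¹ = T x ^ (-1 : ℝ) := by
          rw [ENNReal.ofReal_inv_of_pos hx, ENNReal.rpow_neg_one]
        have h3 : T x ^ (-1 : ℝ) * T x ^ r⁻¹ = T x ^ (-p⁻¹) := by
          rw [← ENNReal.rpow_add _ _ hT0 (hTt x)]
          congr 1
          have := hpr.inv_add_inv_eq_one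
          linarith
        rw [h2, ← h3]
        ring
    _ < ∞ := by
        rw [lintegral_const_mul _ (hTm.pow_const _)]
        have h1 : ∫⁻ x, T x ^ (-p⁻¹) ∂m ≠ ∞ := hτp
        have h2 : shiftLaw n N ε univ ≠ ∞ := measure_ne_top _ _
        finiteness

/-- For almost all parameters, the integral along a map `q`, moved by shifts whose last coordinates are
multiplied by the height `τ`, is finite. -/
lemma ae_lintegral_shiftAll_ne_top {N : ℕ} {b : Fin N → AdaptedBall n M D} {lam : Measure R}
    [SFinite lam] (h : ∀ i, (b i).Comparable lam) {ε : ℝ} (hε : ∀ i, ε ≤ (b i).size)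
    {p : ℝ} (hp : 1 < p) {f : R → ℝ≥0∞} (hf : Measurable f) (hfp : ∫⁻ x, f x ^ p ∂lam ≠ ∞)
    {X : Type*} [MeasurableSpace X] {m : Measure X} [SFinite m] {q : X → R} (hq : Measurable q)
    (hqr : ∀ x, q x ∈ reach ε N b) {τ : X → ℝ} (hτ : Measurable τ) (hτ1 : ∀ᵐ x ∂m, τ x ≤ 1)
    (hτp : ∫⁻ x, ENNReal.ofReal (τ x) ^ (-p⁻¹) ∂m ≠ ∞) :
    ∀ᵐ w ∂shiftLaw n N ε, ∫⁻ x, f (shiftAll N b (fun i => scaleLast n (τ x) (w i)) (q x)) ∂m ≠ ∞ := by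
  obtain ⟨C, hC, H⟩ := exists_lintegral_shiftLaw_le h hε
  set G : (Fin N → EuclideanSpace ℝ (Fin n)) → X → ℝ≥0∞ :=
    fun w x => f (shiftAll N b (fun i => scaleLast n (τ x) (w i)) (q x)) with hG
  have hGm : Measurable (Function.uncurry G) := by
    refine hf.comp (measurable_shiftAll b (measurable_pi_lambda _ fun i => ?_)
      (hq.comp measurable_snd))
    exact (hτ.comp measurable_snd).scaleLast ((measurable_pi_apply i).comp measurable_fst)
  have hfin := lintegral_lintegral_shiftAll_lt_top hC hfp hp hGm hτ hτ1 hτp fun x hx =>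
    H (q x) (hqr x) (τ x) hx (fun y => f y ^ p) (hf.pow_const p)
  have hmw : Measurable fun w => ∫⁻ x, G w x ∂m := hGm.lintegral_prod_right'
  filter_upwards [ae_lt_top hmw hfin.ne] with w hw
  exact hw.ne

end Average

end AdaptedBall

/-! ### Riemannian volume and surface measures -/

section Volume

variable {n : ℕ} {R : Type*} [TopologicalSpace R] [ChartedSpace (EuclideanSpace ℝ (Fin n)) R]

/-- On compact sets, the Lebesgue measures in two bilipschitz charts are comparable. -/
lemma exists_volume_image_chart_le [HasGroupoid R (lipschitzGroupoid n)]
    {φ ψ : OpenPartialHomeomorph R (EuclideanSpace ℝ (Fin n))} (hφ : φ ∈ lipCharts n R)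
    (hψ : ψ ∈ lipCharts n R) {K : Set R} (hK : IsCompact K) (hKφ : K ⊆ φ.source)
    (hKψ : K ⊆ ψ.source) :
    ∃ C : ℝ≥0∞, C ≠ ∞ ∧ ∀ A ⊆ K, volume (φ '' A) ≤ C * volume (ψ '' A) := by
  have hU : ∀ x ∈ K, ψ x ∈ (ψ.symm.trans φ).source := fun x hx => by simp [hKψ hx, hKφ hx]
  refine hK.induction_on (p := fun S => ∃ C : ℝ≥0∞, C ≠ ∞ ∧ ∀ A ⊆ S, volume (φ '' A) ≤
    C * volume (ψ '' A)) ⟨0, by simp, fun A hA => by simp [subset_empty_iff.1 hA]⟩ ?_ ?_ ?_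
  · rintro s t hst ⟨C, hC, H⟩
    exact ⟨C, hC, fun A hA => H A (hA.trans hst)⟩
  · rintro s t ⟨C, hC, H⟩ ⟨C', hC', H'⟩
    refine ⟨C + C', by finiteness, fun A hA => ?_⟩
    have e : A = (A ∩ s) ∪ (A ∩ t) := by rw [← inter_union_distrib_left, inter_eq_left.2 hA]
    calc volume (φ '' A) ≤ volume (φ '' (A ∩ s)) + volume (φ '' (A ∩ t)) := by
          conv_lhs => rw [e, image_union]
          exact measure_union_le _ _
      _ ≤ C * volume (ψ '' A) + C' * volume (ψ '' A) := by
          refine add_le_add ((H _ inter_subset_right).trans ?_) ((H' _ inter_subset_right).trans ?_)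
          all_goals
            gcongr
            exact inter_subset_left
      _ = _ := (add_mul _ _ _).symm
  · intro x hx
    obtain ⟨L, s, hs, hL⟩ := locallyLipschitzOn_transition hψ hφ (hU x hx)
    rw [(ψ.symm.trans φ).open_source.nhdsWithin_eq (hU x hx)] at hs
    refine ⟨ψ.source ∩ ψ ⁻¹' s, mem_nhdsWithin_of_mem_nhds (inter_mem
      (ψ.open_source.mem_nhds (hKψ hx)) ((ψ.continuousAt (hKψ hx)).preimage_mem_nhds hs)),
      L ^ n, by finiteness, fun A hA => ?_⟩
    have e : φ '' A = (φ ∘ ψ.symm) '' (ψ '' A) := by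
      rw [image_image]
      refine image_congr fun y hy => ?_
      simp [ψ.left_inv (hA hy).1]
    rw [e]
    refine (hL.mono ?_).volume_image_le
    rintro _ ⟨y, hy, rfl⟩
    exact (hA hy).2

lemma le_det_of_le_quadratic {c : ℝ} (hc : 0 ≤ c) {A : Matrix (Fin n) (Fin n) ℝ}
    (hA : A.IsHermitian) (h : ∀ v : Fin n → ℝ, c * (v ⬝ᵥ v) ≤ v ⬝ᵥ (A.mulVec v)) : c ^ n ≤ A.det := by
  rw [hA.det_eq_prod_eigenvalues]
  have : ∀ i, c ≤ hA.eigenvalues i := by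
    intro i
    have h1 := hA.eigenvalues_eq i
    have h2 := h (hA.eigenvectorBasis i)
    have h3 : (hA.eigenvectorBasis i : Fin n → ℝ) ⬝ᵥ (hA.eigenvectorBasis i) = 1 := by
      have := hA.eigenvectorBasis.orthonormal.1 i
      have h4 : inner ℝ (hA.eigenvectorBasis i) (hA.eigenvectorBasis i) = (1 : ℝ) := by
        rw [real_inner_self_eq_norm_sq, this, one_pow]
      rw [← h4, EuclideanSpace.inner_eq_star_dotProduct]
      simp
    rw [h3, mul_one] at h2
    rw [h1]
    simpa using h2
  calc c ^ n = ∏ _i : Fin n, c := by simp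
    _ ≤ ∏ i, hA.eigenvalues i := Finset.prod_le_prod (fun _ _ => hc) fun i _ => this i
    _ = _ := by simp

lemma LipRiemannianMetric.exists_le_density (g : LipRiemannianMetric n R)
    (φ : atlas (EuclideanSpace ℝ (Fin n)) R) :
    ∃ c : ℝ≥0∞, c ≠ 0 ∧ c ≠ ∞ ∧ ∀ᵐ x ∂volume.restrict φ.1.target, c ≤ g.density φ x := by
  obtain ⟨C, hC, H⟩ := g.comparable φ
  have hC0 : 0 < C := by linarith
  refine ⟨ENNReal.ofReal √(C⁻¹ ^ n), (ENNReal.ofReal_pos.2 (by positivity)).ne',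
    ENNReal.ofReal_ne_top, ?_⟩
  filter_upwards [H, g.symm φ] with x hx hs
  refine ENNReal.ofReal_le_ofReal (Real.sqrt_le_sqrt (le_det_of_le_quadratic (by positivity) ?_ ?_))
  · ext i j
    simp [Matrix.conjTranspose_apply, hs (EuclideanSpace.single j 1)]
  · intro v
    have h1 := (hx (WithLp.toLp 2 v)).1
    have h2 : ‖(WithLp.toLp 2 v : EuclideanSpace ℝ (Fin n))‖ ^ 2 = v ⬝ᵥ v := by
      rw [EuclideanSpace.norm_sq_eq]
      simp [dotProduct, sq]
    have e : (WithLp.toLp 2 v : EuclideanSpace ℝ (Fin n)) =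
        ∑ i, v i • EuclideanSpace.single i (1 : ℝ) := by
      simpa using ((EuclideanSpace.basisFun (Fin n) ℝ).sum_repr (WithLp.toLp 2 v)).symm
    have h3 : g.inChart φ x (WithLp.toLp 2 v) (WithLp.toLp 2 v) = v ⬝ᵥ ((Matrix.of fun i j : Fin n =>
        g.inChart φ x (EuclideanSpace.single i 1) (EuclideanSpace.single j 1)).mulVec v) := by
      rw [e]
      simp only [map_sum, map_smul, _root_.sum_apply, _root_.smul_apply,
        smul_eq_mul, dotProduct, Matrix.mulVec, Matrix.of_apply, Finset.mul_sum]
      rw [Finset.sum_comm]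
      refine Finset.sum_congr rfl fun i _ => Finset.sum_congr rfl fun j _ => ?_
      ring
    rwa [h2, h3] at h1

variable [MeasurableSpace R] [BorelSpace R] {M D : Set R}

lemma AdaptedBall.chartMeasure_apply (b : AdaptedBall n M D) {A : Set R} (hA : MeasurableSet A) :
    b.chartMeasure A = volume (b.chart '' (A ∩ b.carrier)) := by
  rw [chartMeasure, Measure.map_apply_of_aemeasurable b.aemeasurable_symm hA,
    Measure.restrict_apply' Metric.isClosed_closedBall.measurableSet]
  congr 1
  ext u
  constructor
  · rintro ⟨h1, h2⟩
    exact ⟨b.chart.symm u, ⟨h1, u, h2, rfl⟩, b.chart.right_inv (b.closedBall_subset h2)⟩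
  · rintro ⟨x, ⟨h1, h2⟩, rfl⟩
    have hs := b.carrier_subset_source h2
    refine ⟨?_, (b.mem_carrier_iff hs).1 h2⟩
    rwa [mem_preimage, b.chart.left_inv hs]

lemma AdaptedBall.comparable_sum [T2Space R] [HasGroupoid R (lipschitzGroupoid n)] {N : ℕ}
    (b : Fin N → AdaptedBall n M D) (i : Fin N) : (b i).Comparable (∑ j, (b j).chartMeasure) := by
  refine ⟨?_, ?_⟩
  · rw [← Finset.add_sum_erase _ _ (Finset.mem_univ i)]
    exact Measure.le_add_right le_rfl
  have H : ∀ j, ∃ C : ℝ≥0∞, C ≠ ∞ ∧ ∀ A ⊆ (b j).carrier ∩ (b i).carrier,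
      volume ((b j).chart '' A) ≤ C * volume ((b i).chart '' A) := fun j =>
    exists_volume_image_chart_le (b j).chart_mem (b i).chart_mem
      ((b j).isCompact_carrier.inter_right (b i).isClosed_carrier)
      (inter_subset_left.trans (b j).carrier_subset_source)
      (inter_subset_right.trans (b i).carrier_subset_source)
  choose C hC H using H
  refine ⟨∑ j, C j, ENNReal.sum_ne_top.2 fun j _ => hC j, Measure.le_iff.2 fun A hA => ?_⟩
  have hm := (b i).isClosed_carrier.measurableSet
  rw [Measure.restrict_apply hA, Measure.finsetSum_apply, Measure.smul_apply, smul_eq_mul,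
    Finset.sum_mul]
  refine Finset.sum_le_sum fun j _ => ?_
  rw [(b j).chartMeasure_apply (hA.inter hm), (b i).chartMeasure_apply hA]
  refine (H j _ fun x hx => ⟨hx.2, hx.1.2⟩).trans ?_
  refine mul_le_mul_right (measure_mono (image_mono ?_)) _
  exact inter_subset_left

/-- Only a lower bound for the Riemannian volume is needed; it comes from a single chart of the atlas. -/
lemma LipRiemannianMetric.exists_volume_image_le_vol (g : LipRiemannianMetric n R)
    (φ : atlas (EuclideanSpace ℝ (Fin n)) R) :
    ∃ C : ℝ≥0∞, C ≠ ∞ ∧ ∀ A ⊆ φ.1.source,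
      volume (φ.1 '' A) ≤ C * g.vol A := by
  obtain ⟨c, hc, hct, H⟩ := g.exists_le_density φ
  refine ⟨c⁻¹, ENNReal.inv_ne_top.2 hc, fun A hAφ => ?_⟩
  have h1 : AEMeasurable φ.1.symm ((volume.restrict φ.1.target).withDensity (g.density φ)) :=
    (φ.1.symm.continuousOn.aemeasurable φ.1.open_target.measurableSet).mono_ac
      (withDensity_absolutelyContinuous _ _)
  have h2 : c • volume.restrict φ.1.target ≤ (volume.restrict φ.1.target).withDensity (g.density φ) := by
    rw [← withDensity_const]
    exact withDensity_mono H
  have h3 : c * volume (φ.1 '' A) ≤ g.vol A := by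
    calc c * volume (φ.1 '' A) ≤ c * volume.restrict φ.1.target (φ.1.symm ⁻¹' A) := by
          refine mul_le_mul_right (le_trans (measure_mono (t := φ.1.symm ⁻¹' A ∩ φ.1.target) ?_)
            (Measure.le_restrict_apply _ _)) _
          rintro _ ⟨x, hx, rfl⟩
          refine ⟨?_, φ.1.map_source (hAφ hx)⟩
          rwa [mem_preimage, φ.1.left_inv (hAφ hx)]
      _ ≤ (volume.restrict φ.1.target).withDensity (g.density φ) (φ.1.symm ⁻¹' A) :=
          Measure.le_iff'.1 h2 _
      _ ≤ g.chartVol φ A := Measure.le_map_apply h1 A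
      _ ≤ g.vol A := Measure.le_iff'.1 (le_iSup g.chartVol φ) A
  rw [← ENNReal.div_eq_inv_mul, ENNReal.le_div_iff_mul_le (Or.inl hc) (Or.inl hct), mul_comm]
  exact h3

/-- The image of Lebesgue measure on a ball is bounded by the Riemannian volume. -/
lemma AdaptedBall.exists_chartMeasure_le_vol [T2Space R] [HasGroupoid R (lipschitzGroupoid n)]
    (b : AdaptedBall n M D) (g : LipRiemannianMetric n R) :
    ∃ C : ℝ≥0∞, C ≠ ∞ ∧ b.chartMeasure ≤ C • g.vol := by
  have : LocallyCompactSpace R := ChartedSpace.locallyCompactSpace (EuclideanSpace ℝ (Fin n)) R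
  have H : ∃ C : ℝ≥0∞, C ≠ ∞ ∧ ∀ A ⊆ b.carrier,
      volume (b.chart '' A) ≤ C * g.vol A := by
    refine b.isCompact_carrier.induction_on (p := fun S => ∃ C : ℝ≥0∞, C ≠ ∞ ∧ ∀ A ⊆ S,
      volume (b.chart '' A) ≤ C * g.vol A)
      ⟨0, by simp, fun A hA => by simp [subset_empty_iff.1 hA]⟩ ?_ ?_ ?_
    · rintro s t hst ⟨C, hC, H⟩
      exact ⟨C, hC, fun A hA => H A (hA.trans hst)⟩
    · rintro s t ⟨C, hC, H⟩ ⟨C', hC', H'⟩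
      refine ⟨C + C', by finiteness, fun A hA => ?_⟩
      have e : A = (A ∩ s) ∪ (A ∩ t) := by rw [← inter_union_distrib_left, inter_eq_left.2 hA]
      calc volume (b.chart '' A) ≤ volume (b.chart '' (A ∩ s)) + volume (b.chart '' (A ∩ t)) := by
            conv_lhs => rw [e, image_union]
            exact measure_union_le _ _
        _ ≤ C * g.vol A + C' * g.vol A := by
            refine add_le_add ((H _ inter_subset_right).trans ?_)
              ((H' _ inter_subset_right).trans ?_)
            all_goals
              gcongr
              exact inter_subset_left
        _ = _ := (add_mul _ _ _).symm
    · intro x hx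
      have hxb := b.carrier_subset_source hx
      set ψ := chartAt (EuclideanSpace ℝ (Fin n)) x with hψ
      have hxψ : x ∈ ψ.source := mem_chart_source _ x
      have hψa : ψ ∈ atlas (EuclideanSpace ℝ (Fin n)) R := chart_mem_atlas _ x
      obtain ⟨K, hKx, hKs, hK⟩ := LocallyCompactSpace.local_compact_nhds x (b.chart.source ∩ ψ.source)
        (inter_mem (b.chart.open_source.mem_nhds hxb) (ψ.open_source.mem_nhds hxψ))
      obtain ⟨C, hC, H⟩ := exists_volume_image_chart_le b.chart_mem
        ((lipschitzGroupoid n).chart_mem_maximalAtlas x) hK (hKs.trans inter_subset_left)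
        (hKs.trans inter_subset_right)
      obtain ⟨C', hC', H'⟩ := g.exists_volume_image_le_vol ⟨ψ, hψa⟩
      refine ⟨K, mem_nhdsWithin_of_mem_nhds hKx, C * C', by finiteness, fun A hA => ?_⟩
      rw [mul_assoc]
      refine (H A hA).trans ?_
      gcongr
      exact H' A (hA.trans (hKs.trans inter_subset_right))
  obtain ⟨C, hC, H⟩ := H
  refine ⟨C, hC, Measure.le_iff.2 fun A hA => ?_⟩
  rw [b.chartMeasure_apply hA, Measure.smul_apply, smul_eq_mul]
  refine (H _ inter_subset_right).trans ?_
  gcongr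
  exact inter_subset_left

end Volume

section Surface

variable {n k : ℕ} {R : Type*} [TopologicalSpace R] [ChartedSpace (EuclideanSpace ℝ (Fin n)) R]

lemma isClosed_stdSimplexR (k : ℕ) : IsClosed (stdSimplexR k) := by
  have : stdSimplexR k = (⋂ i, {x : EuclideanSpace ℝ (Fin k) | 0 ≤ x i}) ∩
      {x : EuclideanSpace ℝ (Fin k) | ∑ i, x i ≤ 1} := by
    ext x; simp [stdSimplexR]
  rw [this]
  exact (isClosed_iInter fun i => isClosed_le continuous_const (by fun_prop)).inter
    (isClosed_le (by fun_prop) continuous_const)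

lemma convex_stdSimplexR (k : ℕ) : Convex ℝ (stdSimplexR k) := by
  intro x hx y hy a b ha hb hab
  refine ⟨fun i => ?_, ?_⟩
  · have h1 := mul_nonneg ha (hx.1 i)
    have h2 := mul_nonneg hb (hy.1 i)
    simpa using add_nonneg h1 h2
  · have h1 := mul_le_mul_of_nonneg_left hx.2 ha
    have h2 := mul_le_mul_of_nonneg_left hy.2 hb
    simp only [PiLp.add_apply, PiLp.smul_apply, smul_eq_mul, Finset.sum_add_distrib,
      ← Finset.mul_sum]
    linarith

lemma apply_mem_Icc_of_mem_stdSimplexR {x : EuclideanSpace ℝ (Fin k)} (hx : x ∈ stdSimplexR k) (i) :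
    x i ∈ Icc (0 : ℝ) 1 :=
  ⟨hx.1 i, (Finset.single_le_sum (f := fun i => x i) (fun j _ => hx.1 j) (Finset.mem_univ i)).trans hx.2⟩

lemma isCompact_stdSimplexR (k : ℕ) : IsCompact (stdSimplexR k) := by
  refine Metric.isCompact_of_isClosed_isBounded (isClosed_stdSimplexR k) ?_
  refine Metric.isBounded_closedBall.subset (t := Metric.closedBall 0 (k * 1)) fun x hx => ?_
  rw [mem_closedBall_zero_iff]
  refine norm_le_of_forall_abs_le fun i => ?_
  have := apply_mem_Icc_of_mem_stdSimplexR hx i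
  rw [abs_of_nonneg this.1]
  exact this.2

lemma LipSimplex.extend_of_mem (σ : LipSimplex n k R) {x : EuclideanSpace ℝ (Fin k)}
    (hx : x ∈ stdSimplexR k) : σ.extend x = σ.toFun ⟨x, hx⟩ := dif_pos hx

lemma LipSimplex.extend_mem_range (σ : LipSimplex n k R) (x : EuclideanSpace ℝ (Fin k)) :
    σ.extend x ∈ range σ.toFun := by
  unfold extend
  split_ifs
  exacts [mem_range_self _, mem_range_self _]

lemma LipSimplex.measurable_extend [MeasurableSpace R] [BorelSpace R] (σ : LipSimplex n k R) :
    Measurable σ.extend := by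
  classical
  exact Measurable.dite (s := stdSimplexR k) σ.continuous_toFun.measurable measurable_const
    (isClosed_stdSimplexR k).measurableSet

lemma exists_jacobian_le (k n : ℕ) (C : ℝ) : ∃ B : ℝ≥0∞, B ≠ ∞ ∧
    ∀ (f : EuclideanSpace ℝ (Fin k) → EuclideanSpace ℝ (Fin n)) (x), ‖fderiv ℝ f x‖ ≤ C →
      jacobian f x ≤ B := by
  have : ProperSpace (EuclideanSpace ℝ (Fin k) →L[ℝ] EuclideanSpace ℝ (Fin n)) :=
    FiniteDimensional.proper ℝ _
  have hc : Continuous fun A : EuclideanSpace ℝ (Fin k) →L[ℝ] EuclideanSpace ℝ (Fin n) =>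
      √((ContinuousLinearMap.adjoint A).comp A).det := by
    refine Real.continuous_sqrt.comp (ContinuousLinearMap.continuous_det.comp ?_)
    exact (LinearIsometryEquiv.continuous _).clm_comp continuous_id
  obtain ⟨B, hB⟩ := (isCompact_closedBall (0 : EuclideanSpace ℝ (Fin k) →L[ℝ]
    EuclideanSpace ℝ (Fin n)) C).bddAbove_image hc.continuousOn
  refine ⟨ENNReal.ofReal B, ENNReal.ofReal_ne_top, fun f x hx => ENNReal.ofReal_le_ofReal ?_⟩
  exact hB ⟨fderiv ℝ f x, mem_closedBall_zero_iff.2 hx, rfl⟩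

/-- The derivative of a singular simplex in a chart is bounded on compact sets. At interior points of the
simplex the extension by a constant does not matter. -/
lemma LipSimplex.exists_norm_fderiv_le [HasGroupoid R (lipschitzGroupoid n)] (σ : LipSimplex n k R)
    {φ : OpenPartialHomeomorph R (EuclideanSpace ℝ (Fin n))} (hφ : φ ∈ lipCharts n R)
    {T : Set (EuclideanSpace ℝ (Fin k))} (hT : IsCompact T) (hTs : T ⊆ stdSimplexR k)
    (hTφ : MapsTo σ.extend T φ.source) :
    ∃ C : ℝ, ∀ x ∈ T ∩ interior (stdSimplexR k), ‖fderiv ℝ (φ ∘ σ.extend) x‖ ≤ C := by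
  refine hT.induction_on (p := fun S => ∃ C : ℝ, ∀ x ∈ S ∩ interior (stdSimplexR k),
    ‖fderiv ℝ (φ ∘ σ.extend) x‖ ≤ C) ⟨0, fun x hx => hx.1.elim⟩ ?_ ?_ ?_
  · rintro s t hst ⟨C, H⟩
    exact ⟨C, fun x hx => H x ⟨hst hx.1, hx.2⟩⟩
  · rintro s t ⟨C, H⟩ ⟨C', H'⟩
    refine ⟨max C C', fun x hx => ?_⟩
    rcases hx.1 with h | h
    exacts [(H x ⟨h, hx.2⟩).trans (le_max_left _ _), (H' x ⟨h, hx.2⟩).trans (le_max_right _ _)]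
  · intro x hx
    have hxφ := hTφ hx
    rw [σ.extend_of_mem (hTs hx)] at hxφ
    obtain ⟨K, t, ht, -, hK⟩ := σ.chartLipschitz.exists_lipschitzOnWith hφ hxφ
    obtain ⟨u, hu, hut⟩ := (mem_nhds_induced _ _ _).1 ht
    obtain ⟨O, hOu, hO, hxO⟩ := mem_nhds_iff.1 hu
    refine ⟨O, mem_nhdsWithin_of_mem_nhds (hO.mem_nhds hxO), K, fun y hy => ?_⟩
    refine norm_fderiv_le_of_lipschitzOn ℝ ((hO.inter isOpen_interior).mem_nhds hy) (C := K) ?_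
    intro z hz z' hz'
    have h1 := interior_subset hz.2
    have h2 := interior_subset hz'.2
    simp only [Function.comp, σ.extend_of_mem h1, σ.extend_of_mem h2]
    exact hK (hut (hOu hz.1)) (hut (hOu hz'.1))

/-- Integrals with respect to a surface measure are bounded by integrals over the simplex. -/
lemma IsSurfaceMeasure.lintegral_ne_top [HasGroupoid R (lipschitzGroupoid n)] [MeasurableSpace R]
    [BorelSpace R] {σ : LipSimplex n k R} {μ : Measure R} (h : IsSurfaceMeasure σ μ)
    {f : R → ℝ≥0∞} (hf : Measurable f) (hσ : ∫⁻ x in stdSimplexR k, f (σ.extend x) ≠ ∞) :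
    ∫⁻ y, f y ∂μ ≠ ∞ := by
  obtain ⟨N, T, φ, hT, hTu, -, hφ, hTφ, rfl⟩ := h
  rw [lintegral_finsetSum_measure]
  refine ENNReal.sum_ne_top.2 fun i _ => ?_
  have hTs : T i ⊆ stdSimplexR k := hTu ▸ subset_iUnion T i
  obtain ⟨C, hC⟩ := σ.exists_norm_fderiv_le (hφ i)
    ((isCompact_stdSimplexR k).of_isClosed_subset (hT i) hTs) hTs (hTφ i)
  obtain ⟨B, hB, HB⟩ := exists_jacobian_le k n C
  have hae : ∀ᵐ x ∂volume.restrict (T i), jacobian (φ i ∘ σ.extend) x ≤ B := by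
    have h1 : ∀ᵐ x ∂(volume : Measure (EuclideanSpace ℝ (Fin k))), x ∉ frontier (stdSimplexR k) :=
      measure_eq_zero_iff_ae_notMem.1 ((convex_stdSimplexR k).addHaar_frontier volume)
    filter_upwards [ae_restrict_mem (hT i).measurableSet, ae_restrict_of_ae h1] with x hx hx'
    refine HB _ _ (hC x ⟨hx, ?_⟩)
    by_contra hxi
    exact hx' ⟨subset_closure (hTs hx), hxi⟩
  rw [lintegral_map hf σ.measurable_extend]
  have hle : (volume.restrict (T i)).withDensity (jacobian (φ i ∘ σ.extend)) ≤
      B • volume.restrict (stdSimplexR k) := by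
    refine (withDensity_mono hae).trans ?_
    rw [withDensity_const]
    exact Measure.le_iff'.2 fun A => by
      simp only [Measure.smul_apply, smul_eq_mul]
      exact mul_le_mul_right (Measure.le_iff'.1 (Measure.restrict_mono hTs le_rfl) A) _
  refine ne_top_of_le_ne_top ?_ (lintegral_mono' hle le_rfl)
  rw [lintegral_smul_measure, smul_eq_mul]
  exact ENNReal.mul_ne_top hB hσ

/-- Powers of the last coordinate with exponents above `-1` are integrable on the simplex. -/
lemma lintegral_last_rpow_ne_top (k : ℕ) {r : ℝ} (hr : -1 < r) :
    ∫⁻ x in stdSimplexR (k + 1), ENNReal.ofReal (x (Fin.last k)) ^ r ≠ ∞ := by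
  have hmeas : Measurable fun t : ℝ => ENNReal.ofReal t ^ r :=
    ENNReal.measurable_ofReal.pow_const r
  have hprob : IsProbabilityMeasure ((volume : Measure ℝ).restrict (Icc 0 1)) :=
    ⟨by simp⟩
  have h1 := EuclideanSpace.volume_preserving_symm_measurableEquiv_toLp (Fin (k + 1))
  have hle : ∫⁻ x in stdSimplexR (k + 1), ENNReal.ofReal (x (Fin.last k)) ^ r ≤
      ∫⁻ y in univ.pi fun _ : Fin (k + 1) => Icc (0 : ℝ) 1, ENNReal.ofReal (y (Fin.last k)) ^ r := by
    rw [← h1.setLIntegral_comp_preimage_emb (MeasurableEquiv.measurableEmbedding _)]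
    refine lintegral_mono_set fun x hx i _ => ?_
    exact apply_mem_Icc_of_mem_stdSimplexR hx i
  have h2 := measurePreserving_eval (fun _ : Fin (k + 1) => (volume : Measure ℝ).restrict (Icc 0 1))
    (Fin.last k)
  refine ne_top_of_le_ne_top ?_ hle
  rw [volume_pi, Measure.restrict_pi_pi, h2.lintegral_comp hmeas]
  have h3 : IntegrableOn (fun t : ℝ => t ^ r) (Icc 0 1) := by
    have := (intervalIntegral.intervalIntegrable_rpow' (a := 0) (b := 1) hr).1
    rwa [← integrableOn_Icc_iff_integrableOn_Ioc] at this
  refine ne_top_of_le_ne_top h3.lintegral_lt_top.ne (le_of_eq ?_)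
  rw [← restrict_Ioc_eq_restrict_Icc]
  refine setLIntegral_congr_fun measurableSet_Ioc fun t ht => ?_
  exact ENNReal.ofReal_rpow_of_pos ht.1

end Surface

/-! ### Homology classes are not exceptional -/

/-- A family of modulus zero admits a single `p`-integrable function with infinite integrals. -/
lemma exists_lintegral_eq_top_of_fugledeModulus_eq_zero {X : Type*} [MeasurableSpace X] {p : ℝ}
    (hp : 0 < p) {μ : Measure X} {S : Set (Measure X)} (h : fugledeModulus p μ S = 0) :
    ∃ f : X → ℝ≥0∞, Measurable f ∧ ∫⁻ x, f x ^ p ∂μ ≠ ∞ ∧ ∀ ν ∈ S, ∫⁻ x, f x ∂ν = ∞ := by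
  -- the supremum of `2 ^ j * f j` works, if `f j` is admissible and `∫ (f j) ^ p` is small enough
  have hex : ∀ j : ℕ, ∃ f : {f : X → ℝ≥0∞ // Measurable f ∧ ∀ ν ∈ S, 1 ≤ ∫⁻ x, f x ∂ν},
      ((2 : ℝ≥0∞) ^ j) ^ p * ∫⁻ x, f.1 x ^ p ∂μ ≤ 2⁻¹ ^ j := by
    intro j
    have h0 : ((2 : ℝ≥0∞) ^ j) ^ p ≠ 0 := by
      rw [Ne, ENNReal.rpow_eq_zero_iff_of_pos hp]; simp
    have ht : ((2 : ℝ≥0∞) ^ j) ^ p ≠ ∞ := ENNReal.rpow_ne_top_of_nonneg hp.le (by finiteness)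
    have hpos : fugledeModulus p μ S < 2⁻¹ ^ j / ((2 : ℝ≥0∞) ^ j) ^ p := by
      rw [h]
      exact ENNReal.div_pos (by simp) ht
    obtain ⟨f, hf⟩ := iInf_lt_iff.1 hpos
    refine ⟨f, ?_⟩
    rw [mul_comm]
    exact (ENNReal.le_div_iff_mul_le (Or.inl h0) (Or.inl ht)).1 hf.le
  choose f hf using hex
  refine ⟨fun x => ⨆ j, 2 ^ j * (f j).1 x, Measurable.iSup fun j => (f j).2.1.const_mul _, ?_, ?_⟩
  · refine ne_top_of_le_ne_top (b := 2) (by simp) ?_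
    calc ∫⁻ x, (⨆ j, 2 ^ j * (f j).1 x) ^ p ∂μ
        ≤ ∫⁻ x, ∑' j, ((2 : ℝ≥0∞) ^ j) ^ p * (f j).1 x ^ p ∂μ := by
          refine lintegral_mono fun x => ?_
          have e := (ENNReal.orderIsoRpow p hp).map_iSup fun j => 2 ^ j * (f j).1 x
          simp only [ENNReal.orderIsoRpow_apply] at e
          rw [e]
          refine iSup_le fun j => ?_
          rw [ENNReal.mul_rpow_of_nonneg _ _ hp.le]
          exact ENNReal.le_tsum (f := fun j => ((2 : ℝ≥0∞) ^ j) ^ p * (f j).1 x ^ p) j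
      _ = ∑' j, ((2 : ℝ≥0∞) ^ j) ^ p * ∫⁻ x, (f j).1 x ^ p ∂μ := by
          rw [lintegral_tsum fun j => (((f j).2.1.pow_const p).const_mul _).aemeasurable]
          simp_rw [lintegral_const_mul _ ((f _).2.1.pow_const p)]
      _ ≤ ∑' j : ℕ, 2⁻¹ ^ j := ENNReal.tsum_le_tsum hf
      _ = 2 := by rw [ENNReal.tsum_geometric, ENNReal.one_sub_inv_two, inv_inv]
  · intro ν hν
    refine ENNReal.eq_top_of_forall_nnreal_le fun r => ?_
    obtain ⟨j, hj⟩ := exists_nat_gt r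
    calc (r : ℝ≥0∞) ≤ 2 ^ j := by
          have : (r : ℝ≥0∞) ≤ (j : ℝ≥0∞) := by exact_mod_cast hj.le
          refine this.trans ?_
          exact_mod_cast Nat.lt_two_pow_self.le
      _ ≤ 2 ^ j * ∫⁻ x, (f j).1 x ∂ν := le_mul_of_one_le_right' ((f j).2.2 ν hν)
      _ = ∫⁻ x, 2 ^ j * (f j).1 x ∂ν := (lintegral_const_mul _ (f j).2.1).symm
      _ ≤ _ := lintegral_mono fun x => le_iSup (fun j => 2 ^ j * (f j).1 x) j

section

variable {n k : ℕ} {R : Type*} [TopologicalSpace R] [ChartedSpace (EuclideanSpace ℝ (Fin n)) R]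
  {M D : Set R}

lemma lintegral_chainMeasure_ne_top [MeasurableSpace R] {K : Type*} [NormedCommRing K]
    {m : LipSimplex n k R → Measure R} {f : R → ℝ≥0∞} {s : LipChain n k R K}
    (h : s ∈ Finsupp.supported K K {σ | ∫⁻ x, f x ∂m σ ≠ ∞}) :
    ∫⁻ x, f x ∂chainMeasure m s ≠ ∞ := by
  rw [chainMeasure, Finsupp.sum, lintegral_finsetSum_measure]
  refine ENNReal.sum_ne_top.2 fun σ hσ => ?_
  rw [lintegral_smul_measure, smul_eq_mul]
  exact ENNReal.mul_ne_top enorm_ne_top ((Finsupp.mem_supported _ _).1 h hσ)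

lemma exists_adaptedBalls [T2Space R] (hb : ∀ x, ∃ b : AdaptedBall n M D, x ∈ b.core)
    {K : Set R} (hK : IsCompact K) :
    ∃ (N : ℕ) (b : Fin N → AdaptedBall n M D) (ε : ℝ), 0 < ε ∧ (∀ i, ε ≤ (b i).size) ∧
      K ⊆ AdaptedBall.reach ε N b := by
  have : LocallyCompactSpace R := ChartedSpace.locallyCompactSpace (EuclideanSpace ℝ (Fin n)) R
  choose b hb using hb
  obtain ⟨t, ht⟩ := hK.elim_finite_subcover (fun x => (b x).core) (fun x => (b x).isOpen_core)
    fun x _ => mem_iUnion.2 ⟨x, hb x⟩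
  set e := t.equivFin
  set b' : Fin t.card → AdaptedBall n M D := fun i => b (e.symm i) with hb'
  obtain ⟨ε₀, hε₀, H⟩ := AdaptedBall.exists_subset_reach b' hK fun x hx => by
    obtain ⟨y, hy, hxy⟩ := mem_iUnion₂.1 (ht hx)
    refine mem_iUnion.2 ⟨e ⟨y, hy⟩, ?_⟩
    simpa [hb'] using hxy
  obtain ⟨ε₁, hε₁, H₁⟩ : ∃ ε₁ > 0, ∀ i, ε₁ ≤ (b' i).size := by
    obtain h | h := isEmpty_or_nonempty (Fin t.card)
    · exact ⟨1, one_pos, fun i => h.elim i⟩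
    · obtain ⟨i, hi⟩ := Finite.exists_min fun i => (b' i).size
      exact ⟨_, (b' i).size_pos, hi⟩
  exact ⟨t.card, b', min ε₀ ε₁, lt_min hε₀ hε₁, fun i => (min_le_right _ _).trans (H₁ i),
    H _ (min_le_left _ _)⟩

namespace AdaptedBall

/-- The homotopy from the identity to the composition of the shifts with vanishing last coordinates. It
preserves `M` and `D`. -/
def tangentialHomotopy {N : ℕ} (b : Fin N → AdaptedBall n M D) (w : Fin N → EuclideanSpace ℝ (Fin n))
    (t : ℝ) (x : R) : R :=
  shiftAll N b (fun i => t • scaleLast n 0 (w i)) x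

/-- The homotopy of the compositions of shifts given by the increase of the last coordinates. It preserves `M`,
and moves `D` into `M`. -/
def normalHomotopy {N : ℕ} (b : Fin N → AdaptedBall n M D) (w : Fin N → EuclideanSpace ℝ (Fin n))
    (t : ℝ) (x : R) : R :=
  shiftAll N b (fun i => scaleLast n t (w i)) x

variable {N : ℕ} (b : Fin N → AdaptedBall n M D) (w : Fin N → EuclideanSpace ℝ (Fin n))
  [T2Space R] [HasGroupoid R (lipschitzGroupoid n)]

lemma isLipHomotopy_tangentialHomotopy : IsLipHomotopy n (tangentialHomotopy b w) := by
  intro k a f ha hf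
  refine chartLipschitz_shiftAll b hf fun i => ?_
  have h : ContDiff ℝ 1 fun t : ℝ => t • scaleLast n 0 (w i) := by fun_prop
  exact h.locallyLipschitz.comp ha

lemma isLipHomotopy_normalHomotopy : IsLipHomotopy n (normalHomotopy b w) := by
  intro k a f ha hf
  exact chartLipschitz_shiftAll b hf fun i => (locallyLipschitz_scaleLast (w i)).comp ha

variable [SecondCountableTopology R] [MeasurableSpace R] [BorelSpace R]

lemma ae_lintegral_prismSimplex_ne_top {lam : Measure R} [SFinite lam]
    (h : ∀ i, (b i).Comparable lam) {ε : ℝ} (hε : ∀ i, ε ≤ (b i).size)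
    {p : ℝ} (hp : 1 < p) {f : R → ℝ≥0∞} (hf : Measurable f) (hfp : ∫⁻ x, f x ^ p ∂lam ≠ ∞)
    {σ : LipSimplex n k R} (hσ : range σ.toFun ⊆ reach ε N b) {m : ℕ}
    (θ : Fin (m + 1) → Fin (k + 1)) {ρ : Fin (m + 1) → ℝ} (hρ : ∀ i, ρ i ∈ Icc (0 : ℝ) 1)
    (hρp : ∫⁻ x in stdSimplexR m, ENNReal.ofReal (simplexHeight ρ x) ^ (-p⁻¹) ≠ ∞) :
    ∀ᵐ w ∂shiftLaw n N ε, ∫⁻ x in stdSimplexR m, f ((prismSimplex _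
      (isLipHomotopy_normalHomotopy b w) σ θ ρ).extend x) ≠ ∞ := by
  have hmeas := (isClosed_stdSimplexR m).measurableSet
  have h1 := ae_lintegral_shiftAll_ne_top h hε hp hf hfp (m := volume.restrict (stdSimplexR m))
    (q := fun x => σ.extend (simplexMap θ x))
    (σ.measurable_extend.comp (contDiff_simplexMap θ).continuous.measurable)
    (fun x => hσ (σ.extend_mem_range _)) (contDiff_simplexHeight ρ).continuous.measurable
    (by
      filter_upwards [ae_restrict_mem hmeas] with x hx
      exact (simplexHeight_mem_Icc hρ hx).2) hρp
  filter_upwards [h1] with w hw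
  refine ne_of_eq_of_ne (setLIntegral_congr_fun hmeas fun x hx => ?_) hw
  simp only [LipSimplex.extend_of_mem _ hx, LipSimplex.extend_of_mem _ (simplexMap_mem θ hx)]
  rfl

/-- The last vertex of each simplex of the prism has the height `1`, hence the height is at least the last
coordinate. -/
lemma lintegral_prismHeight_ne_top {p : ℝ} (hp : 1 < p) (i : Fin (k + 1)) :
    ∫⁻ x in stdSimplexR (k + 1), ENNReal.ofReal (simplexHeight (prismHeight i) x) ^ (-p⁻¹) ≠ ∞ := by
  have hp' : -1 < -p⁻¹ := neg_lt_neg (inv_lt_one_of_one_lt₀ hp)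
  refine ne_top_of_le_ne_top (lintegral_last_rpow_ne_top k hp') ?_
  refine setLIntegral_mono' (isClosed_stdSimplexR _).measurableSet fun x hx => ?_
  rw [ENNReal.rpow_neg, ENNReal.rpow_neg]
  refine ENNReal.inv_le_inv.2 (ENNReal.rpow_le_rpow (ENNReal.ofReal_le_ofReal ?_)
    (inv_nonneg.2 (by linarith)))
  have h1 : prismHeight i (Fin.last (k + 1)) * bary x (Fin.last (k + 1)) = x (Fin.last k) := by
    rw [prismHeight, if_pos (Fin.castSucc_lt_last i), one_mul, ← Fin.succ_last, bary_succ]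
  rw [← h1]
  exact Finset.single_le_sum (f := fun j => prismHeight i j * bary x j)
    (fun j _ => mul_nonneg (prismHeight_mem_Icc i j).1 (bary_nonneg hx j)) (Finset.mem_univ _)

lemma ae_deformChain_mem_supported {K : Type*} [CommRing K] {lam : Measure R} [SFinite lam]
    (h : ∀ i, (b i).Comparable lam) {ε : ℝ} (hε : ∀ i, ε ≤ (b i).size)
    {p : ℝ} (hp : 1 < p) {f : R → ℝ≥0∞} (hf : Measurable f) (hfp : ∫⁻ x, f x ^ p ∂lam ≠ ∞)
    {s : LipChain n k R K} (hs : s ∈ chainsIn n k K (reach ε N b)) :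
    ∀ᵐ w ∂shiftLaw n N ε, deformChain (isLipHomotopy_normalHomotopy b w) k s ∈
      Finsupp.supported K K {σ | ∫⁻ x in stdSimplexR k, f (σ.extend x) ≠ ∞} := by
  have h1 : ∀ᵐ w ∂shiftLaw n N ε, pushChain (isLipHomotopy_normalHomotopy b w) K 1 k s ∈
      Finsupp.supported K K {σ | ∫⁻ x in stdSimplexR k, f (σ.extend x) ≠ ∞} := by
    have h2 := (Filter.eventually_all_finset s.support).2 fun σ hσ =>
      ae_lintegral_prismSimplex_ne_top b h hε hp hf hfp
        ((Finsupp.mem_supported _ _).1 hs hσ) (m := k) id (ρ := fun _ => 1) (by simp)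
        (by simpa [simplexHeight_const] using (isCompact_stdSimplexR k).measure_lt_top.ne)
    filter_upwards [h2] with w hw
    exact pushChain_mem_supported _ hw
  cases k with
  | zero => exact h1
  | succ k =>
    have h2 := (Filter.eventually_all_finset (lipBoundary n k R K s).support).2 fun σ hσ =>
      Filter.eventually_all.2 fun i : Fin (k + 1) =>
        ae_lintegral_prismSimplex_ne_top b h hε hp hf hfp
          ((Finsupp.mem_supported _ _).1 (lipBoundary_mem_chainsIn hs) hσ) i.predAbove
          (prismHeight_mem_Icc i) (lintegral_prismHeight_ne_top hp i)
    filter_upwards [h1, h2] with w hw1 hw2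
    exact Submodule.sub_mem _ hw1 (prismOp_mem_supported _ hw2)

end AdaptedBall

lemma lastCoord_smul_scaleLast_zero (t : ℝ) (w : EuclideanSpace ℝ (Fin n)) :
    lastCoord n (t • scaleLast n 0 w) = 0 := by
  cases n
  · rfl
  · simp [lastCoord, scaleLast_apply]

lemma isCompact_iUnion_range {K : Type*} [CommRing K] (s : LipChain n k R K) :
    IsCompact (⋃ σ ∈ s.support, range σ.toFun) := by
  have : CompactSpace (stdSimplexR k) := isCompact_iff_compactSpace.1 (isCompact_stdSimplexR k)
  exact s.support.isCompact_biUnion fun σ _ => isCompact_range σ.continuous_toFun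

variable [T2Space R] [SecondCountableTopology R] [MeasurableSpace R] [BorelSpace R]
  [HasGroupoid R (lipschitzGroupoid n)]

/-- A homology class is not exceptional, whenever `R` is covered by the cores of adapted balls. -/
theorem not_isPExceptional_chains {K : Type*} [NormedCommRing K] (g : LipRiemannianMetric n R)
    (hDM : D ⊆ M) (hb : ∀ x, ∃ b : AdaptedBall n M D, x ∈ b.core) {p : ℝ} (hp : 1 < p)
    (c : LipHomology n k K M D) : ¬ IsPExceptional g p (LipHomology.chains c) := by
  rintro ⟨m, hm, hmod⟩
  obtain ⟨f, hf, hfp, hftop⟩ :=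
    exists_lintegral_eq_top_of_fugledeModulus_eq_zero (by linarith) hmod
  obtain ⟨s, hs, hsc⟩ := Submodule.mem_map.1 c.2
  obtain ⟨N, b, ε, hε, hεb, hreach⟩ := exists_adaptedBalls hb (isCompact_iUnion_range s)
  have hsr : s ∈ chainsIn n k K (AdaptedBall.reach ε N b) := (Finsupp.mem_supported _ _).2
    fun σ hσ => (subset_biUnion_of_mem (u := fun σ : LipSimplex n k R => range σ.toFun) hσ).trans hreach
  set lam : Measure R := ∑ j, (b j).chartMeasure with hlam
  have : SFinite lam := by
    refine Finset.sum_induction _ SFinite (fun _ _ _ _ => inferInstance) inferInstance fun j _ => ?_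
    unfold AdaptedBall.chartMeasure
    infer_instance
  have hlamp : ∫⁻ x, f x ^ p ∂lam ≠ ∞ := by
    rw [hlam, lintegral_finsetSum_measure]
    refine ENNReal.sum_ne_top.2 fun j _ => ?_
    obtain ⟨C, hC, H⟩ := (b j).exists_chartMeasure_le_vol g
    refine ne_top_of_le_ne_top ?_ (lintegral_mono' H le_rfl)
    rw [lintegral_smul_measure, smul_eq_mul]
    exact ENNReal.mul_ne_top hC hfp
  have hae := AdaptedBall.ae_deformChain_mem_supported b (AdaptedBall.comparable_sum b) hεb hp hf
    hlamp hsr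
  have : NeBot (ae (AdaptedBall.shiftLaw n N ε)) := ae_neBot.2 (AdaptedBall.shiftLaw_ne_zero n N hε)
  obtain ⟨w, hw⟩ := hae.exists
  have hdef := deformChain_equiv (AdaptedBall.isLipHomotopy_tangentialHomotopy b w)
    (AdaptedBall.isLipHomotopy_normalHomotopy b w)
    (fun x => by simpa [AdaptedBall.tangentialHomotopy] using AdaptedBall.shiftAll_zero N b x)
    (fun x => by simp [AdaptedBall.tangentialHomotopy, AdaptedBall.normalHomotopy])
    (fun _ _ _ hx => AdaptedBall.shiftAll_mem_left b _ hx)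
    (fun _ _ _ hx => AdaptedBall.shiftAll_mem_right b (fun i => lastCoord_smul_scaleLast_zero _ _) hx)
    (fun _ _ _ hx => AdaptedBall.shiftAll_mem_left b _ hx) hDM hs
  refine lintegral_chainMeasure_ne_top (m := m) (f := f) (Finsupp.supported_mono ?_ hw)
    (hftop _ (mem_image_of_mem _ ⟨hdef.1, ?_⟩))
  · exact fun σ hσ => (hm σ).lintegral_ne_top hf hσ
  · rw [← hsc]
    exact (Submodule.Quotient.eq _).2 hdef.2

end

end
theorem proposition6p1 {n : ℕ} {R : Type*} [TopologicalSpace R] [T2Space R]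
    [SecondCountableTopology R] [MeasurableSpace R] [BorelSpace R]
    [ChartedSpace (EuclideanSpace ℝ (Fin n)) R] [HasGroupoid R (lipschitzGroupoid n)]
    (g : LipRiemannianMetric n R) (M : Set R) (hM : IsClosedLipSubmanifold (lipCharts n R) M)
    (D : Set (frontier M)) (hD : IsClosedLipSubmanifold (boundaryLipCharts n M) D)
    (p : ℝ) (hp : 1 < p) (k : ℕ) :
    (∀ c : LipHomology n k ℤ M (Subtype.val '' D), ¬ IsPExceptional g p (LipHomology.chains c)) ∧
    (∀ c : LipHomology n k ℝ M (Subtype.val '' D), ¬ IsPExceptional g p (LipHomology.chains c)) := by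
  have hb := exists_adaptedBall hM hD
  have hDM : Subtype.val '' D ⊆ M := by
    rintro _ ⟨x, -, rfl⟩
    exact hM.1.frontier_subset x.2
  exact ⟨not_isPExceptional_chains g hDM hb hp, not_isPExceptional_chains g hDM hb hp⟩
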